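/- Let $\mathcal P\subset\mathbb R^d$ be a convex body (convex, compact, with non-empty interior, not necessarily centrally symmetric) and let $\mathcal L\subset\mathbb R^d$ be a set of losses with $\langle p,\ell\rangle\le 1$ for all $p\in\mathcal P$, $\ell\in\mathcal L$; if $0\notin\mathcal P$, assume also that $\langle p,\ell\rangle\ge -1$ for all $p\in\mathcal P$, $\ell\in\mathcal L$. For strategies $p_1,\dots,p_T\in\mathcal P$ and losses $\ell_1,\dots,\ell_T\in\mathcal L$ let $$\mathsf{LinearSwapReg}_T=\sum_{t=1}^T\langle \ell_t,p_t\rangle-\min_{\phi}\sum_{t=1}^T\langle \ell_t,\phi(p_t)\rangle ,$$ where $\phi$ ranges over the linear maps $\mathbb R^d\to\mathbb R^d$ (no affine part) with $\phi(\mathcal P)\subseteq\mathcal P$. There are a universal constant $C$, a universal polynomial $q$ and a single deterministic online algorithm with the following property. The algorithm is given $d$, $T$, the information whether $0\in\mathcal P$, and access to $\mathcal P$ through a linear optimization oracle (which for $c\in\mathbb R^d$ returns some minimizer of $\langle c,\cdot\rangle$ over $\mathcal P$). For all $d$, $T$, $\mathcal P$, $\mathcal L$ as above and every sequence $\ell_1,\dots,\ell_T\in\mathcal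 L$, where $\ell_t$ is revealed after $p_t$ is played, it plays $p_1,\dots,p_T\in\mathcal P$ with $$\mathsf{LinearSwapReg}_T\le C\,d^{3/2}\sqrt T .$$ It is computationally efficient: on a real random access machine (unit-cost arithmetic operations $+,-,\times,/,\sqrt{\ }$ and comparisons on real numbers, integer registers with $+,-,\times$ and comparisons for indexing, and oracle calls charged $d+1$ steps), the preprocessing before the first round and the computation in each round take at most $q(d,T)$ steps. -/

import Mathlib

open scoped RealInnerProductSpace

/-! ### Linear swap regret -/

/-- The linear endomorphisms of `P`: linear maps (without an affine part) that send `P` into `P`. -/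
def linearEndomorphisms {d : ℕ} (P : Set (EuclideanSpace ℝ (Fin d))) :
    Set (EuclideanSpace ℝ (Fin d) →ₗ[ℝ] EuclideanSpace ℝ (Fin d)) :=
  {φ | Set.MapsTo φ P P}

/-- The linear swap regret after `T` rounds of the strategies `p 0, …, p (T - 1)` against the losses
`ℓ 0, …, ℓ (T - 1)`: the cumulative loss, minus the least cumulative loss that a fixed linear
endomorphism of `P`, applied to all strategies in hindsight, would have produced. -/
noncomputable def linearSwapRegret {d : ℕ} (P : Set (EuclideanSpace ℝ (Fin d))) (T : ℕ)
    (p ℓ : ℕ → EuclideanSpace ℝ (Fin d)) : ℝ :=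
  (∑ t ∈ Finset.range T, ⟪ℓ t, p t⟫) -
    sInf ((fun φ : EuclideanSpace ℝ (Fin d) →ₗ[ℝ] EuclideanSpace ℝ (Fin d) =>
      ∑ t ∈ Finset.range T, ⟪ℓ t, φ (p t)⟫) '' linearEndomorphisms P)

/-- `o` is a linear optimization oracle for `P`: for each direction `c` it returns a point of `P`
that minimizes `⟪c, ·⟫` over `P` (ties are broken arbitrarily). -/
def IsLinearOptimizationOracle {d : ℕ} (P : Set (EuclideanSpace ℝ (Fin d)))
    (o : EuclideanSpace ℝ (Fin d) → EuclideanSpace ℝ (Fin d)) : Prop :=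
  ∀ c, o c ∈ P ∧ ∀ p ∈ P, ⟪c, o c⟫ ≤ ⟪c, p⟫

/-! ### A real random access machine with a linear optimization oracle

Programs are finite and mention only natural-number constants, so one program serves all dimensions,
horizons and strategy sets.  Memory consists of integer registers and of arrays of real numbers.
Every arithmetic operation, memory access and comparison has unit cost. -/

namespace RealRAM

/-- Integer expressions; `sub` is truncated subtraction. -/
inductive NatExpr : Type
  | const (c : ℕ) : NatExpr
  | var (x : ℕ) : NatExpr
  | add (e f : NatExpr) : NatExpr
  | sub (e f : NatExpr) : NatExpr
  | mul (e f : NatExpr) : NatExpr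

/-- Real expressions; `read a i` is the entry with index `i` of the array `a`. -/
inductive RealExpr : Type
  | ofNat (e : NatExpr) : RealExpr
  | read (a : ℕ) (i : NatExpr) : RealExpr
  | add (e f : RealExpr) : RealExpr
  | sub (e f : RealExpr) : RealExpr
  | mul (e f : RealExpr) : RealExpr
  | div (e f : RealExpr) : RealExpr
  | sqrt (e : RealExpr) : RealExpr

/-- Programs.
* `setNat x e` : `x := e` for an integer register `x`;
* `setReal a i e` : `a[i] := e` for an array `a` of reals;
* `ifNat e f c₁ c₂`, `ifReal e f c₁ c₂` : if `e ≤ f` then `c₁` else `c₂`;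
* `loop x e c` : evaluate `e` to `n`, then run `c` for `x = 0, 1, …, n - 1`;
* `oracle a b` : query the linear optimization oracle at the vector stored in the array `a`, and
  store the answer in the array `b`. -/
inductive Program : Type
  | skip : Program
  | setNat (x : ℕ) (e : NatExpr) : Program
  | setReal (a : ℕ) (i : NatExpr) (e : RealExpr) : Program
  | seq (c₁ c₂ : Program) : Program
  | ifNat (e f : NatExpr) (c₁ c₂ : Program) : Program
  | ifReal (e f : RealExpr) (c₁ c₂ : Program) : Program
  | loop (x : ℕ) (e : NatExpr) (c : Program) : Program
  | oracle (a b : ℕ) : Program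

/-- Memory contents. -/
structure Memory : Type where
  /-- the integer registers -/
  nat : ℕ → ℕ
  /-- the arrays of real numbers -/
  arr : ℕ → ℕ → ℝ

/-- Write `v` to the integer register `x`. -/
def Memory.setNat (m : Memory) (x v : ℕ) : Memory :=
  { m with nat := Function.update m.nat x v }

/-- Write `v` to the entry `i` of the array `a`. -/
noncomputable def Memory.setReal (m : Memory) (a i : ℕ) (v : ℝ) : Memory :=
  { m with arr := Function.update m.arr a (Function.update (m.arr a) i v) }

/-- The vector in `ℝ^d` that is stored in the entries `0, …, d - 1` of the array `a`. -/
noncomputable def Memory.load {d : ℕ} (m : Memory) (a : ℕ) : EuclideanSpace ℝ (Fin d) :=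
  WithLp.toLp 2 fun i : Fin d => m.arr a i

/-- Store the vector `v` in the entries `0, …, d - 1` of the array `a`. -/
noncomputable def Memory.store {d : ℕ} (m : Memory) (a : ℕ) (v : EuclideanSpace ℝ (Fin d)) :
    Memory :=
  { m with arr := Function.update m.arr a fun j => if h : j < d then v ⟨j, h⟩ else m.arr a j }

/-- Value of an integer expression. -/
def NatExpr.eval (m : Memory) : NatExpr → ℕ
  | .const c => c
  | .var x => m.nat x
  | .add e f => e.eval m + f.eval m
  | .sub e f => e.eval m - f.eval m
  | .mul e f => e.eval m * f.eval m

/-- Number of operations needed to evaluate an integer expression. -/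
def NatExpr.cost : NatExpr → ℕ
  | .const _ => 1
  | .var _ => 1
  | .add e f => e.cost + f.cost + 1
  | .sub e f => e.cost + f.cost + 1
  | .mul e f => e.cost + f.cost + 1

/-- Value of a real expression. -/
noncomputable def RealExpr.eval (m : Memory) : RealExpr → ℝ
  | .ofNat e => (e.eval m : ℝ)
  | .read a i => m.arr a (i.eval m)
  | .add e f => e.eval m + f.eval m
  | .sub e f => e.eval m - f.eval m
  | .mul e f => e.eval m * f.eval m
  | .div e f => e.eval m / f.eval m
  | .sqrt e => Real.sqrt (e.eval m)

/-- Number of operations needed to evaluate a real expression. -/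
def RealExpr.cost : RealExpr → ℕ
  | .ofNat e => e.cost + 1
  | .read _ i => i.cost + 1
  | .add e f => e.cost + f.cost + 1
  | .sub e f => e.cost + f.cost + 1
  | .mul e f => e.cost + f.cost + 1
  | .div e f => e.cost + f.cost + 1
  | .sqrt e => e.cost + 1

/-- `iter f n x` applies `f 0`, `f 1`, …, `f (n - 1)` to `x`, in this order. -/
def iter {α : Type} (f : ℕ → α → α) : ℕ → α → α
  | 0, x => x
  | n + 1, x => f n (iter f n x)

open Classical in
/-- Execution of a program in dimension `d` with oracle `o`, started from a given memory: the final
memory, and the number of steps.  An oracle call is charged `d + 1` steps. -/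
noncomputable def exec {d : ℕ} (o : EuclideanSpace ℝ (Fin d) → EuclideanSpace ℝ (Fin d)) :
    Program → Memory → Memory × ℕ
  | .skip, m => (m, 1)
  | .setNat x e, m => (m.setNat x (e.eval m), e.cost + 1)
  | .setReal a i e, m => (m.setReal a (i.eval m) (e.eval m), i.cost + e.cost + 1)
  | .seq c₁ c₂, m => ((exec o c₂ (exec o c₁ m).1).1, (exec o c₁ m).2 + (exec o c₂ (exec o c₁ m).1).2)
  | .ifNat e f c₁ c₂, m =>
      let r := if e.eval m ≤ f.eval m then exec o c₁ m else exec o c₂ m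
      (r.1, e.cost + f.cost + 1 + r.2)
  | .ifReal e f c₁ c₂, m =>
      let r := if e.eval m ≤ f.eval m then exec o c₁ m else exec o c₂ m
      (r.1, e.cost + f.cost + 1 + r.2)
  | .loop x e c, m =>
      iter (fun k r => ((exec o c (r.1.setNat x k)).1, r.2 + 1 + (exec o c (r.1.setNat x k)).2))
        (e.eval m) (m, e.cost + 1)
  | .oracle a b, m => (m.store b (o (m.load a)), d + 1)

/-! ### Online algorithms -/

/-- An online algorithm: a program that is run once before the first round, and a program that is
run in every round. -/
structure OnlineAlgorithm : Type where
  /-- preprocessing -/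
  init : Program
  /-- computation of the next strategy -/
  step : Program

open Classical in
/-- The initial memory: register `0` holds the dimension, register `1` the horizon, and register `2`
tells whether the origin lies in `P`; everything else is `0`. -/
noncomputable def initialMemory {d : ℕ} (T : ℕ) (P : Set (EuclideanSpace ℝ (Fin d))) : Memory where
  nat := fun x =>
    if x = 0 then d else if x = 1 then T else if x = 2 then (if (0 : EuclideanSpace ℝ (Fin d)) ∈ P then 1 else 0) else 0
  arr := fun _ _ => 0

namespace OnlineAlgorithm

variable {d : ℕ} (A : OnlineAlgorithm) (T : ℕ) (P : Set (EuclideanSpace ℝ (Fin d)))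
  (o : EuclideanSpace ℝ (Fin d) → EuclideanSpace ℝ (Fin d)) (ℓ : ℕ → EuclideanSpace ℝ (Fin d))

/-- The memory at the beginning of round `t` (rounds are numbered from `0`).  At the end of round `t`
the loss `ℓ t` is revealed: it is stored in array `1`. -/
noncomputable def memory : ℕ → Memory
  | 0 => (exec o A.init (initialMemory T P)).1
  | t + 1 => (exec o A.step (memory t)).1.store 1 (ℓ t)

/-- The strategy played in round `t`: the contents of array `0` when the computation of this round
ends.  It depends only on the losses of the earlier rounds. -/
noncomputable def strategy (t : ℕ) : EuclideanSpace ℝ (Fin d) :=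
  (exec o A.step (A.memory T P o ℓ t)).1.load 0

/-- Number of steps of the preprocessing. -/
noncomputable def initCost : ℕ := (exec o A.init (initialMemory T P)).2

/-- Number of steps in round `t`. -/
noncomputable def roundCost (t : ℕ) : ℕ := (exec o A.step (A.memory T P o ℓ t)).2

end OnlineAlgorithm

end RealRAM

/-!
If the origin is a strategy, playing it in every round has regret zero, because linear maps fix it.
In the other case all losses take values in `[-1, 1]` on `P`, and the algorithm works as follows.

*Coordinates.*  The preprocessing computes a `2`-approximate barycentric spanner: a basis of points
`b i` of `P` such that all coordinates of points of `P` are at most `2` in absolute value.  A first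
pass replaces every standard basis vector by a maximizer of its coordinate functional, after which
the determinant is within the factor `d!` of the optimum (`IsFirstPass.det_le`); hence only `d²`
later passes can double it, whatever the shape of `P` is (`IsLaterPass.abs_le_two`).

*Regret.*  In coordinates, with `u` for the strategy and `l` for the loss, the regret with respect to
an endomorphism `Y` is the sum of `G ⬝ᵥ (1 - Y)` over the outer products `G = l uᵀ`.  The algorithm
runs gradient descent on a matrix `X` and plays an approximate fixed point `u ≈ X u`, so that
`G ⬝ᵥ 1 ≈ G ⬝ᵥ X`.  In the Euclidean norm of matrices the gradients can have the squared norm `d²`,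
which would only give the rate `d² √T`.  Therefore the norm is changed by a rank-one update
`V ↦ V + G Gᵀ` whenever the squared dual norm of `G` exceeds `d`.  Each update multiplies `det V` by
at least `1 + d` and adds at most `4 d²` to the trace, so there are fewer than `8 d²` of them
(`update_count_lt`); each adds at most `9` to the squared distances to the endomorphisms, since
`G ⬝ᵥ (X - Y)` is a difference of losses of strategies.  So the squared distances stay `O(d²)`, the
squared dual norms of the gradients are at most `d`, and the regret is `O(d^(3/2) √T)`
(`IsRoundState.reg_le`).

*Fixed points.*  A perceptron collects points `v` of `P` that minimize `⟨S, v - X v⟩`, where `S` is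
the sum of the displacements so far.  As long as these values are at most `1`, the norm of `S` grows
like the square root of the number of points, and the average of the points becomes an approximate
fixed point.  Otherwise `⟨S, u - X u⟩ > 1` for all `u` in `P`; at the minimizer `w` of `⟨S, ·⟩` every
endomorphism `Y` has `⟨S, w - Y w⟩ ≤ 0`, which yields a half-space that contains all endomorphisms but
not `X`.  The projection onto it decreases the distance to all endomorphisms by a definite amount, so
that this happens only polynomially often (`IsSearch.project`, `IsSearch.count_eq`).

*Implementation.*  All array computations are instances of one program scheme, `fill`.  The running
time is polynomial because all loop bounds are polynomials in the dimension and the horizon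
(`Program.exists_cost_le_pow`).
-/

section

open Matrix

namespace RealRAM

/-! ### Running programs: final memory, frame conditions, polynomial running time -/

/-- The final memory of an execution, without its cost. -/
noncomputable def run {d : ℕ} (o : EuclideanSpace ℝ (Fin d) → EuclideanSpace ℝ (Fin d))
    (p : Program) (m : Memory) : Memory :=
  (exec o p m).1

section Run

variable {d : ℕ} (o : EuclideanSpace ℝ (Fin d) → EuclideanSpace ℝ (Fin d))

@[simp] theorem run_skip (m : Memory) : run o .skip m = m := rfl

@[simp] theorem run_setNat (x : ℕ) (e : NatExpr) (m : Memory) :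
    run o (.setNat x e) m = m.setNat x (e.eval m) := rfl

@[simp] theorem run_setReal (a : ℕ) (i : NatExpr) (e : RealExpr) (m : Memory) :
    run o (.setReal a i e) m = m.setReal a (i.eval m) (e.eval m) := rfl

@[simp] theorem run_seq (p q : Program) (m : Memory) :
    run o (.seq p q) m = run o q (run o p m) := rfl

theorem run_ifNat (e f : NatExpr) (p q : Program) (m : Memory) :
    run o (.ifNat e f p q) m = if e.eval m ≤ f.eval m then run o p m else run o q m := by
  simp only [run, exec]
  split_ifs <;> rfl

theorem run_ifReal (e f : RealExpr) (p q : Program) (m : Memory) :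
    run o (.ifReal e f p q) m = if e.eval m ≤ f.eval m then run o p m else run o q m := by
  simp only [run, exec]
  split_ifs <;> rfl

theorem run_loop (x : ℕ) (e : NatExpr) (p : Program) (m : Memory) :
    run o (.loop x e p) m = iter (fun k m' => run o p (m'.setNat x k)) (e.eval m) m := by
  simp only [run, exec]
  induction e.eval m with
  | zero => rfl
  | succ n ih => simp only [iter, ih]

@[simp] theorem run_oracle (a b : ℕ) (m : Memory) :
    run o (.oracle a b) m = m.store b (o (m.load a)) := rfl

/-- The invariant rule for loops. -/
theorem run_loop_induction (x : ℕ) (e : NatExpr) (p : Program) (m : Memory)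
    (I : ℕ → Memory → Prop) (h0 : I 0 m)
    (hs : ∀ n < e.eval m, ∀ m', I n m' → I (n + 1) (run o p (m'.setNat x n))) :
    I (e.eval m) (run o (.loop x e p) m) := by
  rw [run_loop]
  have key : ∀ n ≤ e.eval m, I n (iter (fun k m' => run o p (m'.setNat x k)) n m) := by
    intro n
    induction n with
    | zero => intro _; exact h0
    | succ n ih => intro hn; exact hs n (by omega) _ (ih (by omega))
  exact key _ le_rfl

/-- Whether a program contains an instruction that writes to the array `a`. -/
def Program.writesArr (a : ℕ) : Program → Bool
  | .skip => false
  | .setNat _ _ => false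
  | .setReal b _ _ => a == b
  | .seq p q => p.writesArr a || q.writesArr a
  | .ifNat _ _ p q => p.writesArr a || q.writesArr a
  | .ifReal _ _ p q => p.writesArr a || q.writesArr a
  | .loop _ _ p => p.writesArr a
  | .oracle _ b => a == b

/-- Whether a program contains an instruction that writes to the integer register `x`. -/
def Program.writesNat (x : ℕ) : Program → Bool
  | .skip => false
  | .setNat y _ => x == y
  | .setReal _ _ _ => false
  | .seq p q => p.writesNat x || q.writesNat x
  | .ifNat _ _ p q => p.writesNat x || q.writesNat x
  | .ifReal _ _ p q => p.writesNat x || q.writesNat x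
  | .loop y _ p => x == y || p.writesNat x
  | .oracle _ _ => false

theorem run_arr_of_not_writes (a : ℕ) (p : Program) (h : p.writesArr a = false) (m : Memory) :
    (run o p m).arr a = m.arr a := by
  induction p generalizing m with
  | skip => rfl
  | setNat x e => rfl
  | setReal b i e =>
    have hab : a ≠ b := by simpa [Program.writesArr] using h
    simp [Memory.setReal, hab]
  | seq p q hp hq =>
    simp only [Program.writesArr, Bool.or_eq_false_iff] at h
    rw [run_seq, hq h.2, hp h.1]
  | ifNat e f p q hp hq =>
    simp only [Program.writesArr, Bool.or_eq_false_iff] at h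
    rw [run_ifNat]
    split_ifs
    exacts [hp h.1 m, hq h.2 m]
  | ifReal e f p q hp hq =>
    simp only [Program.writesArr, Bool.or_eq_false_iff] at h
    rw [run_ifReal]
    split_ifs
    exacts [hp h.1 m, hq h.2 m]
  | loop x e p hp =>
    refine run_loop_induction o x e p m (fun _ m' => m'.arr a = m.arr a) rfl ?_
    intro n _ m' hm'
    rw [hp h, ← hm']
    rfl
  | oracle b c =>
    have hac : a ≠ c := by simpa [Program.writesArr] using h
    simp [Memory.store, hac]

theorem run_nat_of_not_writes (x : ℕ) (p : Program) (h : p.writesNat x = false) (m : Memory) :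
    (run o p m).nat x = m.nat x := by
  induction p generalizing m with
  | skip => rfl
  | setNat y e =>
    have hxy : x ≠ y := by simpa [Program.writesNat] using h
    simp [Memory.setNat, hxy]
  | setReal b i e => rfl
  | seq p q hp hq =>
    simp only [Program.writesNat, Bool.or_eq_false_iff] at h
    rw [run_seq, hq h.2, hp h.1]
  | ifNat e f p q hp hq =>
    simp only [Program.writesNat, Bool.or_eq_false_iff] at h
    rw [run_ifNat]
    split_ifs
    exacts [hp h.1 m, hq h.2 m]
  | ifReal e f p q hp hq =>
    simp only [Program.writesNat, Bool.or_eq_false_iff] at h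
    rw [run_ifReal]
    split_ifs
    exacts [hp h.1 m, hq h.2 m]
  | loop y e p hp =>
    simp only [Program.writesNat, Bool.or_eq_false_iff] at h
    have hxy : x ≠ y := by simpa using h.1
    refine run_loop_induction o y e p m (fun _ m' => m'.nat x = m.nat x) rfl ?_
    intro n _ m' hm'
    rw [hp h.2, ← hm']
    simp [Memory.setNat, hxy]
  | oracle b c => rfl

/-- Integer expressions in the registers `0` (dimension) and `1` (horizon) only. -/
def NatExpr.onlyParams : NatExpr → Bool
  | .const _ => true
  | .var x => decide (x < 2)
  | .add e f => e.onlyParams && f.onlyParams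
  | .sub e f => e.onlyParams && f.onlyParams
  | .mul e f => e.onlyParams && f.onlyParams

/-- Programs that never write to the registers `0` and `1`, and whose loop bounds are expressions in
these two registers. -/
def Program.polyLoops : Program → Bool
  | .skip => true
  | .setNat x _ => decide (2 ≤ x)
  | .setReal _ _ _ => true
  | .seq p q => p.polyLoops && q.polyLoops
  | .ifNat _ _ p q => p.polyLoops && q.polyLoops
  | .ifReal _ _ p q => p.polyLoops && q.polyLoops
  | .loop x e p => decide (2 ≤ x) && e.onlyParams && p.polyLoops
  | .oracle _ _ => true

theorem le_pow_of_two_le (c n : ℕ) (hn : 2 ≤ n) : c ≤ n ^ c :=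
  (Nat.lt_pow_self (by omega)).le

theorem add_le_pow_of_le {n a b A B : ℕ} (hn : 2 ≤ n) (ha : a ≤ n ^ A) (hb : b ≤ n ^ B) :
    a + b ≤ n ^ (A + B + 1) := by
  have h1 : n ^ A ≤ n ^ (A + B) := Nat.pow_le_pow_right (by omega) (by omega)
  have h2 : n ^ B ≤ n ^ (A + B) := Nat.pow_le_pow_right (by omega) (by omega)
  calc a + b ≤ n ^ (A + B) * 2 := by omega
    _ ≤ n ^ (A + B) * n := Nat.mul_le_mul_left _ hn
    _ = n ^ (A + B + 1) := (pow_succ _ _).symm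

theorem NatExpr.exists_eval_le_pow (e : NatExpr) (he : e.onlyParams = true) :
    ∃ K : ℕ, ∀ m : Memory, e.eval m ≤ (m.nat 0 + m.nat 1 + 2) ^ K := by
  induction e with
  | const c => exact ⟨c, fun m => le_pow_of_two_le c _ (by omega)⟩
  | var x =>
    refine ⟨1, fun m => ?_⟩
    have hx : x < 2 := by simpa [NatExpr.onlyParams] using he
    rw [pow_one]
    interval_cases x <;> simp only [NatExpr.eval] <;> omega
  | add e f hE hF =>
    simp only [NatExpr.onlyParams, Bool.and_eq_true] at he
    obtain ⟨A, hA⟩ := hE he.1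
    obtain ⟨B, hB⟩ := hF he.2
    exact ⟨A + B + 1, fun m => add_le_pow_of_le (by omega) (hA m) (hB m)⟩
  | sub e f hE hF =>
    simp only [NatExpr.onlyParams, Bool.and_eq_true] at he
    obtain ⟨A, hA⟩ := hE he.1
    exact ⟨A, fun m => (Nat.sub_le _ _).trans (hA m)⟩
  | mul e f hE hF =>
    simp only [NatExpr.onlyParams, Bool.and_eq_true] at he
    obtain ⟨A, hA⟩ := hE he.1
    obtain ⟨B, hB⟩ := hF he.2
    refine ⟨A + B, fun m => ?_⟩
    rw [pow_add]
    exact Nat.mul_le_mul (hA m) (hB m)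

theorem Program.polyLoops_writesNat (p : Program) (h : p.polyLoops = true) (x : ℕ) (hx : x < 2) :
    p.writesNat x = false := by
  induction p with
  | skip => rfl
  | setNat y e =>
    have : 2 ≤ y := by simpa [Program.polyLoops] using h
    simp only [Program.writesNat, beq_eq_false_iff_ne]; omega
  | setReal b i e => rfl
  | seq p q hp hq =>
    simp only [Program.polyLoops, Bool.and_eq_true] at h
    simp [Program.writesNat, hp h.1, hq h.2]
  | ifNat e f p q hp hq =>
    simp only [Program.polyLoops, Bool.and_eq_true] at h
    simp [Program.writesNat, hp h.1, hq h.2]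
  | ifReal e f p q hp hq =>
    simp only [Program.polyLoops, Bool.and_eq_true] at h
    simp [Program.writesNat, hp h.1, hq h.2]
  | loop y e p hp =>
    simp only [Program.polyLoops, Bool.and_eq_true, decide_eq_true_eq] at h
    simp only [Program.writesNat, hp h.2, Bool.or_false, beq_eq_false_iff_ne]; omega
  | oracle b c => rfl

/-- A program whose loop bounds depend only on the dimension and the horizon runs in polynomial
time; the exponent depends only on the program. -/
theorem Program.exists_cost_le_pow (p : Program) (hp : p.polyLoops = true) :
    ∃ K : ℕ, ∀ (d : ℕ) (o : EuclideanSpace ℝ (Fin d) → EuclideanSpace ℝ (Fin d)) (m : Memory),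
      m.nat 0 = d → (exec o p m).2 ≤ (m.nat 0 + m.nat 1 + 2) ^ K := by
  induction p with
  | skip => exact ⟨1, fun d o m _ => by simp only [exec, pow_one]; omega⟩
  | setNat x e =>
    exact ⟨e.cost + 1, fun d o m _ => le_pow_of_two_le _ _ (by omega)⟩
  | setReal a i e =>
    exact ⟨i.cost + e.cost + 1, fun d o m _ => le_pow_of_two_le _ _ (by omega)⟩
  | seq p q hP hQ =>
    simp only [Program.polyLoops, Bool.and_eq_true] at hp
    obtain ⟨A, hA⟩ := hP hp.1
    obtain ⟨B, hB⟩ := hQ hp.2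
    refine ⟨A + B + 1, fun d o m hd => add_le_pow_of_le (by omega) (hA d o m hd) ?_⟩
    have e0 := run_nat_of_not_writes o 0 p (p.polyLoops_writesNat hp.1 0 (by omega)) m
    have e1 := run_nat_of_not_writes o 1 p (p.polyLoops_writesNat hp.1 1 (by omega)) m
    rw [← e0, ← e1]
    exact hB d o _ (e0.trans hd)
  | ifNat e f p q hP hQ =>
    simp only [Program.polyLoops, Bool.and_eq_true] at hp
    obtain ⟨A, hA⟩ := hP hp.1
    obtain ⟨B, hB⟩ := hQ hp.2
    refine ⟨(e.cost + f.cost + 1) + (A + B) + 1, fun d o m hd => ?_⟩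
    refine add_le_pow_of_le (by omega) (le_pow_of_two_le _ _ (by omega)) ?_
    have h1 : (m.nat 0 + m.nat 1 + 2) ^ A ≤ (m.nat 0 + m.nat 1 + 2) ^ (A + B) :=
      Nat.pow_le_pow_right (by omega) (by omega)
    have h2 : (m.nat 0 + m.nat 1 + 2) ^ B ≤ (m.nat 0 + m.nat 1 + 2) ^ (A + B) :=
      Nat.pow_le_pow_right (by omega) (by omega)
    split_ifs
    · exact (hA d o m hd).trans h1
    · exact (hB d o m hd).trans h2
  | ifReal e f p q hP hQ =>
    simp only [Program.polyLoops, Bool.and_eq_true] at hp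
    obtain ⟨A, hA⟩ := hP hp.1
    obtain ⟨B, hB⟩ := hQ hp.2
    refine ⟨(e.cost + f.cost + 1) + (A + B) + 1, fun d o m hd => ?_⟩
    refine add_le_pow_of_le (by omega) (le_pow_of_two_le _ _ (by omega)) ?_
    have h1 : (m.nat 0 + m.nat 1 + 2) ^ A ≤ (m.nat 0 + m.nat 1 + 2) ^ (A + B) :=
      Nat.pow_le_pow_right (by omega) (by omega)
    have h2 : (m.nat 0 + m.nat 1 + 2) ^ B ≤ (m.nat 0 + m.nat 1 + 2) ^ (A + B) :=
      Nat.pow_le_pow_right (by omega) (by omega)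
    split_ifs
    · exact (hA d o m hd).trans h1
    · exact (hB d o m hd).trans h2
  | loop x e p hP =>
    simp only [Program.polyLoops, Bool.and_eq_true, decide_eq_true_eq] at hp
    obtain ⟨A, hA⟩ := hP hp.2
    obtain ⟨B, hB⟩ := e.exists_eval_le_pow hp.1.2
    refine ⟨(e.cost + 1) + (B + (1 + A + 1)) + 1, fun d o m hd => ?_⟩
    set n := m.nat 0 + m.nat 1 + 2 with hn
    have key : ∀ k : ℕ,
        let r := iter (fun k r => ((exec o p (r.1.setNat x k)).1,
          r.2 + 1 + (exec o p (r.1.setNat x k)).2)) k (m, e.cost + 1)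
        r.1.nat 0 = m.nat 0 ∧ r.1.nat 1 = m.nat 1 ∧ r.2 ≤ e.cost + 1 + k * n ^ (1 + A + 1) := by
      intro k
      induction k with
      | zero => simp [iter]
      | succ k ih =>
        obtain ⟨i0, i1, i2⟩ := ih
        set r := iter (fun k r => ((exec o p (r.1.setNat x k)).1,
          r.2 + 1 + (exec o p (r.1.setNat x k)).2)) k (m, e.cost + 1) with hr
        have h0x : (0 : ℕ) ≠ x := by omega
        have h1x : (1 : ℕ) ≠ x := by omega
        have s0 : (r.1.setNat x k).nat 0 = m.nat 0 := by simp [Memory.setNat, h0x, i0]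
        have s1 : (r.1.setNat x k).nat 1 = m.nat 1 := by simp [Memory.setNat, h1x, i1]
        have e0 := run_nat_of_not_writes o 0 p (p.polyLoops_writesNat hp.2 0 (by omega))
          (r.1.setNat x k)
        have e1 := run_nat_of_not_writes o 1 p (p.polyLoops_writesNat hp.2 1 (by omega))
          (r.1.setNat x k)
        have hc := hA d o (r.1.setNat x k) (s0.trans hd)
        rw [s0, s1] at hc
        have h1 : 1 + (exec o p (r.1.setNat x k)).2 ≤ n ^ (1 + A + 1) :=
          add_le_pow_of_le (by omega) (by rw [pow_one]; omega) hc
        refine ⟨e0.trans s0, e1.trans s1, ?_⟩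
        simp only [iter]
        rw [← hr, add_mul, one_mul]
        omega
    have h := (key (e.eval m)).2.2
    simp only [exec]
    refine h.trans ?_
    refine add_le_pow_of_le (by omega) (le_pow_of_two_le _ _ (by omega)) ?_
    rw [pow_add n B]
    exact Nat.mul_le_mul_right _ (hB m)
  | oracle a b =>
    exact ⟨1, fun d o m hd => by simp only [exec, pow_one]; omega⟩

end Run

/-! ### Array operations -/

/-- The memory in which the index registers `10`, `11`, `12` hold `i`, `j`, `k`. -/
def Memory.indexed (m : Memory) (i j k : ℕ) : Memory :=
  { m with nat := fun x =>
      if x = 10 then i else if x = 11 then j else if x = 12 then k else m.nat x }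

/-- The expression does not mention the index registers. -/
def NatExpr.noIndex : NatExpr → Bool
  | .const _ => true
  | .var x => decide (x < 10)
  | .add e f => e.noIndex && f.noIndex
  | .sub e f => e.noIndex && f.noIndex
  | .mul e f => e.noIndex && f.noIndex

/-- The expression does not read from the array `a`. -/
def RealExpr.avoids (a : ℕ) : RealExpr → Bool
  | .ofNat _ => true
  | .read b _ => a != b
  | .add e f => e.avoids a && f.avoids a
  | .sub e f => e.avoids a && f.avoids a
  | .mul e f => e.avoids a && f.avoids a
  | .div e f => e.avoids a && f.avoids a
  | .sqrt e => e.avoids a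

theorem NatExpr.eval_congr_nat (e : NatExpr) {m m' : Memory} (h : m.nat = m'.nat) :
    e.eval m = e.eval m' := by
  induction e with
  | const c => rfl
  | var x => simp only [NatExpr.eval, h]
  | add e f he hf => simp only [NatExpr.eval, he, hf]
  | sub e f he hf => simp only [NatExpr.eval, he, hf]
  | mul e f he hf => simp only [NatExpr.eval, he, hf]

theorem NatExpr.eval_congr_noIndex (e : NatExpr) (he : e.noIndex = true) {m m' : Memory}
    (h : ∀ x < 10, m.nat x = m'.nat x) : e.eval m = e.eval m' := by
  induction e with
  | const c => rfl
  | var x => exact h x (by simpa [NatExpr.noIndex] using he)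
  | add e f hE hF =>
    simp only [NatExpr.noIndex, Bool.and_eq_true] at he
    simp only [NatExpr.eval, hE he.1, hF he.2]
  | sub e f hE hF =>
    simp only [NatExpr.noIndex, Bool.and_eq_true] at he
    simp only [NatExpr.eval, hE he.1, hF he.2]
  | mul e f hE hF =>
    simp only [NatExpr.noIndex, Bool.and_eq_true] at he
    simp only [NatExpr.eval, hE he.1, hF he.2]

theorem RealExpr.eval_congr (e : RealExpr) (a : ℕ) (he : e.avoids a = true) {m m' : Memory}
    (h : m.nat = m'.nat) (h' : ∀ b, b ≠ a → m.arr b = m'.arr b) : e.eval m = e.eval m' := by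
  induction e with
  | ofNat e => simp only [RealExpr.eval, e.eval_congr_nat h]
  | read b i =>
    have hab : b ≠ a := by
      have : a ≠ b := by simpa [RealExpr.avoids] using he
      exact this.symm
    simp only [RealExpr.eval, h' b hab, i.eval_congr_nat h]
  | add e f hE hF =>
    simp only [RealExpr.avoids, Bool.and_eq_true] at he
    simp only [RealExpr.eval, hE he.1, hF he.2]
  | sub e f hE hF =>
    simp only [RealExpr.avoids, Bool.and_eq_true] at he
    simp only [RealExpr.eval, hE he.1, hF he.2]
  | mul e f hE hF =>
    simp only [RealExpr.avoids, Bool.and_eq_true] at he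
    simp only [RealExpr.eval, hE he.1, hF he.2]
  | div e f hE hF =>
    simp only [RealExpr.avoids, Bool.and_eq_true] at he
    simp only [RealExpr.eval, hE he.1, hF he.2]
  | sqrt e hE =>
    simp only [RealExpr.eval, hE he]

/-- The computation of a single entry in `fill`. -/
def fillCell (a : ℕ) (ny nz κ : NatExpr) (init term : RealExpr) : Program :=
  .seq (.setNat 12 (.const 0)) (.seq
    (.setReal a (.add (.mul (.var 10) ny) (.var 11))
      (.add (.mul (.ofNat κ) (.read a (.add (.mul (.var 10) ny) (.var 11)))) init))
    (.loop 12 nz (.setReal a (.add (.mul (.var 10) ny) (.var 11))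
      (.add (.read a (.add (.mul (.var 10) ny) (.var 11))) term))))

/-- The array operation
`a[i * ny + j] := κ(i, j) * a[i * ny + j] + init(i, j) + ∑ k < nz, term(i, j, k)`
for all `i < nx` and `j < ny`.  The expressions `κ`, `init` and `term` refer to `i`, `j`, `k` as the
registers `10`, `11`, `12`. -/
def fill (a : ℕ) (nx ny nz κ : NatExpr) (init term : RealExpr) : Program :=
  .loop 10 nx (.loop 11 ny (fillCell a ny nz κ init term))

/-- The entry `(i, j)` that `fill` computes. -/
noncomputable def fillValue (m : Memory) (a : ℕ) (ny nz κ : NatExpr) (init term : RealExpr)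
    (i j : ℕ) : ℝ :=
  (κ.eval (m.indexed i j 0) : ℝ) * m.arr a (i * ny.eval m + j) + init.eval (m.indexed i j 0) +
    ∑ k ∈ Finset.range (nz.eval m), term.eval (m.indexed i j k)

theorem mul_add_inj {n i j i' j' : ℕ} (hj : j < n) (hj' : j' < n)
    (h : i * n + j = i' * n + j') : i = i' ∧ j = j' := by
  have hn : 0 < n := by omega
  have h1 : (i * n + j) / n = i := by
    rw [mul_comm, Nat.mul_add_div hn, Nat.div_eq_of_lt hj, add_zero]
  have h2 : (i' * n + j') / n = i' := by
    rw [mul_comm, Nat.mul_add_div hn, Nat.div_eq_of_lt hj', add_zero]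
  have hi : i = i' := by rw [← h1, ← h2, h]
  subst hi
  exact ⟨rfl, by omega⟩

variable {d : ℕ} (o : EuclideanSpace ℝ (Fin d) → EuclideanSpace ℝ (Fin d))

theorem run_fill (a : ℕ) (nx ny nz κ : NatExpr) (init term : RealExpr) (m : Memory)
    (hny : ny.noIndex = true) (hnz : nz.noIndex = true)
    (hinit : init.avoids a = true) (hterm : term.avoids a = true)
    {i j : ℕ} (hi : i < nx.eval m) (hj : j < ny.eval m) :
    (run o (fill a nx ny nz κ init term) m).arr a (i * ny.eval m + j) =
      fillValue m a ny nz κ init term i j := by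
  -- `A` records what every stage of the execution leaves untouched
  set A : Memory → Prop := fun m' =>
    (∀ x, x ≠ 10 → x ≠ 11 → x ≠ 12 → m'.nat x = m.nat x) ∧ ∀ b, b ≠ a → m'.arr b = m.arr b with hA
  have evalN : ∀ (e : NatExpr), e.noIndex = true → ∀ m', A m' → e.eval m' = e.eval m := by
    intro e he m' hm'
    exact e.eval_congr_noIndex he fun x hx => hm'.1 x (by omega) (by omega) (by omega)
  have natIndexed : ∀ m' i j k, A m' → m'.nat 10 = i → m'.nat 11 = j → m'.nat 12 = k →
      m'.nat = (m.indexed i j k).nat := by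
    intro m' i j k hm' h0 h1 h2
    funext x
    simp only [Memory.indexed]
    split_ifs with c0 c1 c2
    · rw [c0, h0]
    · rw [c1, h1]
    · rw [c2, h2]
    · exact hm'.1 x c0 c1 c2
  have hA0 : A m := ⟨fun _ _ _ _ => rfl, fun _ _ => rfl⟩
  -- the invariant of the outer loop
  set I : ℕ → Memory → Prop := fun n m' => A m' ∧
    (∀ i < n, ∀ j < ny.eval m, m'.arr a (i * ny.eval m + j) =
      fillValue m a ny nz κ init term i j) ∧
    (∀ i, n ≤ i → ∀ j < ny.eval m, m'.arr a (i * ny.eval m + j) = m.arr a (i * ny.eval m + j))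
    with hI
  have main : I (nx.eval m) (run o (fill a nx ny nz κ init term) m) := by
    refine run_loop_induction o _ _ _ m I ⟨hA0, by intros; omega, by intros; rfl⟩ ?_
    rintro r hr m1 ⟨hAm1, h1, h2⟩
    have hAm1' : A (m1.setNat 10 r) := ⟨fun x hx hx' hx'' => by
      simp [Memory.setNat, hx, hAm1.1 x hx hx' hx''], hAm1.2⟩
    -- the invariant of the middle loop
    set J : ℕ → Memory → Prop := fun n m' => A m' ∧ m'.nat 10 = r ∧
      (∀ i < r, ∀ j < ny.eval m, m'.arr a (i * ny.eval m + j) =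
        fillValue m a ny nz κ init term i j) ∧
      (∀ j < n, j < ny.eval m → m'.arr a (r * ny.eval m + j) =
        fillValue m a ny nz κ init term r j) ∧
      (∀ j, n ≤ j → j < ny.eval m → m'.arr a (r * ny.eval m + j) = m.arr a (r * ny.eval m + j)) ∧
      (∀ i, r < i → ∀ j < ny.eval m, m'.arr a (i * ny.eval m + j) = m.arr a (i * ny.eval m + j))
      with hJ
    have inner : J (ny.eval (m1.setNat 10 r)) 
        (run o (.loop 11 ny (fillCell a ny nz κ init term)) (m1.setNat 10 r)) := by
      refine run_loop_induction o _ _ _ (m1.setNat 10 r) J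
        ⟨hAm1', by simp [Memory.setNat], h1, by intros; omega,
          fun j _ hj => h2 r le_rfl j hj, fun i hi j hj => h2 i hi.le j hj⟩ ?_
      rw [evalN ny hny _ hAm1']
      rintro s hs m2 ⟨hAm2, h10, g1, g2, g3, g4⟩
      have idx : ∀ m', A m' → m'.nat 10 = r → m'.nat 11 = s →
          NatExpr.eval m' (.add (.mul (.var 10) ny) (.var 11)) = r * ny.eval m + s := by
        intro m' hm' e0 e1
        simp only [NatExpr.eval, evalN ny hny m' hm', e0, e1]
      set m3 := (m2.setNat 11 s).setNat 12 0 with hm3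
      have hAm3 : A m3 := ⟨fun x hx hx' hx'' => by
        simp [hm3, Memory.setNat, hx', hx'', hAm2.1 x hx hx' hx''], hAm2.2⟩
      have e10 : m3.nat 10 = r := by simp [hm3, Memory.setNat, h10]
      have e11 : m3.nat 11 = s := by simp [hm3, Memory.setNat]
      have e12 : m3.nat 12 = 0 := by simp [hm3, Memory.setNat]
      have hnat3 := natIndexed m3 r s 0 hAm3 e10 e11 e12
      set v0 : ℝ := (κ.eval (m.indexed r s 0) : ℝ) * m.arr a (r * ny.eval m + s) +
        init.eval (m.indexed r s 0) with hv0
      set m4 := m3.setReal a (r * ny.eval m + s) v0 with hm4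
      have run4 : run o (.setReal a (.add (.mul (.var 10) ny) (.var 11))
          (.add (.mul (.ofNat κ) (.read a (.add (.mul (.var 10) ny) (.var 11)))) init)) m3
            = m4 := by
        rw [run_setReal, idx m3 hAm3 e10 e11]
        simp only [RealExpr.eval]
        rw [idx m3 hAm3 e10 e11, κ.eval_congr_nat hnat3,
          init.eval_congr a hinit hnat3 (fun b hb => hAm3.2 b hb)]
        have : m3.arr a (r * ny.eval m + s) = m.arr a (r * ny.eval m + s) := g3 s le_rfl hs
        rw [this]
      have hAm4 : A m4 := ⟨hAm3.1, fun b hb => by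
        rw [← hAm3.2 b hb]; simp [hm4, Memory.setReal, hb]⟩
      -- the invariant of the inner loop
      set L : ℕ → Memory → Prop := fun n m' => A m' ∧ m'.nat 10 = r ∧ m'.nat 11 = s ∧
        m'.arr a (r * ny.eval m + s) = v0 + ∑ k ∈ Finset.range n, term.eval (m.indexed r s k) ∧
        ∀ q, q ≠ r * ny.eval m + s → m'.arr a q = m2.arr a q with hL
      have innermost : L (nz.eval m4) (run o (.loop 12 nz
          (.setReal a (.add (.mul (.var 10) ny) (.var 11)) (.add (.read a (.add (.mul (.var 10) ny) (.var 11))) term))) m4) := by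
        refine run_loop_induction o _ _ (.setReal a (.add (.mul (.var 10) ny) (.var 11))
          (.add (.read a (.add (.mul (.var 10) ny) (.var 11))) term)) m4 L
          ⟨hAm4, e10, e11, by simp [hm4, Memory.setReal],
          fun q hq => by simp [hm4, Memory.setReal, hq, hm3, Memory.setNat]⟩ ?_
        rintro k hk m5 ⟨hAm5, k10, k11, kv, ko⟩
        set m6 := m5.setNat 12 k with hm6
        have hAm6 : A m6 := ⟨fun x hx hx' hx'' => by
          simp [hm6, Memory.setNat, hx'', hAm5.1 x hx hx' hx''], hAm5.2⟩
        have f10 : m6.nat 10 = r := by simp [hm6, Memory.setNat, k10]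
        have f11 : m6.nat 11 = s := by simp [hm6, Memory.setNat, k11]
        have f12 : m6.nat 12 = k := by simp [hm6, Memory.setNat]
        have hnat6 := natIndexed m6 r s k hAm6 f10 f11 f12
        rw [run_setReal, idx m6 hAm6 f10 f11]
        simp only [RealExpr.eval]
        rw [idx m6 hAm6 f10 f11, term.eval_congr a hterm hnat6 (fun b hb => hAm6.2 b hb)]
        refine ⟨⟨hAm6.1, fun b hb => ?_⟩, f10, f11, ?_, ?_⟩
        · rw [← hAm6.2 b hb]; simp [Memory.setReal, hb]
        · have : m6.arr a (r * ny.eval m + s) = _ := kv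
          simp only [Memory.setReal, Function.update_self]
          rw [this, Finset.sum_range_succ, add_assoc]
        · intro q hq
          rw [← ko q hq]
          simp [Memory.setReal, hq, hm6, Memory.setNat]
      rw [fillCell, run_seq, run_seq, run_setNat]
      change J (s + 1) (run o (.loop 12 nz _) (run o _ m3))
      rw [run4]
      rw [evalN nz hnz m4 hAm4] at innermost
      obtain ⟨l1, l2, l3, l4, l5⟩ := innermost
      refine ⟨l1, l2, ?_, ?_, ?_, ?_⟩
      · intro i hi j hj
        rw [l5 _ fun hne => by have := mul_add_inj hj hs hne; omega, g1 i hi j hj]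
      · intro j hj hj'
        rcases Nat.lt_succ_iff_lt_or_eq.mp hj with hlt | rfl
        · rw [l5 _ fun hne => by omega, g2 j hlt hj']
        · rw [l4]; rfl
      · intro j hj hj'
        rw [l5 _ fun hne => by omega, g3 j (by omega) hj']
      · intro i hi j hj
        rw [l5 _ fun hne => by have := mul_add_inj hj hs hne; omega, g4 i hi j hj]
    rw [evalN ny hny _ hAm1'] at inner
    obtain ⟨i1, _, i3, i4, _, i6⟩ := inner
    refine ⟨i1, ?_, fun i hi j hj => i6 i hi j hj⟩
    intro i hi j hj
    rcases Nat.lt_succ_iff_lt_or_eq.mp hi with hlt | rfl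
    · exact i3 i hlt j hj
    · exact i4 j hj hj
  exact main.2.1 i hi j hj

theorem fill_writesArr (a : ℕ) (nx ny nz κ : NatExpr) (init term : RealExpr) (b : ℕ) :
    (fill a nx ny nz κ init term).writesArr b = (b == a) := by
  simp [fill, fillCell, Program.writesArr]

end RealRAM

/-! ### Preconditioners with rank-one updates -/

section Preconditioner

variable {n : Type*} [Fintype n]

theorem dotProduct_self_nonneg (v : n → ℝ) : 0 ≤ v ⬝ᵥ v :=
  Finset.sum_nonneg fun i _ => mul_self_nonneg (v i)

theorem dotProduct_vecMulVec_mulVec_self (G Y : n → ℝ) :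
    Y ⬝ᵥ vecMulVec G G *ᵥ Y = (G ⬝ᵥ Y) ^ 2 := by
  rw [vecMulVec_mulVec, dotProduct_smul, dotProduct_comm Y G]
  simp only [MulOpposite.smul_eq_mul_unop, MulOpposite.unop_op]
  ring

theorem dotProduct_add_vecMulVec_mulVec_self (V : Matrix n n ℝ) (G Y : n → ℝ) :
    Y ⬝ᵥ (V + vecMulVec G G) *ᵥ Y = Y ⬝ᵥ V *ᵥ Y + (G ⬝ᵥ Y) ^ 2 := by
  rw [add_mulVec, dotProduct_add, dotProduct_vecMulVec_mulVec_self]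

theorem trace_add_vecMulVec_self (V : Matrix n n ℝ) (G : n → ℝ) :
    (V + vecMulVec G G).trace = V.trace + G ⬝ᵥ G := by
  rw [trace_add, trace_vecMulVec]

variable [DecidableEq n]

/-- `V` is a symmetric matrix with `V ≥ 1`, and `W` is its inverse. -/
structure IsPreconditioner (V W : Matrix n n ℝ) : Prop where
  symm : Vᵀ = V
  mul_eq_one : V * W = 1
  le_quad : ∀ Y : n → ℝ, Y ⬝ᵥ Y ≤ Y ⬝ᵥ V *ᵥ Y

namespace IsPreconditioner

theorem one : IsPreconditioner (1 : Matrix n n ℝ) 1 where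
  symm := by simp
  mul_eq_one := by simp
  le_quad := by simp

variable {V W : Matrix n n ℝ}

theorem inv_symm (h : IsPreconditioner V W) : Wᵀ = W := by
  have h1 : Wᵀ * V = 1 := by rw [← h.symm, ← transpose_mul, h.mul_eq_one, transpose_one]
  calc Wᵀ = Wᵀ * (V * W) := by rw [h.mul_eq_one, mul_one]
    _ = W := by rw [← mul_assoc, h1, one_mul]

theorem mulVec_mulVec_inv (h : IsPreconditioner V W) (H : n → ℝ) : V *ᵥ (W *ᵥ H) = H := by
  rw [mulVec_mulVec, h.mul_eq_one, one_mulVec]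

theorem dotProduct_mulVec_comm (h : IsPreconditioner V W) (x y : n → ℝ) :
    x ⬝ᵥ V *ᵥ y = y ⬝ᵥ V *ᵥ x := by
  rw [dotProduct_mulVec, ← mulVec_transpose, h.symm, dotProduct_comm]

theorem quad_nonneg (h : IsPreconditioner V W) (Y : n → ℝ) : 0 ≤ Y ⬝ᵥ V *ᵥ Y :=
  (dotProduct_self_nonneg Y).trans (h.le_quad Y)

theorem inv_quad_eq (h : IsPreconditioner V W) (H : n → ℝ) :
    H ⬝ᵥ W *ᵥ H = (W *ᵥ H) ⬝ᵥ V *ᵥ (W *ᵥ H) := by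
  rw [h.mulVec_mulVec_inv, dotProduct_comm]

theorem inv_quad_nonneg (h : IsPreconditioner V W) (H : n → ℝ) : 0 ≤ H ⬝ᵥ W *ᵥ H := by
  rw [h.inv_quad_eq]; exact h.quad_nonneg _

theorem inv_quad_pos (h : IsPreconditioner V W) {H : n → ℝ} (hH : H ≠ 0) :
    0 < H ⬝ᵥ W *ᵥ H := by
  rw [h.inv_quad_eq]
  refine lt_of_lt_of_le ?_ (h.le_quad _)
  refine lt_of_le_of_ne (dotProduct_self_nonneg _) fun h0 => hH ?_
  rw [← h.mulVec_mulVec_inv H, dotProduct_self_eq_zero.mp h0.symm, mulVec_zero]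

theorem inv_quad_le (h : IsPreconditioner V W) (H : n → ℝ) : H ⬝ᵥ W *ᵥ H ≤ H ⬝ᵥ H := by
  -- with `Y = W H`: `|Y|² ≤ Y V Y = H · Y` and `(H · Y)² ≤ |H|² |Y|²`
  set q := H ⬝ᵥ W *ᵥ H with hq
  have h1 : (W *ᵥ H) ⬝ᵥ (W *ᵥ H) ≤ q := by rw [hq, h.inv_quad_eq]; exact h.le_quad _
  have h2 : q ^ 2 ≤ (H ⬝ᵥ H) * ((W *ᵥ H) ⬝ᵥ (W *ᵥ H)) := by
    have := Finset.sum_mul_sq_le_sq_mul_sq Finset.univ H (W *ᵥ H)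
    simpa only [hq, dotProduct, sq] using this
  have h0 : 0 ≤ q := h.inv_quad_nonneg H
  have h3 : 0 ≤ H ⬝ᵥ H := dotProduct_self_nonneg H
  rcases h0.eq_or_lt with h0 | h0
  · rw [← h0]; exact h3
  · have : q * q ≤ (H ⬝ᵥ H) * q := by nlinarith
    exact le_of_mul_le_mul_right this h0

/-- Moving in the direction `W H` changes the `V`-norm like a gradient step for `H`. -/
theorem quad_add_smul (h : IsPreconditioner V W) (Y H : n → ℝ) (a : ℝ) :
    (Y + a • W *ᵥ H) ⬝ᵥ V *ᵥ (Y + a • W *ᵥ H) =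
      Y ⬝ᵥ V *ᵥ Y + 2 * a * (H ⬝ᵥ Y) + a ^ 2 * (H ⬝ᵥ W *ᵥ H) := by
  have e1 : Y ⬝ᵥ H = H ⬝ᵥ Y := dotProduct_comm _ _
  have e2 : (W *ᵥ H) ⬝ᵥ V *ᵥ Y = H ⬝ᵥ Y := by
    rw [h.dotProduct_mulVec_comm, h.mulVec_mulVec_inv, e1]
  have e3 : (W *ᵥ H) ⬝ᵥ H = H ⬝ᵥ W *ᵥ H := dotProduct_comm _ _
  simp only [mulVec_add, mulVec_smul, h.mulVec_mulVec_inv, add_dotProduct, dotProduct_add,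
    smul_dotProduct, dotProduct_smul, smul_eq_mul, e1, e2, e3]
  ring

/-- The Sherman–Morrison formula. -/
theorem update (h : IsPreconditioner V W) (G : n → ℝ) :
    IsPreconditioner (V + vecMulVec G G)
      (W - (1 + G ⬝ᵥ W *ᵥ G)⁻¹ • vecMulVec (W *ᵥ G) (W *ᵥ G)) where
  symm := by rw [transpose_add, h.symm, transpose_vecMulVec]
  mul_eq_one := by
    have hg := h.inv_quad_nonneg G
    set g := G ⬝ᵥ W *ᵥ G with hgdef
    have hg1 : (1 + g) ≠ 0 := by positivity
    have e1 : vecMulVec G G * W = vecMulVec G (W *ᵥ G) := by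
      rw [vecMulVec_mul, ← mulVec_transpose, h.inv_symm]
    have e2 : V * vecMulVec (W *ᵥ G) (W *ᵥ G) = vecMulVec G (W *ᵥ G) := by
      rw [mul_vecMulVec, h.mulVec_mulVec_inv]
    have e3 : vecMulVec G G * vecMulVec (W *ᵥ G) (W *ᵥ G) = g • vecMulVec G (W *ᵥ G) := by
      rw [vecMulVec_mul_vecMulVec]
      ext i j
      simp only [vecMulVec_apply, Matrix.smul_apply, Pi.smul_apply, smul_eq_mul, hgdef]
      ring
    rw [add_mul, mul_sub, mul_sub, h.mul_eq_one, Matrix.mul_smul, Matrix.mul_smul, e1, e2,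
      e3, smul_smul]
    have : (1 + g)⁻¹ + (1 + g)⁻¹ * g = 1 := by field_simp
    ext i j
    simp only [Matrix.add_apply, Matrix.sub_apply, Matrix.smul_apply, smul_eq_mul]
    linear_combination (-(vecMulVec G (W *ᵥ G) i j)) * this
  le_quad := fun Y => by
    rw [dotProduct_add_vecMulVec_mulVec_self]
    have := h.le_quad Y
    have := sq_nonneg (G ⬝ᵥ Y)
    linarith

/-- After the update the dual norm of the direction of the update is at most `1`. -/
theorem update_inv_quad (h : IsPreconditioner V W) (G : n → ℝ) :
    G ⬝ᵥ (W - (1 + G ⬝ᵥ W *ᵥ G)⁻¹ • vecMulVec (W *ᵥ G) (W *ᵥ G)) *ᵥ G ≤ 1 := by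
  have hg := h.inv_quad_nonneg G
  rw [sub_mulVec, smul_mulVec, dotProduct_sub, dotProduct_smul, dotProduct_vecMulVec_mulVec_self,
    dotProduct_comm (W *ᵥ G) G, smul_eq_mul]
  set g := G ⬝ᵥ W *ᵥ G
  have : g - (1 + g)⁻¹ * g ^ 2 = g / (1 + g) := by field_simp; ring
  rw [this, div_le_one (by positivity)]
  linarith

theorem det_pos (h : IsPreconditioner V W) : 0 < V.det := by
  have hV : V.PosDef := by
    refine Matrix.PosDef.of_dotProduct_mulVec_pos (by simpa [IsHermitian] using h.symm) ?_
    intro x hx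
    refine lt_of_lt_of_le ?_ (h.le_quad x)
    exact lt_of_le_of_ne (dotProduct_self_nonneg _) fun h0 => hx (dotProduct_self_eq_zero.mp h0.symm)
  exact hV.det_pos

theorem update_det (h : IsPreconditioner V W) (G : n → ℝ) :
    (V + vecMulVec G G).det = V.det * (1 + G ⬝ᵥ W *ᵥ G) := by
  have hW : V⁻¹ = W := inv_eq_right_inv h.mul_eq_one
  rw [vecMulVec_eq Unit, det_add_replicateCol_mul_replicateRow h.det_pos.ne'.isUnit, hW]
  congr 1
  rw [det_unique, dotProduct_mulVec]
  simp [Matrix.mul_apply, dotProduct, vecMul]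

/-- The inequality of the arithmetic and geometric means for the eigenvalues. -/
theorem det_le_trace_pow (h : IsPreconditioner V W) {s : ℝ} (hs : 0 < s)
    (ht : V.trace ≤ Fintype.card n * s) : V.det ≤ s ^ Fintype.card n := by
  have hH : V.IsHermitian := by simpa [IsHermitian] using h.symm
  have hV : V.PosSemidef := by
    refine Matrix.PosSemidef.of_dotProduct_mulVec_nonneg hH fun x => ?_
    simpa using h.quad_nonneg x
  have hd : V.det = ∏ i, hH.eigenvalues i := by simpa using hH.det_eq_prod_eigenvalues
  have ht' : V.trace = ∑ i, hH.eigenvalues i := by simpa using hH.trace_eq_sum_eigenvalues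
  have h1 : ∏ i, (hH.eigenvalues i / s) ≤ ∏ i, Real.exp (hH.eigenvalues i / s - 1) := by
    refine Finset.prod_le_prod (fun i _ => div_nonneg (hV.eigenvalues_nonneg i) hs.le) ?_
    intro i _
    have := Real.add_one_le_exp (hH.eigenvalues i / s - 1)
    linarith
  rw [Finset.prod_div_distrib, ← hd, ← Real.exp_sum, Finset.sum_sub_distrib, ← Finset.sum_div,
    ← ht', Finset.prod_const, Finset.sum_const, Finset.card_univ, nsmul_eq_mul, mul_one] at h1
  have h2 : V.trace / s - Fintype.card n ≤ 0 := by
    rw [sub_nonpos, div_le_iff₀ hs]; exact ht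
  have h3 := h1.trans (Real.exp_le_one_iff.mpr h2)
  rwa [div_le_one (by positivity)] at h3

end IsPreconditioner

end Preconditioner

/-- If a determinant has grown `k` times by the factor `1 + d` while the trace increased only by
`4 d²` each time, then `k < 8 d²`. -/
theorem update_count_lt {d k : ℕ} (hd : 0 < d) (h : (1 + d) ^ k ≤ (1 + 4 * k) ^ (d * d)) :
    k < 8 * (d * d) := by
  -- otherwise let `y = k / d² ≥ 8`; taking `d²`-th roots gives `(1 + d) ^ y ≤ 1 + 4 d² (y + 1)`
  by_contra! hk
  have hD : 0 < d * d := Nat.mul_pos hd hd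
  set D := d * d with hDdef
  set y := k / D with hy
  have hy8 : 8 ≤ y := (Nat.le_div_iff_mul_le hD).mpr hk
  have h1 : D * y ≤ k := Nat.mul_div_le k D
  have h2 : k < D * (y + 1) := Nat.lt_mul_div_succ k hD
  have h3 : ((1 + d) ^ y) ^ D ≤ (1 + 4 * (D * (y + 1))) ^ D := by
    calc ((1 + d) ^ y) ^ D = (1 + d) ^ (D * y) := by rw [← pow_mul, mul_comm]
      _ ≤ (1 + d) ^ k := Nat.pow_le_pow_right (by omega) h1
      _ ≤ (1 + 4 * k) ^ D := h
      _ ≤ _ := Nat.pow_le_pow_left (by omega) D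
  have h4 : (1 + d) ^ y ≤ 1 + 4 * (D * (y + 1)) := (Nat.pow_le_pow_iff_left hD.ne').mp h3
  have h5 : ∀ z, 8 ≤ z → 16 * (z + 1) < 2 ^ z := by
    intro z hz
    induction z, hz using Nat.le_induction with
    | base => norm_num
    | succ z hz ih => rw [pow_succ]; omega
  have h6 := h5 y hy8
  have h7 : (1 + d) ^ 2 * 2 ^ (y - 2) ≤ (1 + d) ^ y := by
    calc (1 + d) ^ 2 * 2 ^ (y - 2) ≤ (1 + d) ^ 2 * (1 + d) ^ (y - 2) :=
          Nat.mul_le_mul_left _ (Nat.pow_le_pow_left (by omega) _)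
      _ = (1 + d) ^ y := by rw [← pow_add]; congr 1; omega
  have h8 : 2 ^ y = 4 * 2 ^ (y - 2) := by
    rw [show (4 : ℕ) = 2 ^ 2 by norm_num, ← pow_add]; congr 1; omega
  have h9 : 4 * (y + 1) < 2 ^ (y - 2) := by omega
  have h10 : 1 + 4 * (D * (y + 1)) ≤ (1 + d) ^ 2 * (4 * (y + 1)) := by
    rw [hDdef]; nlinarith
  have h11 : (1 + d) ^ 2 * (4 * (y + 1)) < (1 + d) ^ 2 * 2 ^ (y - 2) :=
    Nat.mul_lt_mul_of_pos_left h9 (by positivity)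
  omega

/-! ### Approximate fixed points by projecting onto half-spaces -/

section Search

variable {d : ℕ}

/-- The image of `v` under the linear map whose matrix has the entries `X (i, j)`. -/
def applyPairs (X : Fin d × Fin d → ℝ) (v : Fin d → ℝ) : Fin d → ℝ :=
  fun i => ∑ j, X (i, j) * v j

/-- The entries `s i * w j` of the outer product of two vectors. -/
def outerPairs (s w : Fin d → ℝ) : Fin d × Fin d → ℝ := fun p => s p.1 * w p.2

/-- The entries of the identity matrix. -/
def idPairs (d : ℕ) : Fin d × Fin d → ℝ := fun p => if p.1 = p.2 then 1 else 0

theorem applyPairs_idPairs (v : Fin d → ℝ) : applyPairs (idPairs d) v = v := by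
  ext i
  simp [applyPairs, idPairs]

theorem applyPairs_add (X : Fin d × Fin d → ℝ) (v w : Fin d → ℝ) :
    applyPairs X (v + w) = applyPairs X v + applyPairs X w := by
  ext i
  simp [applyPairs, mul_add, Finset.sum_add_distrib]

theorem applyPairs_smul (X : Fin d × Fin d → ℝ) (c : ℝ) (v : Fin d → ℝ) :
    applyPairs X (c • v) = c • applyPairs X v := by
  ext i
  simp only [applyPairs, Pi.smul_apply, smul_eq_mul, Finset.mul_sum]
  exact Finset.sum_congr rfl fun j _ => by ring

theorem applyPairs_zero (X : Fin d × Fin d → ℝ) : applyPairs X 0 = 0 := by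
  ext i
  simp [applyPairs]

theorem sub_applyPairs (X Y : Fin d × Fin d → ℝ) (v : Fin d → ℝ) :
    applyPairs (X - Y) v = applyPairs X v - applyPairs Y v := by
  ext i
  simp [applyPairs, sub_mul, Finset.sum_sub_distrib]

theorem outerPairs_dotProduct (s w : Fin d → ℝ) (X : Fin d × Fin d → ℝ) :
    outerPairs s w ⬝ᵥ X = s ⬝ᵥ applyPairs X w := by
  simp only [dotProduct, outerPairs, applyPairs, Fintype.sum_prod_type, Finset.mul_sum]
  exact Finset.sum_congr rfl fun i _ => Finset.sum_congr rfl fun j _ => by ring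

theorem outerPairs_dotProduct_self (s w : Fin d → ℝ) :
    outerPairs s w ⬝ᵥ outerPairs s w = (s ⬝ᵥ s) * (w ⬝ᵥ w) := by
  simp only [dotProduct, outerPairs, Fintype.sum_prod_type, Finset.sum_mul_sum]
  exact Finset.sum_congr rfl fun i _ => Finset.sum_congr rfl fun j _ => by ring

theorem dotProduct_applyPairs_self_le (X : Fin d × Fin d → ℝ) (v : Fin d → ℝ) :
    applyPairs X v ⬝ᵥ applyPairs X v ≤ (X ⬝ᵥ X) * (v ⬝ᵥ v) := by
  have h : ∀ i, applyPairs X v i * applyPairs X v i ≤ (∑ j, X (i, j) * X (i, j)) * (v ⬝ᵥ v) := by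
    intro i
    have := Finset.sum_mul_sq_le_sq_mul_sq Finset.univ (fun j => X (i, j)) v
    simpa only [applyPairs, dotProduct, sq] using this
  calc applyPairs X v ⬝ᵥ applyPairs X v
      ≤ ∑ i, (∑ j, X (i, j) * X (i, j)) * (v ⬝ᵥ v) := Finset.sum_le_sum fun i _ => h i
    _ = (X ⬝ᵥ X) * (v ⬝ᵥ v) := by
        rw [← Finset.sum_mul]; simp only [dotProduct, Fintype.sum_prod_type]

theorem dotProduct_self_le_of_abs_le {ι : Type*} [Fintype ι] {v : ι → ℝ} {c : ℝ}
    (h : ∀ i, |v i| ≤ c) : v ⬝ᵥ v ≤ Fintype.card ι * c ^ 2 := by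
  have : ∀ i ∈ Finset.univ, v i * v i ≤ c ^ 2 := by
    intro i _
    have h1 := h i
    have h2 := abs_nonneg (v i)
    rw [← abs_mul_abs_self, sq]
    exact mul_self_le_mul_self h2 h1
  simpa [dotProduct] using Finset.sum_le_sum this

/-- The matrices that map the set `A` into itself. -/
def endoPairs (A : Set (Fin d → ℝ)) : Set (Fin d × Fin d → ℝ) :=
  {Y | Set.MapsTo (applyPairs Y) A A}

theorem idPairs_mem_endoPairs (A : Set (Fin d → ℝ)) : idPairs d ∈ endoPairs A := by
  intro v hv
  rwa [applyPairs_idPairs]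

/-- A bound for the squared distance between the iterates and the identity matrix. -/
def radiusSq (d T : ℕ) : ℕ := 9 * T + d * d + 2 * d

/-- A bound for the squared norm of the increments in the search for a fixed point. -/
def incrementSq (d T : ℕ) : ℕ := 4 * d * radiusSq d T + 2

/-- The number of points that are averaged into an approximate fixed point. -/
def sampleSize (d T : ℕ) : ℕ := d * T * incrementSq d T

/-- The reciprocal of the least decrease of the squared distance in one projection. -/
def invDecrease (d T : ℕ) : ℕ := 4 * d * sampleSize d T * incrementSq d T

/-- The number of steps after which the search for a fixed point has ended. -/
def searchLength (d T : ℕ) : ℕ :=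
  sampleSize d T + sampleSize d T * radiusSq d T * invDecrease d T

/-- The search for a point `u` of `A` with `X u ≈ u`, after `n` steps.  The search collects points of
`A`: their number is `c`, their sum is `U`, and `S = U - X U`.  When `S` separates the displacements
`u - X u` from `0`, the matrix `X` is projected onto a half-space that contains all endomorphisms of
`A`, and the collection starts again.  `X₀` is the matrix at the beginning. -/
structure IsSearch (T : ℕ) (A : Set (Fin d → ℝ)) (V : Matrix (Fin d × Fin d) (Fin d × Fin d) ℝ)
    (X₀ : Fin d × Fin d → ℝ) (n : ℕ) (X : Fin d × Fin d → ℝ) (S U : Fin d → ℝ) (c : ℕ) : Prop where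
  count_le : c ≤ sampleSize d T
  displacement : S = U - applyPairs X U
  sum_eq_zero : c = 0 → U = 0
  mean_mem : c ≠ 0 → (c : ℝ)⁻¹ • U ∈ A
  norm_le : S ⬝ᵥ S ≤ c * incrementSq d T
  mono : ∀ Y ∈ endoPairs A, (X - Y) ⬝ᵥ V *ᵥ (X - Y) ≤ (X₀ - Y) ⬝ᵥ V *ᵥ (X₀ - Y)
  progress : c < sampleSize d T → (n : ℝ) ≤ c + sampleSize d T * invDecrease d T *
    (radiusSq d T - (X - idPairs d) ⬝ᵥ V *ᵥ (X - idPairs d))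

namespace IsSearch

variable {T : ℕ} {A : Set (Fin d → ℝ)} {V W : Matrix (Fin d × Fin d) (Fin d × Fin d) ℝ}
  {X₀ X : Fin d × Fin d → ℝ} {n : ℕ} {S U : Fin d → ℝ} {c : ℕ}

theorem start (hX₀ : (X₀ - idPairs d) ⬝ᵥ V *ᵥ (X₀ - idPairs d) ≤ radiusSq d T) :
    IsSearch T A V X₀ 0 X₀ 0 0 0 where
  count_le := Nat.zero_le _
  displacement := by simp [applyPairs_zero]
  sum_eq_zero := fun _ => rfl
  mean_mem := fun h => absurd rfl h
  norm_le := by simp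
  mono := fun _ _ => le_rfl
  progress := fun _ => by
    have : 0 ≤ (radiusSq d T : ℝ) - (X₀ - idPairs d) ⬝ᵥ V *ᵥ (X₀ - idPairs d) := by linarith
    simp only [Nat.cast_zero, zero_add]
    positivity

/-- A completed search is not continued. -/
theorem skip (h : IsSearch T A V X₀ n X S U c) (hc : sampleSize d T ≤ c) :
    IsSearch T A V X₀ (n + 1) X S U c :=
  { h with progress := fun h' => absurd h' (by omega) }

/-- Another point is collected. The square of the norm of `S` grows by at most `2` for the mixed term
and by a bound for the square of the displacement. -/
theorem collect (h : IsSearch T A V X₀ n X S U c) (hV : IsPreconditioner V W)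
    (hA : Convex ℝ A) (hA2 : ∀ u ∈ A, ∀ i, |u i| ≤ 2)
    (hX₀ : (X₀ - idPairs d) ⬝ᵥ V *ᵥ (X₀ - idPairs d) ≤ radiusSq d T)
    (hc : c < sampleSize d T) {v : Fin d → ℝ} (hv : v ∈ A)
    (hS : S ⬝ᵥ (v - applyPairs X v) ≤ 1) :
    IsSearch T A V X₀ (n + 1) X (S + (v - applyPairs X v)) (U + v) (c + 1) where
  count_le := hc
  displacement := by rw [h.displacement, applyPairs_add]; abel
  sum_eq_zero := fun h => absurd h (by omega)
  mean_mem := fun _ => by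
    rcases Nat.eq_zero_or_pos c with h0 | h0
    · simpa [h.sum_eq_zero h0, h0] using hv
    · have h1 := h.mean_mem h0.ne'
      have hc0 : (0 : ℝ) < c := by exact_mod_cast h0
      have h2 := hA h1 hv (a := (c : ℝ) / (c + 1)) (b := 1 / (c + 1)) (by positivity)
        (by positivity) (by field_simp)
      convert h2 using 1
      ext i
      simp only [Pi.smul_apply, Pi.add_apply, smul_eq_mul]
      push_cast
      field_simp
  norm_le := by
    have e : v - applyPairs X v = applyPairs (idPairs d - X) v := by
      rw [sub_applyPairs, applyPairs_idPairs]
    have h1 : (v - applyPairs X v) ⬝ᵥ (v - applyPairs X v) ≤ 4 * d * radiusSq d T := by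
      have hX : (idPairs d - X) ⬝ᵥ (idPairs d - X) ≤ radiusSq d T := by
        have h2 := hV.le_quad (X - idPairs d)
        have h3 := h.mono _ (idPairs_mem_endoPairs A)
        have h4 : (idPairs d - X) ⬝ᵥ (idPairs d - X) = (X - idPairs d) ⬝ᵥ (X - idPairs d) := by
          rw [← neg_sub X, neg_dotProduct_neg]
        linarith
      have hvv := dotProduct_self_le_of_abs_le (hA2 v hv)
      rw [Fintype.card_fin] at hvv
      rw [e]
      refine (dotProduct_applyPairs_self_le _ _).trans ?_
      have h5 := dotProduct_self_nonneg v
      have h6 : (0 : ℝ) ≤ radiusSq d T := Nat.cast_nonneg _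
      calc _ ≤ (radiusSq d T : ℝ) * (d * 2 ^ 2) := mul_le_mul hX hvv h5 h6
        _ = _ := by ring
    have h2 := h.norm_le
    rw [add_dotProduct, dotProduct_add, dotProduct_add, dotProduct_comm (v - applyPairs X v) S]
    rw [incrementSq] at h2 ⊢
    push_cast at h2 ⊢
    nlinarith
  mono := h.mono
  progress := fun _ => by
    have := h.progress hc
    push_cast
    linarith

/-- The projection of `X`, in the norm of `V`, onto the half-space of the matrices `Y` with
`S ⬝ᵥ (w - Y w) ≤ 0`. -/
theorem project (h : IsSearch T A V X₀ n X S U c) (hV : IsPreconditioner V W)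
    (hA2 : ∀ u ∈ A, ∀ i, |u i| ≤ 2) (hc : c < sampleSize d T) {v w : Fin d → ℝ}
    (hw : w ∈ A) (hvmin : ∀ u ∈ A, S ⬝ᵥ (v - applyPairs X v) ≤ S ⬝ᵥ (u - applyPairs X u))
    (hwmin : ∀ u ∈ A, S ⬝ᵥ w ≤ S ⬝ᵥ u) (hS : 1 < S ⬝ᵥ (v - applyPairs X v)) :
    IsSearch T A V X₀ (n + 1)
      (X + ((S ⬝ᵥ w - outerPairs S w ⬝ᵥ X) / (outerPairs S w ⬝ᵥ W *ᵥ outerPairs S w)) •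
        W *ᵥ outerPairs S w) 0 0 0 := by
  set H := outerPairs S w with hH
  set β := S ⬝ᵥ w - H ⬝ᵥ X with hβ
  set q := H ⬝ᵥ W *ᵥ H with hq
  have hβ1 : 1 < β := by
    have := hvmin w hw
    rw [dotProduct_sub S w] at this
    rw [hβ, hH, outerPairs_dotProduct]
    linarith
  have hq0 : 0 < q := by
    refine hV.inv_quad_pos fun h0 => ?_
    have e : H ⬝ᵥ (idPairs d - X) = β := by
      rw [dotProduct_sub, hβ, hH, outerPairs_dotProduct S w (idPairs d), applyPairs_idPairs]
    rw [h0, zero_dotProduct] at e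
    linarith
  have hqE : q ≤ invDecrease d T := by
    refine (hV.inv_quad_le H).trans ?_
    rw [hH, outerPairs_dotProduct_self]
    have h1 := h.norm_le
    have h2 := dotProduct_self_le_of_abs_le (hA2 w hw)
    rw [Fintype.card_fin] at h2
    have h3 : (c : ℝ) ≤ sampleSize d T := by exact_mod_cast hc.le
    have h4 : (0 : ℝ) ≤ incrementSq d T := Nat.cast_nonneg _
    have h5 := dotProduct_self_nonneg w
    calc (S ⬝ᵥ S) * (w ⬝ᵥ w)
        ≤ (sampleSize d T * incrementSq d T) * (d * 2 ^ 2) :=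
          mul_le_mul (h1.trans (mul_le_mul_of_nonneg_right h3 h4)) h2 h5 (by positivity)
      _ = invDecrease d T := by rw [invDecrease]; push_cast; ring
  -- the squared distance to every endomorphism decreases by `β² / q`
  have dec : ∀ Y ∈ endoPairs A, (X + (β / q) • W *ᵥ H - Y) ⬝ᵥ V *ᵥ (X + (β / q) • W *ᵥ H - Y) ≤
      (X - Y) ⬝ᵥ V *ᵥ (X - Y) - β ^ 2 / q := by
    intro Y hY
    have e : X + (β / q) • W *ᵥ H - Y = (X - Y) + (β / q) • W *ᵥ H := by abel
    rw [e, hV.quad_add_smul, ← hq]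
    have h1 : H ⬝ᵥ (X - Y) ≤ -β := by
      have := hwmin _ (hY hw)
      rw [dotProduct_sub, hβ, hH, outerPairs_dotProduct S w Y]
      linarith
    have h2 : 0 < β / q := by positivity
    have h3 : β / q * (H ⬝ᵥ (X - Y)) ≤ β / q * -β := mul_le_mul_of_nonneg_left h1 h2.le
    have h4 : (β / q) ^ 2 * q = β ^ 2 / q := by field_simp
    have h5 : β / q * -β = -(β ^ 2 / q) := by ring
    rw [h5] at h3
    rw [h4]
    linarith
  have hpos : 0 ≤ β ^ 2 / q := by positivity
  refine ⟨Nat.zero_le _, by simp [applyPairs_zero], fun _ => rfl, fun h => absurd rfl h, by simp,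
    fun Y hY => ?_, fun _ => ?_⟩
  · have := dec Y hY
    have := h.mono Y hY
    linarith
  · have h1 := h.progress hc
    have h2 := dec _ (idPairs_mem_endoPairs A)
    have h3 : (c : ℝ) + 1 ≤ sampleSize d T := by exact_mod_cast hc
    have hk : (0 : ℝ) ≤ sampleSize d T := Nat.cast_nonneg _
    have hE : (0 : ℝ) ≤ invDecrease d T := Nat.cast_nonneg _
    have h4 : 1 ≤ invDecrease d T * (β ^ 2 / q) := by
      rw [← mul_div_assoc, le_div_iff₀ hq0]
      have : 1 ≤ β ^ 2 := one_le_pow₀ hβ1.le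
      have := mul_le_mul_of_nonneg_left this hE
      linarith
    have h5 : (sampleSize d T : ℝ) ≤ sampleSize d T * invDecrease d T * (β ^ 2 / q) := by
      nlinarith
    have h6 := mul_le_mul_of_nonneg_left h2 (mul_nonneg hk hE)
    push_cast
    nlinarith

/-- The search is long enough to be completed. -/
theorem count_eq (h : IsSearch T A V X₀ (searchLength d T) X S U c) (hV : IsPreconditioner V W)
    (hd : 0 < sampleSize d T) : c = sampleSize d T := by
  by_contra hne
  have hc : c < sampleSize d T := lt_of_le_of_ne h.count_le hne
  have h1 := h.progress hc
  have h2 := hV.quad_nonneg (X - idPairs d)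
  have h3 : (c : ℝ) + 1 ≤ sampleSize d T := by exact_mod_cast hc
  have hkE : (0 : ℝ) ≤ sampleSize d T * invDecrease d T := by positivity
  rw [searchLength] at h1
  push_cast at h1
  nlinarith

end IsSearch

end Search

/-! ### The regret of preconditioned gradient descent -/

section Rounds

variable {d : ℕ}

/-- The step size `√(d / T)`. -/
noncomputable def stepSize (d T : ℕ) : ℝ := √((d : ℝ) / T)

/-- The accuracy `1 / √T` of the approximate fixed points. -/
noncomputable def accuracy (T : ℕ) : ℝ := (√(T : ℝ))⁻¹

/-- The state after `t` losses have been processed.  `k` is the number of rank-one updates of the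
preconditioner, and `reg Y` is the regret with respect to the endomorphism `Y` so far. -/
structure IsRoundState (T : ℕ) (A : Set (Fin d → ℝ)) (t : ℕ)
    (V W : Matrix (Fin d × Fin d) (Fin d × Fin d) ℝ) (X : Fin d × Fin d → ℝ) (k : ℕ)
    (reg : (Fin d × Fin d → ℝ) → ℝ) : Prop where
  precond : IsPreconditioner V W
  count_le : k ≤ t
  le_det : (1 + d : ℝ) ^ k ≤ V.det
  trace_le : V.trace ≤ d * d + 4 * (d * d) * k
  reg_id : reg (idPairs d) = 0
  potential : ∀ Y ∈ endoPairs A, (X - Y) ⬝ᵥ V *ᵥ (X - Y) +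
    2 * stepSize d T * (reg Y - accuracy T * t) ≤
      (idPairs d - Y) ⬝ᵥ (idPairs d - Y) + 9 * k + stepSize d T ^ 2 * d * t

theorem accuracy_nonneg (T : ℕ) : 0 ≤ accuracy T := by rw [accuracy]; positivity

theorem accuracy_le_one {T : ℕ} (hT : 0 < T) : accuracy T ≤ 1 := by
  rw [accuracy]
  refine inv_le_one_of_one_le₀ ?_
  rw [Real.one_le_sqrt]
  exact_mod_cast hT

theorem accuracy_sq (T : ℕ) : accuracy T ^ 2 = 1 / T := by
  rw [accuracy, inv_pow, Real.sq_sqrt (Nat.cast_nonneg _), one_div]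

theorem stepSize_nonneg (d T : ℕ) : 0 ≤ stepSize d T := Real.sqrt_nonneg _

theorem stepSize_sq (d T : ℕ) : stepSize d T ^ 2 = d / T := by
  rw [stepSize, Real.sq_sqrt (by positivity)]

/-- The average of the collected points is an approximate fixed point. -/
theorem IsSearch.abs_dotProduct_displacement_le {T : ℕ} {A : Set (Fin d → ℝ)}
    {V : Matrix (Fin d × Fin d) (Fin d × Fin d) ℝ} {X₀ X : Fin d × Fin d → ℝ} {n : ℕ}
    {S U : Fin d → ℝ} (h : IsSearch T A V X₀ n X S U (sampleSize d T))
    (hd : 0 < d) (hT : 0 < T) {l : Fin d → ℝ} (hl : ∀ i, |l i| ≤ 1) :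
    |l ⬝ᵥ ((sampleSize d T : ℝ)⁻¹ • U - applyPairs X ((sampleSize d T : ℝ)⁻¹ • U))| ≤
      accuracy T := by
  have hm : (0 : ℝ) < incrementSq d T := by
    have : 0 < incrementSq d T := by rw [incrementSq]; omega
    exact_mod_cast this
  have hd' : (0 : ℝ) < d := by exact_mod_cast hd
  have hT' : (0 : ℝ) < T := by exact_mod_cast hT
  set k : ℝ := ((sampleSize d T : ℕ) : ℝ) with hk
  have hk' : k = d * T * incrementSq d T := by rw [hk, sampleSize]; push_cast; ring
  have hk0 : 0 < k := by rw [hk']; positivity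
  have e : k⁻¹ • U - applyPairs X (k⁻¹ • U) = k⁻¹ • S := by
    rw [applyPairs_smul, h.displacement, smul_sub]
  rw [e, dotProduct_smul, smul_eq_mul]
  refine abs_le_of_sq_le_sq ?_ (accuracy_nonneg T)
  rw [accuracy_sq, mul_pow]
  have h1 : (l ⬝ᵥ S) ^ 2 ≤ (l ⬝ᵥ l) * (S ⬝ᵥ S) := by
    have := Finset.sum_mul_sq_le_sq_mul_sq Finset.univ l S
    simpa only [dotProduct, sq] using this
  have h2 := dotProduct_self_le_of_abs_le hl
  rw [Fintype.card_fin, one_pow, mul_one] at h2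
  have h3 : (l ⬝ᵥ S) ^ 2 ≤ d * (k * incrementSq d T) :=
    h1.trans (mul_le_mul h2 h.norm_le (dotProduct_self_nonneg S) hd'.le)
  calc k⁻¹ ^ 2 * (l ⬝ᵥ S) ^ 2 ≤ k⁻¹ ^ 2 * (d * (k * incrementSq d T)) := by gcongr
    _ = d * incrementSq d T / k := by field_simp
    _ = 1 / T := by rw [hk']; field_simp

namespace IsRoundState

variable {T t k : ℕ} {A : Set (Fin d → ℝ)} {V W : Matrix (Fin d × Fin d) (Fin d × Fin d) ℝ}
  {X X' : Fin d × Fin d → ℝ} {reg : (Fin d × Fin d → ℝ) → ℝ}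

theorem start (T : ℕ) (A : Set (Fin d → ℝ)) :
    IsRoundState T A 0 1 1 (idPairs d) 0 (fun _ => 0) where
  precond := IsPreconditioner.one
  count_le := le_rfl
  le_det := by simp
  trace_le := by simp
  reg_id := rfl
  potential := fun Y _ => by simp

/-- Moving closer to all endomorphisms does no harm. -/
theorem of_mono (h : IsRoundState T A t V W X k reg)
    (hX : ∀ Y ∈ endoPairs A, (X' - Y) ⬝ᵥ V *ᵥ (X' - Y) ≤ (X - Y) ⬝ᵥ V *ᵥ (X - Y)) :
    IsRoundState T A t V W X' k reg :=
  { h with potential := fun Y hY => (add_le_add_left (hX Y hY) _).trans (h.potential Y hY) }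

/-- The case of the identity, with respect to which there is no regret, bounds the iterates. -/
theorem radius_le (h : IsRoundState T A t V W X k reg) (hd : 0 < d) (ht : t ≤ T) (hT : 0 < T) :
    (X - idPairs d) ⬝ᵥ V *ᵥ (X - idPairs d) ≤ radiusSq d T := by
  have h1 := h.potential _ (idPairs_mem_endoPairs A)
  have hT' : (0 : ℝ) < T := by exact_mod_cast hT
  have hd' : (1 : ℝ) ≤ d := by exact_mod_cast hd
  have ht' : (t : ℝ) ≤ T := by exact_mod_cast ht
  have hk : (k : ℝ) ≤ T := by exact_mod_cast h.count_le.trans ht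
  rw [h.reg_id, sub_self, zero_dotProduct, stepSize_sq] at h1
  have h2 : (d : ℝ) / T * d * t ≤ d * d := by
    calc (d : ℝ) / T * d * t ≤ d / T * d * T := by gcongr
      _ = d * d := by field_simp
  have h3 : stepSize d T * (accuracy T * t) ≤ d := by
    have e : stepSize d T * (accuracy T * T) = √(d : ℝ) := by
      rw [stepSize, accuracy, Real.sqrt_div (by positivity)]
      have : √(T : ℝ) ≠ 0 := by positivity
      have e2 : √(T : ℝ) * √(T : ℝ) = T := Real.mul_self_sqrt hT'.le
      field_simp
      rw [sq, e2]
    calc stepSize d T * (accuracy T * t) ≤ stepSize d T * (accuracy T * T) := by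
          have := accuracy_nonneg T
          have := stepSize_nonneg d T
          gcongr
      _ = √(d : ℝ) := e
      _ ≤ d := by
          rw [Real.sqrt_le_left (by positivity)]
          nlinarith
  rw [radiusSq]
  push_cast
  linarith

/-- A gradient step after which the preconditioner is `V'`, where the squared distances to the
endomorphisms may have increased by `9` for an update. -/
theorem gradient_step_aux (h : IsRoundState T A t V W X k reg)
    {V' W' : Matrix (Fin d × Fin d) (Fin d × Fin d) ℝ} {k' : ℕ}
    {l u : Fin d → ℝ} (hV' : IsPreconditioner V' W') (hk' : k' ≤ t + 1)
    (hdet : (1 + d : ℝ) ^ k' ≤ V'.det) (htrace : V'.trace ≤ d * d + 4 * (d * d) * k')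
    (hquad : ∀ Y ∈ endoPairs A, (X - Y) ⬝ᵥ V' *ᵥ (X - Y) + 9 * k ≤
      (X - Y) ⬝ᵥ V *ᵥ (X - Y) + 9 * k')
    (hG : outerPairs l u ⬝ᵥ W' *ᵥ outerPairs l u ≤ d)
    (hfix : |l ⬝ᵥ (u - applyPairs X u)| ≤ accuracy T) :
    IsRoundState T A (t + 1) V' W' (X - stepSize d T • W' *ᵥ outerPairs l u) k'
      (fun Y => reg Y + (l ⬝ᵥ u - l ⬝ᵥ applyPairs Y u)) where
  precond := hV'
  count_le := hk'
  le_det := hdet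
  trace_le := htrace
  reg_id := by rw [h.reg_id, applyPairs_idPairs]; ring
  potential := fun Y hY => by
    have h1 := h.potential Y hY
    have h2 := hquad Y hY
    have e : X - stepSize d T • W' *ᵥ outerPairs l u - Y =
        (X - Y) + (-stepSize d T) • W' *ᵥ outerPairs l u := by
      rw [neg_smul]; abel
    rw [e, hV'.quad_add_smul, dotProduct_sub (outerPairs l u), outerPairs_dotProduct,
      outerPairs_dotProduct]
    have h3 := (abs_le.mp hfix).2
    rw [dotProduct_sub] at h3
    have h4 := stepSize_nonneg d T
    have h5 : stepSize d T ^ 2 * (outerPairs l u ⬝ᵥ W' *ᵥ outerPairs l u) ≤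
        stepSize d T ^ 2 * d := mul_le_mul_of_nonneg_left hG (sq_nonneg _)
    have h6 : stepSize d T * (l ⬝ᵥ u - l ⬝ᵥ applyPairs X u) ≤ stepSize d T * accuracy T :=
      mul_le_mul_of_nonneg_left h3 h4
    push_cast
    nlinarith

/-- A gradient step for the loss `l` at the approximate fixed point `u`, with a preceding update of the
preconditioner if the dual norm of the gradient is large. -/
theorem gradient_step (h : IsRoundState T A t V W X k reg) (hd : 0 < d) (hT : 0 < T)
    {l u : Fin d → ℝ} (hA2 : ∀ u ∈ A, ∀ i, |u i| ≤ 2) (hl : ∀ i, |l i| ≤ 1)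
    (hlA : ∀ u ∈ A, |l ⬝ᵥ u| ≤ 1) (hu : u ∈ A)
    (hfix : |l ⬝ᵥ (u - applyPairs X u)| ≤ accuracy T) :
    (outerPairs l u ⬝ᵥ W *ᵥ outerPairs l u ≤ d →
      IsRoundState T A (t + 1) V W (X - stepSize d T • W *ᵥ outerPairs l u) k
        (fun Y => reg Y + (l ⬝ᵥ u - l ⬝ᵥ applyPairs Y u))) ∧
    (∀ W', ¬ outerPairs l u ⬝ᵥ W *ᵥ outerPairs l u ≤ d →
      W' = W - (1 + outerPairs l u ⬝ᵥ W *ᵥ outerPairs l u)⁻¹ •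
        vecMulVec (W *ᵥ outerPairs l u) (W *ᵥ outerPairs l u) →
      IsRoundState T A (t + 1) (V + vecMulVec (outerPairs l u) (outerPairs l u)) W'
        (X - stepSize d T • W' *ᵥ outerPairs l u) (k + 1)
        (fun Y => reg Y + (l ⬝ᵥ u - l ⬝ᵥ applyPairs Y u))) := by
  have hd' : (1 : ℝ) ≤ d := by exact_mod_cast hd
  refine ⟨fun hG => ?_, fun W' hG hW' => ?_⟩
  · exact h.gradient_step_aux h.precond (h.count_le.trans (Nat.le_succ t)) h.le_det
      h.trace_le (fun Y _ => le_rfl) hG hfix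
  · subst hW'
    refine h.gradient_step_aux (h.precond.update _) (Nat.succ_le_succ h.count_le) ?_ ?_ ?_
      ((h.precond.update_inv_quad _).trans hd') hfix
    · rw [h.precond.update_det, pow_succ]
      push Not at hG
      exact mul_le_mul h.le_det (by linarith) (by positivity) h.precond.det_pos.le
    · rw [trace_add_vecMulVec_self, outerPairs_dotProduct_self]
      have h1 := dotProduct_self_le_of_abs_le hl
      have h2 := dotProduct_self_le_of_abs_le (hA2 u hu)
      rw [Fintype.card_fin] at h1 h2
      have h3 : (l ⬝ᵥ l) * (u ⬝ᵥ u) ≤ (d * 1 ^ 2) * (d * 2 ^ 2) :=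
        mul_le_mul h1 h2 (dotProduct_self_nonneg u) (by positivity)
      have h4 := h.trace_le
      push_cast
      nlinarith
    · intro Y hY
      rw [dotProduct_add_vecMulVec_mulVec_self, dotProduct_sub (outerPairs l u),
        outerPairs_dotProduct, outerPairs_dotProduct]
      have h1 := abs_le.mp (hlA u hu)
      have h2 := abs_le.mp (hlA _ (hY hu))
      have h3 := abs_le.mp hfix
      rw [dotProduct_sub] at h3
      have h4 := accuracy_le_one hT
      have h5 : (l ⬝ᵥ applyPairs X u - l ⬝ᵥ applyPairs Y u) ^ 2 ≤ 9 := by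
        rw [show (9 : ℝ) = 3 ^ 2 by norm_num]
        exact sq_le_sq' (by linarith) (by linarith)
      push_cast
      linarith

theorem count_lt (h : IsRoundState T A t V W X k reg) (hd : 0 < d) : k < 8 * (d * d) := by
  refine update_count_lt hd ?_
  have h1 : V.det ≤ (1 + 4 * k : ℝ) ^ Fintype.card (Fin d × Fin d) := by
    refine h.precond.det_le_trace_pow (by positivity) (h.trace_le.trans ?_)
    rw [Fintype.card_prod, Fintype.card_fin]
    push_cast
    nlinarith
  rw [Fintype.card_prod, Fintype.card_fin] at h1
  exact_mod_cast h.le_det.trans h1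

theorem reg_le (h : IsRoundState T A T V W X k reg) (hd : 0 < d) (hT : 0 < T)
    (hA2 : ∀ u ∈ A, ∀ i, |u i| ≤ 2) (hAe : ∀ i, Pi.single i 1 ∈ A)
    {Y : Fin d × Fin d → ℝ} (hY : Y ∈ endoPairs A) :
    reg Y ≤ 42 * (d : ℝ) ^ (3 / 2 : ℝ) * √(T : ℝ) := by
  have hd' : (1 : ℝ) ≤ d := by exact_mod_cast hd
  have hT' : (1 : ℝ) ≤ T := by exact_mod_cast hT
  have h1 := h.potential Y hY
  have h2 : (k : ℝ) ≤ 8 * (d * d) := by exact_mod_cast (h.count_lt hd).le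
  have h3 : (idPairs d - Y) ⬝ᵥ (idPairs d - Y) ≤ 9 * (d * d) := by
    have : ∀ p, |(idPairs d - Y) p| ≤ 3 := by
      rintro ⟨i, j⟩
      have e : applyPairs Y (Pi.single j 1) i = Y (i, j) := by
        simp [applyPairs, Pi.single_apply]
      have h4 := hA2 _ (hY (hAe j)) i
      rw [e] at h4
      have h5 : |idPairs d (i, j)| ≤ 1 := by
        simp only [idPairs]; split_ifs <;> simp
      rw [Pi.sub_apply]
      exact (abs_sub _ _).trans (by linarith)
    have := dotProduct_self_le_of_abs_le this
    rw [Fintype.card_prod, Fintype.card_fin] at this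
    push_cast at this
    linarith
  have h4 := h.precond.quad_nonneg (X - Y)
  set r := √(T : ℝ) with hr
  set q := √(d : ℝ) with hq
  have hr0 : 0 < r := by positivity
  have hq1 : 1 ≤ q := by rw [hq, Real.one_le_sqrt]; exact hd'
  have hrr : r * r = T := Real.mul_self_sqrt (by positivity)
  have hqq : q * q = d := Real.mul_self_sqrt (by positivity)
  have hη : stepSize d T = q / r := by rw [stepSize, Real.sqrt_div (by positivity)]
  have hε : accuracy T * T = r := by rw [accuracy, ← hr, ← hrr]; field_simp
  have h5 : stepSize d T ^ 2 * d * T = d * d := by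
    rw [stepSize_sq]; field_simp
  rw [h5, hε] at h1
  -- `82 = 9 + 9 * 8 + 1`: the distance at the start, the updates and the gradient steps
  have h6 : 2 * stepSize d T * (reg Y - r) ≤ 82 * (d * d) := by linarith
  rw [hη, ← hqq] at h6
  have h7 : reg Y - r ≤ 41 * (q * q * q) * r := by
    have e : 2 * (q / r) * (reg Y - r) = (2 * q / r) * (reg Y - r) := by ring
    have e2 : 82 * (q * q * (q * q)) = (2 * q / r) * (41 * (q * q * q) * r) := by
      field_simp; ring
    rw [e, e2] at h6
    exact le_of_mul_le_mul_left h6 (by positivity)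
  have h8 : (d : ℝ) ^ (3 / 2 : ℝ) = q * q * q := by
    rw [show (3 / 2 : ℝ) = 1 + 1 / 2 by norm_num, Real.rpow_add (by positivity), Real.rpow_one,
      ← Real.sqrt_eq_rpow, ← hq, hqq]
  rw [h8]
  have h9 : 1 ≤ q * q * q := by nlinarith
  nlinarith

end IsRoundState

end Rounds

/-! ### Barycentric spanners -/

section Spanner

variable {d : ℕ}

/-- The dual basis after the `i`-th basis vector has been replaced by `y`. -/
noncomputable def pivotDual (R : Matrix (Fin d) (Fin d) ℝ) (i : Fin d) (y : Fin d → ℝ) :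
    Matrix (Fin d) (Fin d) ℝ :=
  Matrix.of fun x => R x - ((R x ⬝ᵥ y - if x = i then 1 else 0) / (R i ⬝ᵥ y)) • R i

theorem mul_transpose_eq_one_iff {B R : Matrix (Fin d) (Fin d) ℝ} :
    R * Bᵀ = 1 ↔ ∀ i j, R i ⬝ᵥ B j = if i = j then 1 else 0 := by
  rw [← Matrix.ext_iff]
  simp only [Matrix.mul_apply, transpose_apply, Matrix.one_apply, dotProduct]

theorem pivotDual_mul_transpose {B R : Matrix (Fin d) (Fin d) ℝ} (h : R * Bᵀ = 1) {i : Fin d}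
    {y : Fin d → ℝ} (hy : R i ⬝ᵥ y ≠ 0) : pivotDual R i y * (B.updateRow i y)ᵀ = 1 := by
  rw [mul_transpose_eq_one_iff] at h ⊢
  intro x j
  have e : pivotDual R i y x =
      R x - ((R x ⬝ᵥ y - if x = i then 1 else 0) / (R i ⬝ᵥ y)) • R i := rfl
  rw [e, sub_dotProduct, smul_dotProduct, smul_eq_mul]
  by_cases hj : j = i
  · subst hj
    rw [updateRow_self, div_mul_cancel₀ _ hy]
    ring
  · rw [updateRow_ne hj, h, h, if_neg (Ne.symm hj)]
    ring

theorem eq_sum_of_mul_transpose_eq_one {B R : Matrix (Fin d) (Fin d) ℝ} (h : R * Bᵀ = 1)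
    (y : Fin d → ℝ) : y = ∑ k, (R k ⬝ᵥ y) • B k := by
  have h' : Bᵀ * R = 1 := mul_eq_one_comm.mp h
  calc y = (Bᵀ * R) *ᵥ y := by rw [h', one_mulVec]
    _ = Bᵀ *ᵥ (R *ᵥ y) := by rw [mulVec_mulVec]
    _ = ∑ k, (R k ⬝ᵥ y) • B k := by
      ext i
      simp only [mulVec, dotProduct, transpose_apply, Finset.sum_apply, Pi.smul_apply, smul_eq_mul]
      exact Finset.sum_congr rfl fun k _ => mul_comm _ _

theorem det_updateRow_eq {B R : Matrix (Fin d) (Fin d) ℝ} (h : R * Bᵀ = 1) (i : Fin d)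
    (y : Fin d → ℝ) : (B.updateRow i y).det = (R i ⬝ᵥ y) * B.det := by
  conv_lhs => rw [eq_sum_of_mul_transpose_eq_one h y]
  rw [det_updateRow_sum, smul_eq_mul]

/-- One step of the construction of a spanner: the `i`-th vector `B i` is replaced by a point `y`
of `P` at which the `i`-th coordinate is largest in absolute value, unless the square of this value
is at most `thr`.  The rows of `R` are the dual basis. -/
def SpannerStep (P : Set (Fin d → ℝ)) (thr : ℝ) (i : Fin d) (B R B' R' : Matrix (Fin d) (Fin d) ℝ) :
    Prop :=
  ∃ y ∈ P, (∀ p ∈ P, |R i ⬝ᵥ p| ≤ |R i ⬝ᵥ y|) ∧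
    (((R i ⬝ᵥ y) ^ 2 ≤ thr ∧ B' = B ∧ R' = R) ∨
      (thr < (R i ⬝ᵥ y) ^ 2 ∧ B' = B.updateRow i y ∧ R' = pivotDual R i y))

/-- The first pass, after the first `n` vectors have been replaced.  The functionals `F k` are the
coordinates at the time of the replacement. -/
def IsFirstPass (P : Set (Fin d → ℝ)) (n : ℕ) (B R : Matrix (Fin d) (Fin d) ℝ) : Prop :=
  R * Bᵀ = 1 ∧ (∀ j : Fin d, (j : ℕ) < n → B j ∈ P) ∧
    ∃ F : Matrix (Fin d) (Fin d) ℝ, ∀ k : Fin d, (k : ℕ) < n →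
      (∀ p ∈ P, |F k ⬝ᵥ p| ≤ 1) ∧ (∀ j < k, F k ⬝ᵥ B j = 0) ∧ F k ⬝ᵥ B k = 1

/-- The later passes, after `n` of them and `i` steps of the next one: unless the spanner is found,
every pass has doubled the determinant, whose value after the first pass is `δ`. -/
def IsLaterPass (P : Set (Fin d → ℝ)) (δ : ℝ) (n i : ℕ) (B R : Matrix (Fin d) (Fin d) ℝ) : Prop :=
  R * Bᵀ = 1 ∧ (∀ j, B j ∈ P) ∧
    (2 ^ (n + 1) * δ ≤ |B.det| ∨
      (2 ^ n * δ ≤ |B.det| ∧ ∀ j : Fin d, (j : ℕ) < i → ∀ p ∈ P, |R j ⬝ᵥ p| ≤ 2) ∨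
      ∀ j, ∀ p ∈ P, |R j ⬝ᵥ p| ≤ 2)

variable {P : Set (Fin d → ℝ)} {B R B' R' : Matrix (Fin d) (Fin d) ℝ}

theorem IsFirstPass.zero : IsFirstPass P 0 (1 : Matrix (Fin d) (Fin d) ℝ) 1 :=
  ⟨by simp, by intros; omega, 0, by intros; omega⟩

theorem IsFirstPass.succ {i : Fin d} (h : IsFirstPass P i B R)
    (hP : ∀ r : Fin d → ℝ, r ≠ 0 → ∃ p ∈ P, r ⬝ᵥ p ≠ 0) (hs : SpannerStep P 0 i B R B' R') :
    IsFirstPass P (i + 1) B' R' := by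
  obtain ⟨h1, h2, F, hF⟩ := h
  obtain ⟨y, hy, hmax, hcase⟩ := hs
  have hdual := mul_transpose_eq_one_iff.mp h1
  have hne : R i ⬝ᵥ y ≠ 0 := by
    have hRi : R i ≠ 0 := by
      intro h0
      have := hdual i i
      rw [h0, zero_dotProduct, if_pos rfl] at this
      exact zero_ne_one this
    obtain ⟨p, hp, hp0⟩ := hP _ hRi
    intro h0
    have := hmax p hp
    rw [h0, abs_zero] at this
    exact hp0 (abs_nonpos_iff.mp this)
  rcases hcase with ⟨hle, _, _⟩ | ⟨_, rfl, rfl⟩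
  · exact absurd (pow_eq_zero_iff (two_ne_zero)|>.mp (le_antisymm hle (sq_nonneg _))) hne
  have hdual' := pivotDual_mul_transpose h1 hne
  have hd' := mul_transpose_eq_one_iff.mp hdual'
  refine ⟨hdual', ?_, F.updateRow i (pivotDual R i y i), ?_⟩
  · intro j hj
    by_cases hji : j = i
    · subst hji; rwa [updateRow_self]
    · rw [updateRow_ne hji]
      have : (j : ℕ) ≠ i := fun h => hji (Fin.ext h)
      exact h2 j (by omega)
  · intro k hk
    by_cases hki : k = i
    · subst hki
      rw [updateRow_self]
      refine ⟨fun p hp => ?_, fun j hj => ?_, ?_⟩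
      · have e : pivotDual R k y k ⬝ᵥ p = (R k ⬝ᵥ p) / (R k ⬝ᵥ y) := by
          have e0 : pivotDual R k y k = R k - ((R k ⬝ᵥ y - if k = k then 1 else 0) /
            (R k ⬝ᵥ y)) • R k := rfl
          rw [e0, if_pos rfl, sub_dotProduct, smul_dotProduct, smul_eq_mul]
          field_simp
          ring
        rw [e, abs_div, div_le_one (abs_pos.mpr hne)]
        exact hmax p hp
      · rw [hd', if_neg hj.ne']
      · rw [hd', if_pos rfl]
    · have hlt : (k : ℕ) < i := by
        have : (k : ℕ) ≠ i := fun h => hki (Fin.ext h)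
        omega
      obtain ⟨f1, f2, f3⟩ := hF k hlt
      rw [updateRow_ne hki]
      refine ⟨f1, fun j hj => ?_, ?_⟩
      · have hji : j ≠ i := fun h => by
          rw [h] at hj
          exact absurd hlt (by have : (i : ℕ) < k := hj; omega)
        rw [updateRow_ne hji]
        exact f2 j hj
      · rw [updateRow_ne hki]
        exact f3

/-- After the first pass the determinant is within the factor `d!` of the largest one, because the
matrix `F Bᵀ` is unitriangular and the entries of `F B'ᵀ` are bounded by `1`. -/
theorem IsFirstPass.det_le (h : IsFirstPass P d B R) (hB' : ∀ j, B' j ∈ P) :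
    |B'.det| ≤ d.factorial * |B.det| := by
  obtain ⟨_, _, F, hF⟩ := h
  have h1 : (F * Bᵀ).det = 1 := by
    have htri : (F * Bᵀ).IsUpperTriangular := by
      intro k j hjk
      have := (hF k k.2).2.1 j hjk
      simpa [Matrix.mul_apply, dotProduct] using this
    rw [det_of_isUpperTriangular htri]
    refine Finset.prod_eq_one fun k _ => ?_
    have := (hF k k.2).2.2
    simpa [Matrix.mul_apply, dotProduct] using this
  have h2 : |(F * B'ᵀ).det| ≤ d.factorial := by
    have := Matrix.det_le (A := F * B'ᵀ) (abv := AbsoluteValue.abs) (x := (1 : ℝ)) (fun k j => by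
      have := (hF k k.2).1 _ (hB' j)
      simpa [Matrix.mul_apply, dotProduct] using this)
    simpa using this
  rw [det_mul, det_transpose] at h1 h2
  rw [abs_mul] at h2
  have h3 : |F.det| * |B.det| = 1 := by rw [← abs_mul, h1, abs_one]
  calc |B'.det| = (|F.det| * |B'.det|) * |B.det| := by
        rw [mul_right_comm, h3, one_mul]
    _ ≤ d.factorial * |B.det| := mul_le_mul_of_nonneg_right h2 (abs_nonneg _)

theorem IsFirstPass.isLaterPass (h : IsFirstPass P d B R) : IsLaterPass P |B.det| 0 0 B R :=
  ⟨h.1, fun j => h.2.1 j j.2, Or.inr (Or.inl ⟨by simp, by intros; omega⟩)⟩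

theorem IsLaterPass.succ {δ : ℝ} {n : ℕ} {i : Fin d} (h : IsLaterPass P δ n i B R)
    (hs : SpannerStep P 4 i B R B' R') : IsLaterPass P δ n (i + 1) B' R' := by
  obtain ⟨h1, h2, h3⟩ := h
  obtain ⟨y, hy, hmax, hcase⟩ := hs
  rcases hcase with ⟨hle, rfl, rfl⟩ | ⟨hgt, rfl, rfl⟩
  · refine ⟨h1, h2, h3.imp_right (Or.imp_left fun h4 => ⟨h4.1, fun j hj p hp => ?_⟩)⟩
    rcases Nat.lt_succ_iff_lt_or_eq.mp hj with hlt | heq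
    · exact h4.2 j hlt p hp
    · rw [Fin.ext heq]
      refine (hmax p hp).trans (abs_le_of_sq_le_sq ?_ (by norm_num))
      linarith
  · have hgt' : 2 < |R i ⬝ᵥ y| := by
      refine lt_of_pow_lt_pow_left₀ 2 (abs_nonneg _) ?_
      rw [sq_abs]
      linarith
    have hne : R i ⬝ᵥ y ≠ 0 := fun h0 => by rw [h0, abs_zero] at hgt'; linarith
    refine ⟨pivotDual_mul_transpose h1 hne, fun j => ?_, ?_⟩
    · by_cases hji : j = i
      · subst hji; rwa [updateRow_self]
      · rw [updateRow_ne hji]; exact h2 j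
    · rw [det_updateRow_eq h1, abs_mul]
      have h0 := abs_nonneg B.det
      rcases h3 with h3 | h3 | h3
      · left; nlinarith
      · left
        rw [pow_succ]
        nlinarith [h3.1]
      · exact absurd (h3 i y hy) (by linarith)

theorem IsLaterPass.next {δ : ℝ} {n : ℕ} (h : IsLaterPass P δ n d B R) :
    IsLaterPass P δ (n + 1) 0 B R := by
  obtain ⟨h1, h2, h3⟩ := h
  refine ⟨h1, h2, ?_⟩
  rcases h3 with h3 | h3 | h3
  · exact Or.inr (Or.inl ⟨h3, by intros; omega⟩)
  · exact Or.inr (Or.inr fun j => h3.2 j j.2)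
  · exact Or.inr (Or.inr h3)

theorem factorial_lt_two_pow (d : ℕ) : d.factorial < 2 ^ (d * d + 1) := by
  calc d.factorial ≤ d ^ d := Nat.factorial_le_pow d
    _ ≤ (2 ^ d) ^ d := Nat.pow_le_pow_left Nat.lt_two_pow_self.le d
    _ = 2 ^ (d * d) := by rw [pow_mul]
    _ < 2 ^ (d * d + 1) := Nat.pow_lt_pow_right (by norm_num) (by omega)

/-- After `d² + 1` later passes the basis is a `2`-approximate barycentric spanner. -/
theorem IsLaterPass.abs_le_two {δ : ℝ} (hδ : 0 < δ)
    (hdet : ∀ B' : Matrix (Fin d) (Fin d) ℝ, (∀ j, B' j ∈ P) → |B'.det| ≤ d.factorial * δ)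
    (h : IsLaterPass P δ (d * d + 1) 0 B R) : ∀ j, ∀ p ∈ P, |R j ⬝ᵥ p| ≤ 2 := by
  obtain ⟨_, h2, h3⟩ := h
  have hup := hdet B h2
  have hf : (d.factorial : ℝ) < 2 ^ (d * d + 1) := by exact_mod_cast factorial_lt_two_pow d
  have hlt : d.factorial * δ < 2 ^ (d * d + 1) * δ := mul_lt_mul_of_pos_right hf hδ
  rcases h3 with h3 | h3 | h3
  · have : (2 : ℝ) ^ (d * d + 1) * δ ≤ 2 ^ (d * d + 1 + 1) * δ := by
      rw [pow_succ _ (d * d + 1)]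
      nlinarith [pow_pos (two_pos : (0 : ℝ) < 2) (d * d + 1)]
    linarith
  · linarith [h3.1]
  · exact h3

theorem det_ne_zero_of_mul_transpose (h : R * Bᵀ = 1) : B.det ≠ 0 := by
  intro h0
  have := congrArg Matrix.det h
  rw [det_mul, det_transpose, h0, mul_zero, det_one] at this
  exact zero_ne_one this

end Spanner

namespace RealRAM

/-! ### Vectors and matrices in memory -/

section Views

variable {d : ℕ}

/-- The vector in the array `a`. -/
def Memory.vec (m : Memory) (a : ℕ) : Fin d → ℝ := fun i => m.arr a i

/-- The `d × d` matrix that is stored row by row in the array `a`. -/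
def Memory.mat (m : Memory) (a : ℕ) : Matrix (Fin d) (Fin d) ℝ :=
  Matrix.of fun i j => m.arr a (i * d + j)

/-- The `d × d` matrix in the array `a`, as a vector of length `d²`. -/
def Memory.flat (m : Memory) (a : ℕ) : Fin d × Fin d → ℝ := fun p => m.arr a (p.1 * d + p.2)

/-- The `d² × d²` matrix that is stored row by row in the array `a`. -/
def Memory.big (m : Memory) (a : ℕ) : Matrix (Fin d × Fin d) (Fin d × Fin d) ℝ :=
  Matrix.of fun p q => m.arr a ((p.1 * d + p.2) * (d * d) + (q.1 * d + q.2))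

theorem pair_lt (p : Fin d × Fin d) : (p.1 * d + p.2 : ℕ) < d * d := by
  have h1 := p.1.2
  have h2 := p.2.2
  nlinarith

theorem sum_range_mul_self (f : ℕ → ℝ) :
    ∑ k ∈ Finset.range (d * d), f k = ∑ p : Fin d × Fin d, f (p.1 * d + p.2) := by
  rw [Finset.sum_range, ← finProdFinEquiv.sum_comp]
  refine Finset.sum_congr rfl fun p _ => ?_
  congr 1
  simp only [finProdFinEquiv_apply_val]
  ring

variable (o : EuclideanSpace ℝ (Fin d) → EuclideanSpace ℝ (Fin d))

theorem vec_run_fill {a : ℕ} {nz κ : NatExpr} {init term : RealExpr} {m : Memory}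
    (hm : m.nat 0 = d) (hnz : nz.noIndex = true) (hinit : init.avoids a = true)
    (hterm : term.avoids a = true) :
    (run o (fill a (.const 1) (.var 0) nz κ init term) m).vec a =
      fun j : Fin d => fillValue m a (.var 0) nz κ init term 0 j := by
  ext j
  have := run_fill o a (.const 1) (.var 0) nz κ init term m rfl hnz hinit hterm
    (i := 0) (j := j) Nat.one_pos (by rw [NatExpr.eval, hm]; exact j.2)
  rwa [zero_mul, zero_add] at this

theorem flat_run_fill {a : ℕ} {nz κ : NatExpr} {init term : RealExpr} {m : Memory}
    (hm : m.nat 0 = d) (hnz : nz.noIndex = true) (hinit : init.avoids a = true)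
    (hterm : term.avoids a = true) :
    (run o (fill a (.var 0) (.var 0) nz κ init term) m).flat a =
      fun p : Fin d × Fin d => fillValue m a (.var 0) nz κ init term p.1 p.2 := by
  ext p
  have := run_fill o a (.var 0) (.var 0) nz κ init term m rfl hnz hinit hterm
    (i := p.1) (j := p.2) (by rw [NatExpr.eval, hm]; exact p.1.2)
    (by rw [NatExpr.eval, hm]; exact p.2.2)
  rwa [NatExpr.eval, hm] at this

theorem mat_run_fill {a : ℕ} {nz κ : NatExpr} {init term : RealExpr} {m : Memory}
    (hm : m.nat 0 = d) (hnz : nz.noIndex = true) (hinit : init.avoids a = true)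
    (hterm : term.avoids a = true) :
    (run o (fill a (.var 0) (.var 0) nz κ init term) m).mat a =
      Matrix.of fun i j : Fin d => fillValue m a (.var 0) nz κ init term i j := by
  ext i j
  exact congrFun (flat_run_fill o hm hnz hinit hterm) (i, j)

theorem flat_run_fill_row {a : ℕ} {nz κ : NatExpr} {init term : RealExpr} {m : Memory}
    (hm : m.nat 0 = d) (hnz : nz.noIndex = true) (hinit : init.avoids a = true)
    (hterm : term.avoids a = true) :
    (run o (fill a (.const 1) (.mul (.var 0) (.var 0)) nz κ init term) m).flat a =
      fun p : Fin d × Fin d =>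
        fillValue m a (.mul (.var 0) (.var 0)) nz κ init term 0 (p.1 * d + p.2) := by
  ext p
  have := run_fill o a (.const 1) (.mul (.var 0) (.var 0)) nz κ init term m rfl hnz hinit hterm
    (i := 0) (j := p.1 * d + p.2) Nat.one_pos (by simp only [NatExpr.eval, hm]; exact pair_lt p)
  rwa [zero_mul, zero_add] at this

theorem big_run_fill {a : ℕ} {nz κ : NatExpr} {init term : RealExpr} {m : Memory}
    (hm : m.nat 0 = d) (hnz : nz.noIndex = true) (hinit : init.avoids a = true)
    (hterm : term.avoids a = true) :
    (run o (fill a (.mul (.var 0) (.var 0)) (.mul (.var 0) (.var 0)) nz κ init term) m).big a =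
      Matrix.of fun p q : Fin d × Fin d =>
        fillValue m a (.mul (.var 0) (.var 0)) nz κ init term (p.1 * d + p.2) (q.1 * d + q.2) := by
  ext p q
  have := run_fill o a (.mul (.var 0) (.var 0)) (.mul (.var 0) (.var 0)) nz κ init term m rfl
    hnz hinit hterm (i := p.1 * d + p.2) (j := q.1 * d + q.2)
    (by simp only [NatExpr.eval, hm]; exact pair_lt p)
    (by simp only [NatExpr.eval, hm]; exact pair_lt q)
  simp only [NatExpr.eval, hm] at this
  exact this

theorem scalar_run_fill {a : ℕ} {nz κ : NatExpr} {init term : RealExpr} {m : Memory}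
    (hnz : nz.noIndex = true) (hinit : init.avoids a = true) (hterm : term.avoids a = true) :
    (run o (fill a (.const 1) (.const 1) nz κ init term) m).arr a 0 =
      fillValue m a (.const 1) nz κ init term 0 0 := by
  have := run_fill o a (.const 1) (.const 1) nz κ init term m rfl hnz hinit hterm
    (i := 0) (j := 0) Nat.one_pos Nat.one_pos
  rwa [zero_mul, zero_add] at this

theorem vec_store_self (m : Memory) (b : ℕ) (v : EuclideanSpace ℝ (Fin d)) :
    (m.store b v).vec b = v.ofLp := by
  ext i
  simp [Memory.vec, Memory.store]

theorem arr_store_ne (m : Memory) {a b : ℕ} (h : a ≠ b) (v : EuclideanSpace ℝ (Fin d)) :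
    (m.store b v).arr a = m.arr a := by
  simp [Memory.store, h]

theorem load_eq (m : Memory) (a : ℕ) :
    (m.load a : EuclideanSpace ℝ (Fin d)) = WithLp.toLp 2 (m.vec a) := rfl

/-- `1` if the values of the expressions are equal, and `0` otherwise. -/
def NatExpr.delta (e f : NatExpr) : NatExpr := .sub (.const 1) (.add (.sub e f) (.sub f e))

theorem NatExpr.eval_delta (e f : NatExpr) (m : Memory) :
    (NatExpr.delta e f).eval m = if e.eval m = f.eval m then 1 else 0 := by
  simp only [NatExpr.delta, NatExpr.eval]
  split_ifs <;> omega

end Views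

section Points

variable {d : ℕ}

/-- The points of `P`, as functions on `Fin d`. -/
def points (P : Set (EuclideanSpace ℝ (Fin d))) : Set (Fin d → ℝ) := {v | WithLp.toLp 2 v ∈ P}

theorem real_inner_eq_dotProduct (x y : EuclideanSpace ℝ (Fin d)) :
    ⟪x, y⟫ = x.ofLp ⬝ᵥ y.ofLp := by
  simp [PiLp.inner_apply, dotProduct, mul_comm]

theorem _root_.IsLinearOptimizationOracle.dotProduct_le {P : Set (EuclideanSpace ℝ (Fin d))}
    {o : EuclideanSpace ℝ (Fin d) → EuclideanSpace ℝ (Fin d)}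
    (ho : IsLinearOptimizationOracle P o) (c : Fin d → ℝ) :
    (o (WithLp.toLp 2 c)).ofLp ∈ points P ∧
      ∀ p ∈ points P, c ⬝ᵥ (o (WithLp.toLp 2 c)).ofLp ≤ c ⬝ᵥ p := by
  refine ⟨(ho _).1, fun p hp => ?_⟩
  have := (ho (WithLp.toLp 2 c)).2 _ hp
  rwa [real_inner_eq_dotProduct, real_inner_eq_dotProduct] at this

end Points

/-! ### The preprocessing program -/

/-!
The programs use the memory as follows.

* Registers: `0`, `1`, `2` are the input, `3` counts the collected points, `4` and `5` number the
  passes and the steps of the construction of the spanner, `6` numbers the steps of the search, and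
  `10`, `11`, `12` are the index registers of `fill`.
* Arrays: `0` the strategy, `1` the last loss, `2` the spanner (row by row), `3` its dual basis, `4` the
  matrix `X`, `5` the inverse of the preconditioner, `6` the sum `S` of the displacements, `7` the sum
  `U` of the collected points, `19` the coordinates of the strategy; the arrays from `8` to `18` hold
  intermediate results.
-/

/-- The expression `0`. -/
def RealExpr.zero : RealExpr := .ofNat (.const 0)

/-- Evaluate the coordinate number `r5` at the two extreme points of the strategy set, and store the
extreme point with the larger absolute value in array `9`, and the value there in array `14`.  Array
`8` holds the coordinate functional. -/
def extremeProgram : Program :=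
  .seq (fill 8 (.const 1) (.var 0) (.const 0) (.const 0)
    (.read 3 (.add (.mul (.var 5) (.var 0)) (.var 11))) .zero) <|
  .seq (.oracle 8 9) <|
  .seq (fill 16 (.const 1) (.var 0) (.const 0) (.const 0) (.sub .zero (.read 8 (.var 11))) .zero) <|
  .seq (.oracle 16 10) <|
  .seq (fill 14 (.const 1) (.const 1) (.var 0) (.const 0) .zero
    (.mul (.read 8 (.var 12)) (.read 9 (.var 12)))) <|
  .seq (fill 15 (.const 1) (.const 1) (.var 0) (.const 0) .zero
    (.mul (.read 8 (.var 12)) (.read 10 (.var 12)))) <|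
  .seq (.ifReal (.mul (.read 14 (.const 0)) (.read 14 (.const 0)))
      (.mul (.read 15 (.const 0)) (.read 15 (.const 0)))
    (fill 9 (.const 1) (.var 0) (.const 0) (.const 0) (.read 10 (.var 11)) .zero) .skip) <|
  fill 14 (.const 1) (.const 1) (.var 0) (.const 0) .zero
    (.mul (.read 8 (.var 12)) (.read 9 (.var 12)))

/-- Replace the basis vector number `r5` by the vector in array `9`, and update the dual basis. -/
def pivotProgram : Program :=
  .seq (fill 11 (.const 1) (.var 0) (.var 0) (.const 0) .zero
    (.mul (.read 3 (.add (.mul (.var 11) (.var 0)) (.var 12))) (.read 9 (.var 12)))) <|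
  .seq (fill 3 (.var 0) (.var 0) (.const 0) (.const 1)
    (.sub .zero (.mul (.div (.sub (.read 11 (.var 10)) (.ofNat (.delta (.var 10) (.var 5))))
      (.read 14 (.const 0))) (.read 8 (.var 11)))) .zero) <|
  fill 2 (.var 0) (.var 0) (.const 0) (.sub (.const 1) (.delta (.var 10) (.var 5)))
    (.mul (.ofNat (.delta (.var 10) (.var 5))) (.read 9 (.var 11))) .zero

/-- The square of the threshold for a replacement: `0` in the first pass, and `4` in later passes. -/
def thresholdExpr : NatExpr := .sub (.const 4) (.sub (.const 4) (.mul (.const 4) (.var 4)))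

/-- One step of the construction of the spanner. -/
def spannerStepProgram : Program :=
  .seq extremeProgram <|
  .ifReal (.mul (.read 14 (.const 0)) (.read 14 (.const 0))) (.ofNat thresholdExpr) .skip
    pivotProgram

/-- The construction of the spanner in array `2`, and of its dual basis in array `3`. -/
def spannerProgram : Program :=
  .seq (fill 2 (.var 0) (.var 0) (.const 0) (.const 0)
    (.ofNat (.delta (.var 10) (.var 11))) .zero) <|
  .seq (fill 3 (.var 0) (.var 0) (.const 0) (.const 0)
    (.ofNat (.delta (.var 10) (.var 11))) .zero) <|
  .loop 4 (.add (.mul (.var 0) (.var 0)) (.const 2)) (.loop 5 (.var 0) spannerStepProgram)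

/-- The preprocessing when the origin is not a strategy. -/
def initProgram : Program :=
  .seq spannerProgram <|
  .seq (fill 4 (.var 0) (.var 0) (.const 0) (.const 0) (.ofNat (.delta (.var 10) (.var 11))) .zero) <|
  fill 5 (.mul (.var 0) (.var 0)) (.mul (.var 0) (.var 0)) (.const 0) (.const 0)
    (.ofNat (.delta (.var 10) (.var 11))) .zero

section

variable {d : ℕ} {P : Set (EuclideanSpace ℝ (Fin d))}
  {o : EuclideanSpace ℝ (Fin d) → EuclideanSpace ℝ (Fin d)}

theorem vec_congr {m m' : Memory} {a b : ℕ} (h : m.arr a = m'.arr b) :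
    (m.vec a : Fin d → ℝ) = m'.vec b := by
  funext i
  simp only [Memory.vec, h]

theorem mat_congr {m m' : Memory} {a b : ℕ} (h : m.arr a = m'.arr b) :
    (m.mat a : Matrix (Fin d) (Fin d) ℝ) = m'.mat b := by
  unfold Memory.mat; rw [h]

theorem flat_congr {m m' : Memory} {a b : ℕ} (h : m.arr a = m'.arr b) :
    (m.flat a : Fin d × Fin d → ℝ) = m'.flat b := by
  funext p
  simp only [Memory.flat, h]

theorem big_congr {m m' : Memory} {a b : ℕ} (h : m.arr a = m'.arr b) :
    (m.big a : Matrix (Fin d × Fin d) (Fin d × Fin d) ℝ) = m'.big b := by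
  unfold Memory.big; rw [h]

/-- The final memory after a scalar product has been written to an array of length one. -/
theorem scalar_run_dotProduct {a b c : ℕ} {m : Memory} (hm : m.nat 0 = d) (hb : a ≠ b)
    (hc : a ≠ c) :
    (run o (fill a (.const 1) (.const 1) (.var 0) (.const 0) .zero
      (.mul (.read b (.var 12)) (.read c (.var 12)))) m).arr a 0 =
      (m.vec b : Fin d → ℝ) ⬝ᵥ m.vec c := by
  rw [scalar_run_fill o rfl rfl (by simp [RealExpr.avoids, hb, hc])]
  simp [fillValue, Memory.indexed, NatExpr.eval, RealExpr.eval, RealExpr.zero, hm,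
    Finset.sum_range, dotProduct, Memory.vec]

theorem run_extremeProgram (ho : IsLinearOptimizationOracle P o) {m : Memory} (hm : m.nat 0 = d)
    {i : Fin d} (hi : m.nat 5 = i) :
    ((run o extremeProgram m).vec 8 : Fin d → ℝ) = (m.mat 3 : Matrix (Fin d) (Fin d) ℝ) i ∧
    ((run o extremeProgram m).vec 9 : Fin d → ℝ) ∈ points P ∧
    (∀ p ∈ points P, |(m.mat 3 : Matrix (Fin d) (Fin d) ℝ) i ⬝ᵥ p| ≤
      |(m.mat 3 : Matrix (Fin d) (Fin d) ℝ) i ⬝ᵥ (run o extremeProgram m).vec 9|) ∧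
    (run o extremeProgram m).arr 14 0 =
      (m.mat 3 : Matrix (Fin d) (Fin d) ℝ) i ⬝ᵥ (run o extremeProgram m).vec 9 := by
  set r : Fin d → ℝ := (m.mat 3 : Matrix (Fin d) (Fin d) ℝ) i with hr
  simp only [extremeProgram, run_seq, run_oracle]
  -- the query in the direction of the functional
  generalize h1 : run o (fill 8 _ _ _ _ _ _) m = m1
  have n1 : m1.nat 0 = d := by rw [← h1, run_nat_of_not_writes o 0 _ rfl, hm]
  have v1 : (m1.vec 8 : Fin d → ℝ) = r := by
    rw [← h1, vec_run_fill o hm rfl rfl rfl]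
    ext j
    simp [fillValue, Memory.indexed, NatExpr.eval, RealExpr.eval, RealExpr.zero, hm, hi, hr,
      Memory.mat]
  rw [load_eq, v1]
  set y1 := o (WithLp.toLp 2 r) with hy1
  obtain ⟨y1P, y1min⟩ := ho.dotProduct_le r
  generalize h2 : m1.store 9 y1 = m2
  have n2 : m2.nat 0 = d := by rw [← h2]; exact n1
  have v2 : (m2.vec 8 : Fin d → ℝ) = r := by
    rw [← v1, ← h2]; exact vec_congr (arr_store_ne m1 (by decide) _)
  have w2 : (m2.vec 9 : Fin d → ℝ) = y1.ofLp := by rw [← h2, vec_store_self]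
  -- the query in the opposite direction
  generalize h3 : run o (fill 16 _ _ _ _ _ _) m2 = m3
  have n3 : m3.nat 0 = d := by rw [← h3, run_nat_of_not_writes o 0 _ rfl, n2]
  have v3 : (m3.vec 8 : Fin d → ℝ) = r := by
    rw [← v2, ← h3]; exact vec_congr (run_arr_of_not_writes o 8 _ rfl _)
  have w3 : (m3.vec 9 : Fin d → ℝ) = y1.ofLp := by
    rw [← w2, ← h3]; exact vec_congr (run_arr_of_not_writes o 9 _ rfl _)
  have q3 : (m3.vec 16 : Fin d → ℝ) = -r := by
    rw [← h3, vec_run_fill o n2 rfl rfl rfl, ← v2]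
    ext j
    simp [fillValue, Memory.indexed, NatExpr.eval, RealExpr.eval, RealExpr.zero, Memory.vec]
  rw [load_eq, q3]
  set y2 := o (WithLp.toLp 2 (-r)) with hy2
  obtain ⟨y2P, y2min⟩ := ho.dotProduct_le (-r)
  generalize h4 : m3.store 10 y2 = m4
  have n4 : m4.nat 0 = d := by rw [← h4]; exact n3
  have v4 : (m4.vec 8 : Fin d → ℝ) = r := by
    rw [← v3, ← h4]; exact vec_congr (arr_store_ne m3 (by decide) _)
  have w4 : (m4.vec 9 : Fin d → ℝ) = y1.ofLp := by
    rw [← w3, ← h4]; exact vec_congr (arr_store_ne m3 (by decide) _)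
  have z4 : (m4.vec 10 : Fin d → ℝ) = y2.ofLp := by rw [← h4, vec_store_self]
  -- the two extreme values
  generalize h5 : run o (fill 14 _ _ _ _ _ _) m4 = m5
  have n5 : m5.nat 0 = d := by rw [← h5, run_nat_of_not_writes o 0 _ rfl, n4]
  have s5 : m5.arr 14 0 = r ⬝ᵥ y1.ofLp := by
    rw [← h5, scalar_run_dotProduct n4 (by decide) (by decide), v4, w4]
  have f5 : ∀ b, b ≠ 14 → m5.arr b = m4.arr b := fun b hb => by
    rw [← h5]; exact run_arr_of_not_writes o b _ (by rw [fill_writesArr]; simpa using hb) _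
  generalize h6 : run o (fill 15 _ _ _ _ _ _) m5 = m6
  have n6 : m6.nat 0 = d := by rw [← h6, run_nat_of_not_writes o 0 _ rfl, n5]
  have f6 : ∀ b, b ≠ 15 → m6.arr b = m5.arr b := fun b hb => by
    rw [← h6]; exact run_arr_of_not_writes o b _ (by rw [fill_writesArr]; simpa using hb) _
  have s6 : m6.arr 15 0 = r ⬝ᵥ y2.ofLp := by
    rw [← h6, scalar_run_dotProduct n5 (by decide) (by decide), vec_congr (f5 8 (by decide)),
      vec_congr (f5 10 (by decide)), v4, z4]
  have t6 : m6.arr 14 0 = r ⬝ᵥ y1.ofLp := by rw [f6 14 (by decide), s5]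
  have v6 : (m6.vec 8 : Fin d → ℝ) = r := by
    rw [vec_congr (f6 8 (by decide)), vec_congr (f5 8 (by decide)), v4]
  have w6 : (m6.vec 9 : Fin d → ℝ) = y1.ofLp := by
    rw [vec_congr (f6 9 (by decide)), vec_congr (f5 9 (by decide)), w4]
  have z6 : (m6.vec 10 : Fin d → ℝ) = y2.ofLp := by
    rw [vec_congr (f6 10 (by decide)), vec_congr (f5 10 (by decide)), z4]
  -- the better one of the two points
  generalize h7 : run o (.ifReal _ _ _ _) m6 = m7
  have n7 : m7.nat 0 = d := by rw [← h7, run_nat_of_not_writes o 0 _ rfl, n6]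
  have v7 : (m7.vec 8 : Fin d → ℝ) = r := by
    rw [← v6, ← h7]; exact vec_congr (run_arr_of_not_writes o 8 _ rfl _)
  have key : (m7.vec 9 : Fin d → ℝ) ∈ points P ∧
      |r ⬝ᵥ y1.ofLp| ≤ |r ⬝ᵥ m7.vec 9| ∧ |r ⬝ᵥ y2.ofLp| ≤ |r ⬝ᵥ m7.vec 9| := by
    rw [← h7, run_ifReal]
    simp only [RealExpr.eval, NatExpr.eval, t6, s6, run_skip]
    split_ifs with hle
    · have e : ((run o (fill 9 (.const 1) (.var 0) (.const 0) (.const 0) (.read 10 (.var 11)) .zero)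
          m6).vec 9 : Fin d → ℝ) = y2.ofLp := by
        rw [vec_run_fill o n6 rfl rfl rfl, ← z6]
        ext j
        simp [fillValue, Memory.indexed, NatExpr.eval, RealExpr.eval, Memory.vec]
      rw [e]
      exact ⟨y2P, abs_le_iff_mul_self_le.mpr hle, le_rfl⟩
    · rw [w6]
      exact ⟨y1P, le_rfl, abs_le_iff_mul_self_le.mpr (le_of_not_ge hle)⟩
  generalize h8 : run o (fill 14 _ _ _ _ _ _) m7 = m8
  have f8 : ∀ b, b ≠ 14 → m8.arr b = m7.arr b := fun b hb => by
    rw [← h8]; exact run_arr_of_not_writes o b _ (by rw [fill_writesArr]; simpa using hb) _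
  have s8 : m8.arr 14 0 = r ⬝ᵥ m7.vec 9 := by
    rw [← h8, scalar_run_dotProduct n7 (by decide) (by decide), v7]
  rw [vec_congr (f8 9 (by decide)), vec_congr (f8 8 (by decide))]
  refine ⟨v7, key.1, fun p hp => ?_, s8⟩
  rw [abs_le]
  have hlow := y1min p hp
  have hup := y2min p hp
  rw [neg_dotProduct, neg_dotProduct, neg_le_neg_iff] at hup
  constructor
  · have := neg_abs_le (r ⬝ᵥ y1.ofLp)
    linarith [key.2.1]
  · have := le_abs_self (r ⬝ᵥ y2.ofLp)
    linarith [key.2.2]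

theorem run_pivotProgram {m : Memory} (hm : m.nat 0 = d) {i : Fin d} (hi : m.nat 5 = i)
    (h8 : (m.vec 8 : Fin d → ℝ) = (m.mat 3 : Matrix (Fin d) (Fin d) ℝ) i)
    (h14 : m.arr 14 0 = (m.mat 3 : Matrix (Fin d) (Fin d) ℝ) i ⬝ᵥ m.vec 9) :
    (run o pivotProgram m).mat 2 = (m.mat 2).updateRow i (m.vec 9 : Fin d → ℝ) ∧
    (run o pivotProgram m).mat 3 = pivotDual (m.mat 3) i (m.vec 9) := by
  simp only [pivotProgram, run_seq]
  generalize h1 : run o (fill 11 _ _ _ _ _ _) m = m1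
  have n1 : m1.nat 0 = d := by rw [← h1, run_nat_of_not_writes o 0 _ rfl, hm]
  have i1 : m1.nat 5 = i := by rw [← h1, run_nat_of_not_writes o 5 _ rfl, hi]
  have f1 : ∀ b, b ≠ 11 → m1.arr b = m.arr b := fun b hb => by
    rw [← h1]; exact run_arr_of_not_writes o b _ (by rw [fill_writesArr]; simpa using hb) _
  have v1 : (m1.vec 11 : Fin d → ℝ) =
      fun x => (m.mat 3 : Matrix (Fin d) (Fin d) ℝ) x ⬝ᵥ m.vec 9 := by
    rw [← h1, vec_run_fill o hm rfl rfl rfl]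
    ext j
    simp [fillValue, Memory.indexed, NatExpr.eval, RealExpr.eval, RealExpr.zero, hm,
      Finset.sum_range, dotProduct, Memory.vec, Memory.mat]
  generalize h2 : run o (fill 3 _ _ _ _ _ _) m1 = m2
  have n2 : m2.nat 0 = d := by rw [← h2, run_nat_of_not_writes o 0 _ rfl, n1]
  have i2 : m2.nat 5 = i := by rw [← h2, run_nat_of_not_writes o 5 _ rfl, i1]
  have f2 : ∀ b, b ≠ 3 → m2.arr b = m1.arr b := fun b hb => by
    rw [← h2]; exact run_arr_of_not_writes o b _ (by rw [fill_writesArr]; simpa using hb) _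
  have v2 : (m2.mat 3 : Matrix (Fin d) (Fin d) ℝ) = pivotDual (m.mat 3) i (m.vec 9) := by
    rw [← h2, mat_run_fill o n1 rfl rfl rfl]
    ext x j
    have e1 := congrFun v1 x
    have e2 : m1.arr 8 j = m.arr 3 (i * d + j) := by
      rw [f1 8 (by decide)]; exact congrFun h8 j
    rw [Memory.vec] at e1
    simp only [pivotDual, fillValue, of_apply, Pi.sub_apply, Pi.smul_apply, RealExpr.eval,
      NatExpr.eval, NatExpr.eval_delta, RealExpr.zero, Memory.indexed, n1, i1, if_true,
      Nat.reduceEqDiff, if_false, smul_eq_mul, f1 3 (by decide), f1 14 (by decide), h14, e1, e2]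
    simp [Memory.mat, Fin.ext_iff]
    ring
  have g2 : (run o (fill 2 (.var 0) (.var 0) (.const 0) (.sub (.const 1) (.delta (.var 10) (.var 5)))
      (.mul (.ofNat (.delta (.var 10) (.var 5))) (.read 9 (.var 11))) .zero) m2).arr 3 =
      m2.arr 3 := run_arr_of_not_writes o 3 _ rfl _
  refine ⟨?_, (mat_congr g2).trans v2⟩
  rw [mat_run_fill o n2 rfl rfl rfl]
  ext x j
  simp only [fillValue, of_apply, RealExpr.eval,
      NatExpr.eval, NatExpr.eval_delta, RealExpr.zero, Memory.indexed, n2, i2, if_true,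
      Nat.reduceEqDiff, if_false, f2 2 (by decide), f1 2 (by decide), f2 9 (by decide),
      f1 9 (by decide), updateRow_apply, Fin.ext_iff]
  by_cases hx : (x : ℕ) = i <;> simp [hx, Memory.mat, Memory.vec]

theorem run_spannerStepProgram (ho : IsLinearOptimizationOracle P o) {m : Memory}
    (hm : m.nat 0 = d) {i : Fin d} (hi : m.nat 5 = i) :
    SpannerStep (points P) (thresholdExpr.eval m : ℕ) i (m.mat 2) (m.mat 3)
      ((run o spannerStepProgram m).mat 2) ((run o spannerStepProgram m).mat 3) := by
  obtain ⟨h8, h9, hmax, h14⟩ := run_extremeProgram ho hm hi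
  rw [spannerStepProgram, run_seq]
  set m1 := run o extremeProgram m with hm1
  have n1 : m1.nat 0 = d := by rw [hm1, run_nat_of_not_writes o 0 _ rfl, hm]
  have i1 : m1.nat 5 = i := by rw [hm1, run_nat_of_not_writes o 5 _ rfl, hi]
  have p1 : m1.nat 4 = m.nat 4 := by rw [hm1, run_nat_of_not_writes o 4 _ rfl]
  have e2 : (m1.mat 2 : Matrix (Fin d) (Fin d) ℝ) = m.mat 2 :=
    mat_congr (run_arr_of_not_writes o 2 _ rfl _)
  have e3 : (m1.mat 3 : Matrix (Fin d) (Fin d) ℝ) = m.mat 3 :=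
    mat_congr (run_arr_of_not_writes o 3 _ rfl _)
  have et : thresholdExpr.eval m1 = thresholdExpr.eval m := by
    simp only [thresholdExpr, NatExpr.eval, p1]
  refine ⟨m1.vec 9, h9, hmax, ?_⟩
  rw [run_ifReal]
  simp only [RealExpr.eval, NatExpr.eval, h14, et, ← sq]
  split_ifs with hle
  · exact Or.inl ⟨hle, e2, e3⟩
  · right
    obtain ⟨r2, r3⟩ := run_pivotProgram (o := o) n1 i1 (by rw [e3]; exact h8)
      (by rw [e3]; exact h14)
    rw [e2] at r2
    rw [e3] at r3
    exact ⟨not_le.mp hle, r2, r3⟩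

theorem mat_run_identity {a : ℕ} {m : Memory} (hm : m.nat 0 = d) :
    (run o (fill a (.var 0) (.var 0) (.const 0) (.const 0) (.ofNat (.delta (.var 10) (.var 11)))
      .zero) m).mat a = (1 : Matrix (Fin d) (Fin d) ℝ) := by
  rw [mat_run_fill o hm rfl rfl rfl]
  ext i j
  simp [fillValue, Memory.indexed, NatExpr.eval, RealExpr.eval, NatExpr.eval_delta,
    Matrix.one_apply, Fin.ext_iff]

/-- The preprocessing finds a `2`-approximate barycentric spanner. -/
theorem run_spannerProgram (ho : IsLinearOptimizationOracle P o)
    (hP : ∀ r : Fin d → ℝ, r ≠ 0 → ∃ p ∈ points P, r ⬝ᵥ p ≠ 0) {m : Memory} (hm : m.nat 0 = d) :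
    (run o spannerProgram m).nat 0 = d ∧
    (run o spannerProgram m).mat 3 *
      ((run o spannerProgram m).mat 2 : Matrix (Fin d) (Fin d) ℝ)ᵀ = 1 ∧
    (∀ j, ((run o spannerProgram m).mat 2 : Matrix (Fin d) (Fin d) ℝ) j ∈ points P) ∧
    ∀ j, ∀ p ∈ points P,
      |((run o spannerProgram m).mat 3 : Matrix (Fin d) (Fin d) ℝ) j ⬝ᵥ p| ≤ 2 := by
  simp only [spannerProgram, run_seq]
  generalize h1 : run o (fill 2 _ _ _ _ _ _) m = m1
  have n1 : m1.nat 0 = d := by rw [← h1, run_nat_of_not_writes o 0 _ rfl, hm]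
  have b1 : (m1.mat 2 : Matrix (Fin d) (Fin d) ℝ) = 1 := by rw [← h1, mat_run_identity hm]
  generalize h2 : run o (fill 3 _ _ _ _ _ _) m1 = m2
  have n2 : m2.nat 0 = d := by rw [← h2, run_nat_of_not_writes o 0 _ rfl, n1]
  have b2 : (m2.mat 2 : Matrix (Fin d) (Fin d) ℝ) = 1 := by
    rw [← b1, ← h2]; exact mat_congr (run_arr_of_not_writes o 2 _ rfl _)
  have r2 : (m2.mat 3 : Matrix (Fin d) (Fin d) ℝ) = 1 := by rw [← h2, mat_run_identity n1]
  -- `good n i m'` holds after `n` full passes and `i` steps of the next pass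
  set good : ℕ → ℕ → Memory → Prop := fun n i m' => m'.nat 0 = d ∧
    (n = 0 → IsFirstPass (points P) i (m'.mat 2) (m'.mat 3)) ∧
    ∀ k, n = k + 1 → ∃ δ : ℝ, 0 < δ ∧
      (∀ B' : Matrix (Fin d) (Fin d) ℝ, (∀ j, B' j ∈ points P) →
        |B'.det| ≤ d.factorial * δ) ∧
      IsLaterPass (points P) δ k i (m'.mat 2) (m'.mat 3) with hgood
  have main := run_loop_induction o 4 (.add (.mul (.var 0) (.var 0)) (.const 2))
    (.loop 5 (.var 0) spannerStepProgram) m2 (fun n m' => good n 0 m') ?_ ?_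
  · simp only [NatExpr.eval, n2] at main
    obtain ⟨g0, _, g2⟩ := main
    obtain ⟨δ, hδ, hdet, hl⟩ := g2 (d * d + 1) rfl
    exact ⟨g0, hl.1, hl.2.1, hl.abs_le_two hδ hdet⟩
  · refine ⟨n2, fun _ => ?_, fun k hk => by omega⟩
    rw [b2, r2]
    exact IsFirstPass.zero
  · intro n _ m3 hm3
    have inner := run_loop_induction o 5 (.var 0) spannerStepProgram (m3.setNat 4 n)
      (fun i m' => m'.nat 4 = n ∧ good n i m') ⟨by simp [Memory.setNat], hm3⟩ ?_
    · have e0 : NatExpr.eval (m3.setNat 4 n) (.var 0) = d := hm3.1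
      rw [e0] at inner
      obtain ⟨_, g0, g1, g2⟩ := inner
      refine ⟨g0, fun h => by omega, fun k hk => ?_⟩
      obtain rfl : n = k := by omega
      rcases Nat.eq_zero_or_pos n with rfl | hpos
      · have hf := g1 rfl
        exact ⟨_, abs_pos.mpr (det_ne_zero_of_mul_transpose hf.1), fun B' hB' => hf.det_le hB',
          hf.isLaterPass⟩
      · obtain ⟨k, rfl⟩ : ∃ k, n = k + 1 := ⟨n - 1, by omega⟩
        obtain ⟨δ, hδ, hdet, hl⟩ := g2 k rfl
        exact ⟨δ, hδ, hdet, hl.next⟩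
    · rintro i hi m4 ⟨p4, g0, g1, g2⟩
      have e0 : NatExpr.eval (m3.setNat 4 n) (.var 0) = d := hm3.1
      rw [e0] at hi
      have hs := run_spannerStepProgram ho (m := m4.setNat 5 i) (i := ⟨i, hi⟩)
        (by simpa [Memory.setNat] using g0) (by simp [Memory.setNat])
      have et : thresholdExpr.eval (m4.setNat 5 i) = 4 - (4 - 4 * n) := by
        simp [thresholdExpr, NatExpr.eval, Memory.setNat, p4]
      rw [et] at hs
      refine ⟨?_, ?_, fun hn => ?_, fun k hk => ?_⟩
      · rw [run_nat_of_not_writes o 4 _ rfl]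
        simpa [Memory.setNat] using p4
      · rw [run_nat_of_not_writes o 0 _ rfl]
        simpa [Memory.setNat] using g0
      · subst hn
        norm_num at hs
        exact (g1 rfl).succ (i := ⟨i, hi⟩) hP hs
      · obtain ⟨δ, hδ, hdet, hl⟩ := g2 k hk
        refine ⟨δ, hδ, hdet, hl.succ (i := ⟨i, hi⟩) ?_⟩
        have : 4 - (4 - 4 * n) = 4 := by omega
        rw [this] at hs
        exact_mod_cast hs

theorem run_initProgram (ho : IsLinearOptimizationOracle P o)
    (hP : ∀ r : Fin d → ℝ, r ≠ 0 → ∃ p ∈ points P, r ⬝ᵥ p ≠ 0) {m : Memory} (hm : m.nat 0 = d) :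
    (run o initProgram m).mat 3 *
      ((run o initProgram m).mat 2 : Matrix (Fin d) (Fin d) ℝ)ᵀ = 1 ∧
    (∀ j, ((run o initProgram m).mat 2 : Matrix (Fin d) (Fin d) ℝ) j ∈ points P) ∧
    (∀ j, ∀ p ∈ points P,
      |((run o initProgram m).mat 3 : Matrix (Fin d) (Fin d) ℝ) j ⬝ᵥ p| ≤ 2) ∧
    (run o initProgram m).flat 4 = idPairs d ∧
    (run o initProgram m).big 5 = (1 : Matrix (Fin d × Fin d) (Fin d × Fin d) ℝ) := by
  obtain ⟨h0, h1, h2, h3⟩ := run_spannerProgram ho hP hm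
  simp only [initProgram, run_seq]
  set m1 := run o spannerProgram m with hm1
  generalize e2 : run o (fill 4 _ _ _ _ _ _) m1 = m2
  have n2 : m2.nat 0 = d := by rw [← e2, run_nat_of_not_writes o 0 _ rfl, h0]
  have f2 : ∀ b, b ≠ 4 → m2.arr b = m1.arr b := fun b hb => by
    rw [← e2]; exact run_arr_of_not_writes o b _ (by rw [fill_writesArr]; simpa using hb) _
  have v2 : (m2.flat 4 : Fin d × Fin d → ℝ) = idPairs d := by
    ext ⟨i, j⟩
    have := congrFun (congrFun (mat_run_identity (d := d) (o := o) (a := 4) h0) i) j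
    rw [e2] at this
    simpa [Memory.mat, Memory.flat, idPairs, Matrix.one_apply] using this
  generalize e3 : run o (fill 5 _ _ _ _ _ _) m2 = m3
  have f3 : ∀ b, b ≠ 5 → m3.arr b = m2.arr b := fun b hb => by
    rw [← e3]; exact run_arr_of_not_writes o b _ (by rw [fill_writesArr]; simpa using hb) _
  rw [mat_congr ((f3 2 (by decide)).trans (f2 2 (by decide))),
    mat_congr ((f3 3 (by decide)).trans (f2 3 (by decide))), flat_congr (f3 4 (by decide))]
  refine ⟨h1, h2, h3, v2, ?_⟩
  rw [← e3, big_run_fill o n2 rfl rfl rfl]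
  ext p q
  have : (p.1 * d + p.2 = (q.1 * d + q.2 : ℕ)) ↔ p = q := by
    constructor
    · intro h
      have := mul_add_inj p.2.2 q.2.2 h
      exact Prod.ext (Fin.ext this.1) (Fin.ext this.2)
    · rintro rfl; rfl
  simp [fillValue, Memory.indexed, NatExpr.eval, RealExpr.eval, NatExpr.eval_delta,
    Matrix.one_apply, this]

end

/-! ### The program of a round -/

/-- Query the oracle for the coordinates of a strategy that minimizes the linear functional whose
coefficients are in the array `a`; the answer is stored in the array `b`. -/
def coordQuery (a b : ℕ) : Program :=
  .seq (fill 8 (.const 1) (.var 0) (.var 0) (.const 0) .zero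
    (.mul (.read 3 (.add (.mul (.var 12) (.var 0)) (.var 11))) (.read a (.var 12)))) <|
  .seq (.oracle 8 9) <|
  fill b (.const 1) (.var 0) (.var 0) (.const 0) .zero
    (.mul (.read 3 (.add (.mul (.var 11) (.var 0)) (.var 12))) (.read 9 (.var 12)))

/-- Multiply the vector in array `12` with the inverse preconditioner, into array `13`. -/
def precondProgram : Program :=
  fill 13 (.const 1) (.mul (.var 0) (.var 0)) (.mul (.var 0) (.var 0)) (.const 0) .zero
    (.mul (.read 5 (.add (.mul (.var 11) (.mul (.var 0) (.var 0))) (.var 12)))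
      (.read 12 (.var 12)))

/-- The scalar product of two vectors of length `d²`. -/
def scalarProgram (a b c : ℕ) : Program :=
  fill a (.const 1) (.const 1) (.mul (.var 0) (.var 0)) (.const 0) .zero
    (.mul (.read b (.var 12)) (.read c (.var 12)))

/-- The rank-one update of the inverse preconditioner. -/
def updateProgram : Program :=
  .seq (fill 5 (.mul (.var 0) (.var 0)) (.mul (.var 0) (.var 0)) (.const 0) (.const 1)
    (.sub .zero (.div (.mul (.read 13 (.var 10)) (.read 13 (.var 11)))
      (.add (.ofNat (.const 1)) (.read 14 (.const 0))))) .zero)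
    precondProgram

/-- Process the loss in array `1` and the last strategy, whose coordinates are in array `19`. -/
def gradientProgram : Program :=
  .seq (fill 11 (.const 1) (.var 0) (.var 0) (.const 0) .zero
    (.mul (.read 2 (.add (.mul (.var 11) (.var 0)) (.var 12))) (.read 1 (.var 12)))) <|
  .seq (fill 12 (.var 0) (.var 0) (.const 0) (.const 0)
    (.mul (.read 11 (.var 10)) (.read 19 (.var 11))) .zero) <|
  .seq precondProgram <|
  .seq (scalarProgram 14 12 13) <|
  .seq (.ifReal (.read 14 (.const 0)) (.ofNat (.var 0)) .skip updateProgram) <|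
  fill 4 (.const 1) (.mul (.var 0) (.var 0)) (.const 0) (.const 1)
    (.sub .zero (.mul (.sqrt (.div (.ofNat (.var 0)) (.ofNat (.var 1)))) (.read 13 (.var 11)))) .zero

/-- Forget the points that have been collected. -/
def resetProgram : Program :=
  .seq (fill 6 (.const 1) (.var 0) (.const 0) (.const 0) .zero .zero) <|
  .seq (fill 7 (.const 1) (.var 0) (.const 0) (.const 0) .zero .zero) <|
  .setNat 3 (.const 0)

/-- The value of `radiusSq`. -/
def radiusSqExpr : NatExpr :=
  .add (.add (.mul (.const 9) (.var 1)) (.mul (.var 0) (.var 0))) (.mul (.const 2) (.var 0))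

/-- The value of `incrementSq`. -/
def incrementSqExpr : NatExpr :=
  .add (.mul (.mul (.const 4) (.var 0)) radiusSqExpr) (.const 2)

/-- The value of `sampleSize`. -/
def sampleSizeExpr : NatExpr := .mul (.mul (.var 0) (.var 1)) incrementSqExpr

/-- The value of `searchLength`. -/
def searchLengthExpr : NatExpr :=
  .add sampleSizeExpr (.mul (.mul sampleSizeExpr radiusSqExpr)
    (.mul (.mul (.mul (.const 4) (.var 0)) sampleSizeExpr) incrementSqExpr))

/-- Add the point in array `10`, with the displacement in array `17`, to the collection. -/
def collectProgram : Program :=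
  .seq (fill 6 (.const 1) (.var 0) (.const 0) (.const 1) (.read 17 (.var 11)) .zero) <|
  .seq (fill 7 (.const 1) (.var 0) (.const 0) (.const 1) (.read 10 (.var 11)) .zero) <|
  .setNat 3 (.add (.var 3) (.const 1))

/-- Project the matrix in array `4` onto a half-space that contains all endomorphisms. -/
def projectProgram : Program :=
  .seq (coordQuery 6 10) <|
  .seq (fill 12 (.var 0) (.var 0) (.const 0) (.const 0)
    (.mul (.read 6 (.var 10)) (.read 10 (.var 11))) .zero) <|
  .seq precondProgram <|
  .seq (scalarProgram 15 12 13) <|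
  .seq (scalarProgram 14 12 4) <|
  .seq (fill 18 (.const 1) (.const 1) (.var 0) (.const 0) .zero
    (.mul (.read 6 (.var 12)) (.read 10 (.var 12)))) <|
  .seq (fill 4 (.const 1) (.mul (.var 0) (.var 0)) (.const 0) (.const 1)
    (.mul (.div (.sub (.read 18 (.const 0)) (.read 14 (.const 0))) (.read 15 (.const 0)))
      (.read 13 (.var 11))) .zero)
    resetProgram

/-- Find the point with the least displacement in the direction of array `6`; its coordinates are
stored in array `10`, its displacement in array `17`, and the scalar product in array `14`. -/
def probeProgram : Program :=
  .seq (fill 16 (.const 1) (.var 0) (.var 0) (.const 0) (.read 6 (.var 11))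
    (.sub .zero (.mul (.read 4 (.add (.mul (.var 12) (.var 0)) (.var 11))) (.read 6 (.var 12))))) <|
  .seq (coordQuery 16 10) <|
  .seq (fill 17 (.const 1) (.var 0) (.var 0) (.const 0) (.read 10 (.var 11))
    (.sub .zero (.mul (.read 4 (.add (.mul (.var 11) (.var 0)) (.var 12))) (.read 10 (.var 12))))) <|
  fill 14 (.const 1) (.const 1) (.var 0) (.const 0) .zero
    (.mul (.read 6 (.var 12)) (.read 17 (.var 12)))

/-- One step of the search for an approximate fixed point. -/
def searchStepProgram : Program :=
  .ifNat sampleSizeExpr (.var 3) .skip <|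
  .seq probeProgram <|
  .ifReal (.read 14 (.const 0)) (.ofNat (.const 1)) collectProgram projectProgram

/-- A round when the origin is not a strategy. -/
def roundProgram : Program :=
  .seq gradientProgram <|
  .seq resetProgram <|
  .seq (.loop 6 searchLengthExpr searchStepProgram) <|
  .seq (fill 19 (.const 1) (.var 0) (.const 0) (.const 0)
    (.div (.read 7 (.var 11)) (.ofNat sampleSizeExpr)) .zero) <|
  fill 0 (.const 1) (.var 0) (.var 0) (.const 0) .zero
    (.mul (.read 2 (.add (.mul (.var 12) (.var 0)) (.var 11))) (.read 19 (.var 12)))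

theorem eval_sampleSizeExpr (m : Memory) :
    sampleSizeExpr.eval m = sampleSize (m.nat 0) (m.nat 1) := rfl

theorem eval_searchLengthExpr (m : Memory) :
    searchLengthExpr.eval m = searchLength (m.nat 0) (m.nat 1) := rfl

section

variable {d : ℕ} {P : Set (EuclideanSpace ℝ (Fin d))}
  {o : EuclideanSpace ℝ (Fin d) → EuclideanSpace ℝ (Fin d)}

/-- The coordinates of the points of `P` with respect to the basis whose dual basis is `R`. -/
def coordinates (P : Set (EuclideanSpace ℝ (Fin d))) (R : Matrix (Fin d) (Fin d) ℝ) :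
    Set (Fin d → ℝ) :=
  (fun p => R *ᵥ p) '' points P

theorem run_arr_ne {p : Program} {m m' : Memory} (h : run o p m = m') {b : ℕ}
    (hb : p.writesArr b = false) : m'.arr b = m.arr b := by
  rw [← h]; exact run_arr_of_not_writes o b _ hb _

theorem run_nat_ne {p : Program} {m m' : Memory} (h : run o p m = m') {x : ℕ}
    (hx : p.writesNat x = false) : m'.nat x = m.nat x := by
  rw [← h]; exact run_nat_of_not_writes o x _ hx _

theorem run_coordQuery (ho : IsLinearOptimizationOracle P o) {m : Memory} (hm : m.nat 0 = d)
    {a b : ℕ} (ha : a ≠ 8) (hb : b ≠ 9) (hb' : b ≠ 3) :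
    ((run o (coordQuery a b) m).vec b : Fin d → ℝ) ∈ coordinates P (m.mat 3) ∧
    ∀ u ∈ coordinates P (m.mat 3),
      m.vec a ⬝ᵥ ((run o (coordQuery a b) m).vec b : Fin d → ℝ) ≤ m.vec a ⬝ᵥ u := by
  simp only [coordQuery, run_seq, run_oracle]
  set R : Matrix (Fin d) (Fin d) ℝ := m.mat 3 with hR
  set c : Fin d → ℝ := m.vec a with hc
  generalize h1 : run o (fill 8 _ _ _ _ _ _) m = m1
  have n1 : m1.nat 0 = d := by rw [run_nat_ne h1 rfl, hm]
  have v1 : (m1.vec 8 : Fin d → ℝ) = c ᵥ* R := by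
    rw [← h1, vec_run_fill o hm rfl rfl (by simp [RealExpr.avoids, ha.symm])]
    ext j
    simp [fillValue, Memory.indexed, NatExpr.eval, RealExpr.eval, RealExpr.zero, hm,
      Finset.sum_range, vecMul, dotProduct, hc, hR, Memory.vec, Memory.mat, mul_comm]
  have r1 : (m1.mat 3 : Matrix (Fin d) (Fin d) ℝ) = R := mat_congr (run_arr_ne h1 rfl)
  rw [load_eq, v1]
  obtain ⟨yP, ymin⟩ := ho.dotProduct_le (c ᵥ* R)
  set y := o (WithLp.toLp 2 (c ᵥ* R)) with hy
  generalize h2 : m1.store 9 y = m2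
  have n2 : m2.nat 0 = d := by rw [← h2]; exact n1
  have w2 : (m2.vec 9 : Fin d → ℝ) = y.ofLp := by rw [← h2, vec_store_self]
  have r2 : (m2.mat 3 : Matrix (Fin d) (Fin d) ℝ) = R := by
    rw [← r1, ← h2]; exact mat_congr (arr_store_ne m1 (by decide) _)
  have v3 : ((run o (fill b (.const 1) (.var 0) (.var 0) (.const 0) .zero
      (.mul (.read 3 (.add (.mul (.var 11) (.var 0)) (.var 12))) (.read 9 (.var 12)))) m2).vec b :
        Fin d → ℝ) = R *ᵥ y.ofLp := by
    rw [vec_run_fill o n2 rfl rfl (by simp [RealExpr.avoids, hb, hb']), ← w2, ← r2]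
    ext j
    simp [fillValue, Memory.indexed, NatExpr.eval, RealExpr.eval, RealExpr.zero, n2,
      Finset.sum_range, mulVec, dotProduct, Memory.vec, Memory.mat]
  rw [v3]
  refine ⟨⟨_, yP, rfl⟩, ?_⟩
  rintro _ ⟨p, hp, rfl⟩
  have := ymin p hp
  simpa only [dotProduct_mulVec] using this

theorem run_precondProgram {m : Memory} (hm : m.nat 0 = d) :
    ((run o precondProgram m).flat 13 : Fin d × Fin d → ℝ) = m.big 5 *ᵥ m.flat 12 := by
  rw [precondProgram, flat_run_fill_row o hm rfl rfl rfl]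
  ext p
  simp [fillValue, Memory.indexed, NatExpr.eval, RealExpr.eval, RealExpr.zero, hm,
    sum_range_mul_self, mulVec, dotProduct, Memory.flat, Memory.big]

theorem run_scalarProgram {a b c : ℕ} {m : Memory} (hm : m.nat 0 = d) (hb : a ≠ b) (hc : a ≠ c) :
    (run o (scalarProgram a b c) m).arr a 0 = (m.flat b : Fin d × Fin d → ℝ) ⬝ᵥ m.flat c := by
  rw [scalarProgram, scalar_run_fill o rfl rfl (by simp [RealExpr.avoids, hb, hc])]
  simp [fillValue, Memory.indexed, NatExpr.eval, RealExpr.eval, RealExpr.zero, hm,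
    sum_range_mul_self, dotProduct, Memory.flat]

theorem run_resetProgram {m : Memory} (hm : m.nat 0 = d) :
    ((run o resetProgram m).vec 6 : Fin d → ℝ) = 0 ∧
    ((run o resetProgram m).vec 7 : Fin d → ℝ) = 0 ∧ (run o resetProgram m).nat 3 = 0 := by
  simp only [resetProgram, run_seq, run_setNat]
  generalize h1 : run o (fill 6 _ _ _ _ _ _) m = m1
  have n1 : m1.nat 0 = d := by rw [run_nat_ne h1 rfl, hm]
  have v1 : (m1.vec 6 : Fin d → ℝ) = 0 := by
    rw [← h1, vec_run_fill o hm rfl rfl rfl]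
    ext j
    simp [fillValue, NatExpr.eval, RealExpr.eval, RealExpr.zero]
  generalize h2 : run o (fill 7 _ _ _ _ _ _) m1 = m2
  have v2 : (m2.vec 7 : Fin d → ℝ) = 0 := by
    rw [← h2, vec_run_fill o n1 rfl rfl rfl]
    ext j
    simp [fillValue, NatExpr.eval, RealExpr.eval, RealExpr.zero]
  have w2 : (m2.vec 6 : Fin d → ℝ) = 0 := (vec_congr (run_arr_ne h2 rfl)).trans v1
  exact ⟨w2, v2, by simp [Memory.setNat, NatExpr.eval]⟩

theorem run_gradientProgram {T : ℕ} {m : Memory} (hm : m.nat 0 = d) (hT : m.nat 1 = T)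
    {G : Fin d × Fin d → ℝ} (hG : G = outerPairs (m.mat 2 *ᵥ m.vec 1) (m.vec 19)) :
    (G ⬝ᵥ m.big 5 *ᵥ G ≤ d →
      (run o gradientProgram m).big (d := d) 5 = m.big 5 ∧
      (run o gradientProgram m).flat 4 = m.flat 4 - stepSize d T • m.big 5 *ᵥ G) ∧
    (¬ G ⬝ᵥ m.big 5 *ᵥ G ≤ d →
      (run o gradientProgram m).big 5 = m.big 5 - (1 + G ⬝ᵥ m.big 5 *ᵥ G)⁻¹ •
        vecMulVec (m.big 5 *ᵥ G) (m.big 5 *ᵥ G) ∧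
      (run o gradientProgram m).flat 4 =
        m.flat 4 - stepSize d T • (run o gradientProgram m).big 5 *ᵥ G) := by
  simp only [gradientProgram, run_seq]
  generalize h1 : run o (fill 11 _ _ _ _ _ _) m = m1
  have n1 : m1.nat 0 = d := by rw [run_nat_ne h1 rfl, hm]
  have v1 : (m1.vec 11 : Fin d → ℝ) = m.mat 2 *ᵥ m.vec 1 := by
    rw [← h1, vec_run_fill o hm rfl rfl rfl]
    ext j
    simp [fillValue, Memory.indexed, NatExpr.eval, RealExpr.eval, RealExpr.zero, hm,
      Finset.sum_range, mulVec, dotProduct, Memory.vec, Memory.mat]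
  generalize h2 : run o (fill 12 _ _ _ _ _ _) m1 = m2
  have n2 : m2.nat 0 = d := by rw [run_nat_ne h2 rfl, n1]
  have v2 : (m2.flat 12 : Fin d × Fin d → ℝ) = G := by
    rw [hG, ← v1, ← vec_congr (run_arr_ne h1 (b := 19) rfl), ← h2, flat_run_fill o n1 rfl rfl rfl]
    ext p
    simp [fillValue, Memory.indexed, NatExpr.eval, RealExpr.eval, RealExpr.zero, outerPairs,
      Memory.vec]
  have W2 : (m2.big 5 : Matrix (Fin d × Fin d) (Fin d × Fin d) ℝ) = m.big 5 :=
    big_congr ((run_arr_ne h2 rfl).trans (run_arr_ne h1 rfl))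
  have X2 : (m2.flat 4 : Fin d × Fin d → ℝ) = m.flat 4 :=
    flat_congr ((run_arr_ne h2 rfl).trans (run_arr_ne h1 rfl))
  have T2 : m2.nat 1 = T := by rw [run_nat_ne h2 rfl, run_nat_ne h1 rfl, hT]
  rw [← W2, ← X2, ← v2]
  clear h1 h2 v1 n1 hm hT hG v2 W2 X2
  generalize h3 : run o precondProgram m2 = m3
  have n3 : m3.nat 0 = d := by rw [run_nat_ne h3 rfl, n2]
  have v3 : (m3.flat 13 : Fin d × Fin d → ℝ) = m2.big 5 *ᵥ m2.flat 12 := by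
    rw [← h3, run_precondProgram n2]
  have G3 : (m3.flat 12 : Fin d × Fin d → ℝ) = m2.flat 12 := flat_congr (run_arr_ne h3 rfl)
  generalize h4 : run o (scalarProgram 14 12 13) m3 = m4
  have n4 : m4.nat 0 = d := by rw [run_nat_ne h4 rfl, n3]
  have s4 : m4.arr 14 0 = (m2.flat 12 : Fin d × Fin d → ℝ) ⬝ᵥ m2.big 5 *ᵥ m2.flat 12 := by
    rw [← h4, run_scalarProgram n3 (by decide) (by decide), v3, G3]
  have v4 : (m4.flat 13 : Fin d × Fin d → ℝ) = m2.big 5 *ᵥ m2.flat 12 :=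
    (flat_congr (run_arr_ne h4 rfl)).trans v3
  have G4 : (m4.flat 12 : Fin d × Fin d → ℝ) = m2.flat 12 :=
    (flat_congr (run_arr_ne h4 rfl)).trans G3
  have W4 : (m4.big 5 : Matrix (Fin d × Fin d) (Fin d × Fin d) ℝ) = m2.big 5 :=
    big_congr ((run_arr_ne h4 rfl).trans (run_arr_ne h3 rfl))
  have X4 : (m4.flat 4 : Fin d × Fin d → ℝ) = m2.flat 4 :=
    flat_congr ((run_arr_ne h4 rfl).trans (run_arr_ne h3 rfl))
  have T4 : m4.nat 1 = T := by rw [run_nat_ne h4 rfl, run_nat_ne h3 rfl, T2]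
  rw [← s4, ← v4, ← W4, ← X4, ← G4]
  rw [← W4, ← G4] at v4
  clear s4 W4 X4 G4 h3 h4 n2 n3 v3 G3 T2
  generalize h5 : run o (.ifReal _ _ _ _) m4 = m5
  have n5 : m5.nat 0 = d := by rw [run_nat_ne h5 rfl, n4]
  have T5 : m5.nat 1 = T := by rw [run_nat_ne h5 rfl, T4]
  have X5 : (m5.flat 4 : Fin d × Fin d → ℝ) = m4.flat 4 := flat_congr (run_arr_ne h5 rfl)
  generalize h6 : run o (fill 4 _ _ _ _ _ _) m5 = m6
  have W6 : (m6.big 5 : Matrix (Fin d × Fin d) (Fin d × Fin d) ℝ) = m5.big 5 :=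
    big_congr (run_arr_ne h6 rfl)
  have X6 : (m6.flat 4 : Fin d × Fin d → ℝ) = m4.flat 4 - stepSize d T • m5.flat 13 := by
    rw [← h6, flat_run_fill_row o n5 rfl rfl rfl, ← X5]
    ext p
    simp [fillValue, Memory.indexed, NatExpr.eval, RealExpr.eval, RealExpr.zero, n5, T5, stepSize,
      Memory.flat]
    ring
  rw [W6, X6]
  rw [run_ifReal] at h5
  simp only [RealExpr.eval, NatExpr.eval, n4, run_skip] at h5
  constructor
  · intro hle
    rw [if_pos hle] at h5
    subst h5
    exact ⟨rfl, by rw [v4]⟩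
  · intro hle
    rw [if_neg hle, updateProgram, run_seq] at h5
    generalize h7 : run o (fill 5 _ _ _ _ _ _) m4 = m7 at h5
    have n7 : m7.nat 0 = d := by rw [run_nat_ne h7 rfl, n4]
    have W7 : (m7.big 5 : Matrix (Fin d × Fin d) (Fin d × Fin d) ℝ) =
        m4.big 5 - (1 + m4.arr 14 0)⁻¹ • vecMulVec (m4.flat 13) (m4.flat 13) := by
      rw [← h7, big_run_fill o n4 rfl rfl rfl]
      ext p q
      simp [fillValue, Memory.indexed, NatExpr.eval, RealExpr.eval, RealExpr.zero, n4,
        Memory.flat, Memory.big, vecMulVec_apply]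
      ring
    have W5 : (m5.big 5 : Matrix (Fin d × Fin d) (Fin d × Fin d) ℝ) = m7.big 5 :=
      big_congr (run_arr_ne h5 rfl)
    have v5 : (m5.flat 13 : Fin d × Fin d → ℝ) = m7.big 5 *ᵥ m7.flat 12 := by
      rw [← h5, run_precondProgram n7]
    have G7 : (m7.flat 12 : Fin d × Fin d → ℝ) = m4.flat 12 := flat_congr (run_arr_ne h7 rfl)
    rw [v5, G7, W5]
    exact ⟨W7, rfl⟩

end

section

variable {d : ℕ} {P : Set (EuclideanSpace ℝ (Fin d))}
  {o : EuclideanSpace ℝ (Fin d) → EuclideanSpace ℝ (Fin d)}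

theorem dotProduct_sub_applyPairs (X : Fin d × Fin d → ℝ) (S u : Fin d → ℝ) :
    (fun y => S y + ∑ z, (0 - X (z, y) * S z)) ⬝ᵥ u = S ⬝ᵥ (u - applyPairs X u) := by
  have h : ∑ y, (∑ z, X (z, y) * S z) * u y = ∑ z, S z * ∑ y, X (z, y) * u y := by
    simp only [Finset.sum_mul, Finset.mul_sum]
    rw [Finset.sum_comm]
    exact Finset.sum_congr rfl fun z _ => Finset.sum_congr rfl fun y _ => by ring
  simp only [dotProduct, applyPairs, zero_sub, Finset.sum_neg_distrib, Pi.sub_apply, mul_sub,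
    add_mul, Finset.sum_sub_distrib, Finset.sum_add_distrib, neg_mul, h]
  ring

theorem run_probeProgram (ho : IsLinearOptimizationOracle P o) {m : Memory} (hm : m.nat 0 = d) :
    ((run o probeProgram m).vec 10 : Fin d → ℝ) ∈ coordinates P (m.mat 3) ∧
    ((run o probeProgram m).vec 17 : Fin d → ℝ) = (run o probeProgram m).vec 10 -
      applyPairs (m.flat 4) ((run o probeProgram m).vec 10) ∧
    (∀ u ∈ coordinates P (m.mat 3),
      (m.vec 6 : Fin d → ℝ) ⬝ᵥ (run o probeProgram m).vec 17 ≤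
        m.vec 6 ⬝ᵥ (u - applyPairs (m.flat 4) u)) ∧
    (run o probeProgram m).arr 14 0 =
      (m.vec 6 : Fin d → ℝ) ⬝ᵥ (run o probeProgram m).vec 17 := by
  simp only [probeProgram, run_seq]
  generalize h1 : run o (fill 16 _ _ _ _ _ _) m = m1
  have n1 : m1.nat 0 = d := by rw [run_nat_ne h1 rfl, hm]
  have v1 : (m1.vec 16 : Fin d → ℝ) =
      fun y => m.vec 6 y + ∑ z : Fin d, (0 - m.flat 4 (z, y) * m.vec 6 z) := by
    rw [← h1, vec_run_fill o hm rfl rfl rfl]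
    ext j
    simp [fillValue, Memory.indexed, NatExpr.eval, RealExpr.eval, RealExpr.zero, hm,
      Finset.sum_range, Memory.vec, Memory.flat]
  have R1 : (m1.mat 3 : Matrix (Fin d) (Fin d) ℝ) = m.mat 3 := mat_congr (run_arr_ne h1 rfl)
  obtain ⟨q1, q2⟩ := run_coordQuery ho n1 (a := 16) (b := 10) (by decide) (by decide) (by decide)
  generalize h2 : run o (coordQuery 16 10) m1 = m2 at q1 q2
  have n2 : m2.nat 0 = d := by rw [run_nat_ne h2 rfl, n1]
  have X2 : (m2.flat 4 : Fin d × Fin d → ℝ) = m.flat 4 :=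
    flat_congr ((run_arr_ne h2 rfl).trans (run_arr_ne h1 rfl))
  have S2 : (m2.vec 6 : Fin d → ℝ) = m.vec 6 :=
    vec_congr ((run_arr_ne h2 rfl).trans (run_arr_ne h1 rfl))
  rw [R1] at q1 q2
  generalize h3 : run o (fill 17 _ _ _ _ _ _) m2 = m3
  have n3 : m3.nat 0 = d := by rw [run_nat_ne h3 rfl, n2]
  have v3 : (m3.vec 17 : Fin d → ℝ) = m2.vec 10 - applyPairs (m.flat 4) (m2.vec 10) := by
    rw [← h3, vec_run_fill o n2 rfl rfl rfl, ← X2]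
    ext j
    simp [fillValue, Memory.indexed, NatExpr.eval, RealExpr.eval, RealExpr.zero, n2,
      Finset.sum_range, Memory.vec, Memory.flat, applyPairs]
    ring
  have w3 : (m3.vec 10 : Fin d → ℝ) = m2.vec 10 := vec_congr (run_arr_ne h3 rfl)
  have S3 : (m3.vec 6 : Fin d → ℝ) = m.vec 6 := (vec_congr (run_arr_ne h3 rfl)).trans S2
  generalize h4 : run o (fill 14 _ _ _ _ _ _) m3 = m4
  have w4 : (m4.vec 10 : Fin d → ℝ) = m2.vec 10 := (vec_congr (run_arr_ne h4 rfl)).trans w3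
  have v4 : (m4.vec 17 : Fin d → ℝ) = m3.vec 17 := vec_congr (run_arr_ne h4 rfl)
  have s4 : m4.arr 14 0 = (m.vec 6 : Fin d → ℝ) ⬝ᵥ m3.vec 17 := by
    rw [← h4, scalar_run_dotProduct n3 (by decide) (by decide), S3]
  rw [w4, v4, s4]
  refine ⟨q1, v3, fun u hu => ?_, rfl⟩
  have := q2 u hu
  rwa [v1, dotProduct_sub_applyPairs, dotProduct_sub_applyPairs, ← v3] at this

theorem run_collectProgram {m : Memory} (hm : m.nat 0 = d) :
    ((run o collectProgram m).vec 6 : Fin d → ℝ) = m.vec 6 + m.vec 17 ∧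
    ((run o collectProgram m).vec 7 : Fin d → ℝ) = m.vec 7 + m.vec 10 ∧
    (run o collectProgram m).nat 3 = m.nat 3 + 1 := by
  simp only [collectProgram, run_seq, run_setNat]
  generalize h1 : run o (fill 6 _ _ _ _ _ _) m = m1
  have n1 : m1.nat 0 = d := by rw [run_nat_ne h1 rfl, hm]
  have v1 : (m1.vec 6 : Fin d → ℝ) = m.vec 6 + m.vec 17 := by
    rw [← h1, vec_run_fill o hm rfl rfl rfl]
    ext j
    simp [fillValue, Memory.indexed, NatExpr.eval, RealExpr.eval, RealExpr.zero, Memory.vec]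
  generalize h2 : run o (fill 7 _ _ _ _ _ _) m1 = m2
  have v2 : (m2.vec 7 : Fin d → ℝ) = m.vec 7 + m.vec 10 := by
    rw [← vec_congr (run_arr_ne h1 (b := 7) rfl), ← vec_congr (run_arr_ne h1 (b := 10) rfl),
      ← h2, vec_run_fill o n1 rfl rfl rfl]
    ext j
    simp [fillValue, Memory.indexed, NatExpr.eval, RealExpr.eval, RealExpr.zero, Memory.vec]
  have w2 : (m2.vec 6 : Fin d → ℝ) = m.vec 6 + m.vec 17 :=
    (vec_congr (run_arr_ne h2 rfl)).trans v1
  refine ⟨w2, v2, ?_⟩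
  simp [Memory.setNat, NatExpr.eval, run_nat_ne h2 (x := 3) rfl, run_nat_ne h1 (x := 3) rfl]

theorem run_projectProgram (ho : IsLinearOptimizationOracle P o) {m : Memory} (hm : m.nat 0 = d) :
    ∃ w ∈ coordinates P (m.mat 3), (∀ u ∈ coordinates P (m.mat 3), m.vec 6 ⬝ᵥ w ≤ m.vec 6 ⬝ᵥ u) ∧
    (run o projectProgram m).flat 4 = m.flat 4 +
      ((m.vec 6 ⬝ᵥ w - outerPairs (m.vec 6) w ⬝ᵥ m.flat 4) /
        (outerPairs (m.vec 6) w ⬝ᵥ m.big 5 *ᵥ outerPairs (m.vec 6) w)) •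
        m.big 5 *ᵥ outerPairs (m.vec 6) w ∧
    ((run o projectProgram m).vec 6 : Fin d → ℝ) = 0 ∧
    ((run o projectProgram m).vec 7 : Fin d → ℝ) = 0 ∧ (run o projectProgram m).nat 3 = 0 := by
  simp only [projectProgram, run_seq]
  obtain ⟨q1, q2⟩ := run_coordQuery ho hm (a := 6) (b := 10) (by decide) (by decide) (by decide)
  generalize h1 : run o (coordQuery 6 10) m = m1 at q1 q2
  have n1 : m1.nat 0 = d := by rw [run_nat_ne h1 rfl, hm]
  refine ⟨m1.vec 10, q1, q2, ?_⟩
  rw [← vec_congr (run_arr_ne h1 (b := 6) rfl), ← flat_congr (run_arr_ne h1 (b := 4) rfl),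
    ← big_congr (run_arr_ne h1 (b := 5) rfl)]
  clear q1 q2 h1 hm
  generalize h2 : run o (fill 12 _ _ _ _ _ _) m1 = m2
  have n2 : m2.nat 0 = d := by rw [run_nat_ne h2 rfl, n1]
  have v2 : (m2.flat 12 : Fin d × Fin d → ℝ) = outerPairs (m1.vec 6) (m1.vec 10) := by
    rw [← h2, flat_run_fill o n1 rfl rfl rfl]
    ext p
    simp [fillValue, Memory.indexed, NatExpr.eval, RealExpr.eval, RealExpr.zero, outerPairs,
      Memory.vec]
  rw [← v2, ← vec_congr (run_arr_ne h2 (b := 6) rfl), ← vec_congr (run_arr_ne h2 (b := 10) rfl),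
    ← flat_congr (run_arr_ne h2 (b := 4) rfl), ← big_congr (run_arr_ne h2 (b := 5) rfl)]
  clear v2 h2 n1
  generalize h3 : run o precondProgram m2 = m3
  have n3 : m3.nat 0 = d := by rw [run_nat_ne h3 rfl, n2]
  have v3 : (m3.flat 13 : Fin d × Fin d → ℝ) = m2.big 5 *ᵥ m2.flat 12 := by
    rw [← h3, run_precondProgram n2]
  rw [← v3, ← vec_congr (run_arr_ne h3 (b := 6) rfl), ← vec_congr (run_arr_ne h3 (b := 10) rfl),
    ← flat_congr (run_arr_ne h3 (b := 4) rfl), ← flat_congr (run_arr_ne h3 (b := 12) rfl)]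
  clear v3 h3 n2
  generalize h4 : run o (scalarProgram 15 12 13) m3 = m4
  have n4 : m4.nat 0 = d := by rw [run_nat_ne h4 rfl, n3]
  have s4 : m4.arr 15 0 = (m3.flat 12 : Fin d × Fin d → ℝ) ⬝ᵥ m3.flat 13 := by
    rw [← h4, run_scalarProgram n3 (by decide) (by decide)]
  generalize h5 : run o (scalarProgram 14 12 4) m4 = m5
  have n5 : m5.nat 0 = d := by rw [run_nat_ne h5 rfl, n4]
  have s5 : m5.arr 14 0 = (m3.flat 12 : Fin d × Fin d → ℝ) ⬝ᵥ m3.flat 4 := by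
    rw [← h5, run_scalarProgram n4 (by decide) (by decide), flat_congr (run_arr_ne h4 rfl),
      flat_congr (run_arr_ne h4 rfl)]
  generalize h6 : run o (fill 18 _ _ _ _ _ _) m5 = m6
  have n6 : m6.nat 0 = d := by rw [run_nat_ne h6 rfl, n5]
  have s6 : m6.arr 18 0 = (m3.vec 6 : Fin d → ℝ) ⬝ᵥ m3.vec 10 := by
    rw [← h6, scalar_run_dotProduct n5 (by decide) (by decide), vec_congr (run_arr_ne h5 rfl),
      vec_congr (run_arr_ne h4 rfl), vec_congr (run_arr_ne h5 rfl), vec_congr (run_arr_ne h4 rfl)]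
  have t6 : m6.arr 14 0 = (m3.flat 12 : Fin d × Fin d → ℝ) ⬝ᵥ m3.flat 4 := by
    rw [run_arr_ne h6 rfl, s5]
  have u6 : m6.arr 15 0 = (m3.flat 12 : Fin d × Fin d → ℝ) ⬝ᵥ m3.flat 13 := by
    rw [run_arr_ne h6 rfl, run_arr_ne h5 rfl, s4]
  have X6 : m6.arr 4 = m3.arr 4 := by
    rw [run_arr_ne h6 rfl, run_arr_ne h5 rfl, run_arr_ne h4 rfl]
  have D6 : m6.arr 13 = m3.arr 13 := by
    rw [run_arr_ne h6 rfl, run_arr_ne h5 rfl, run_arr_ne h4 rfl]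
  generalize h7 : run o (fill 4 _ _ _ _ _ _) m6 = m7
  have n7 : m7.nat 0 = d := by rw [run_nat_ne h7 rfl, n6]
  have X7 : (m7.flat 4 : Fin d × Fin d → ℝ) = m3.flat 4 +
      ((m3.vec 6 ⬝ᵥ (m3.vec 10 : Fin d → ℝ) - m3.flat 12 ⬝ᵥ (m3.flat 4 : Fin d × Fin d → ℝ)) /
        (m3.flat 12 ⬝ᵥ (m3.flat 13 : Fin d × Fin d → ℝ))) • m3.flat 13 := by
    rw [← h7, flat_run_fill_row o n6 rfl rfl rfl, ← s6, ← t6, ← u6]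
    ext p
    simp [fillValue, Memory.indexed, NatExpr.eval, RealExpr.eval, RealExpr.zero, n6, Memory.flat,
      X6, D6]
  refine ⟨?_, run_resetProgram n7⟩
  rw [← X7]
  exact flat_congr (run_arr_of_not_writes o 4 _ rfl _)

theorem run_searchStepProgram (ho : IsLinearOptimizationOracle P o) {T n : ℕ}
    {V : Matrix (Fin d × Fin d) (Fin d × Fin d) ℝ} {X₀ : Fin d × Fin d → ℝ} {m : Memory}
    (hm : m.nat 0 = d) (hT : m.nat 1 = T) (hV : IsPreconditioner V (m.big 5))
    (hA : Convex ℝ (coordinates P (m.mat 3)))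
    (hA2 : ∀ u ∈ coordinates P (m.mat 3), ∀ i, |u i| ≤ 2)
    (hX₀ : (X₀ - idPairs d) ⬝ᵥ V *ᵥ (X₀ - idPairs d) ≤ radiusSq d T)
    (h : IsSearch T (coordinates P (m.mat 3)) V X₀ n (m.flat 4) (m.vec 6) (m.vec 7) (m.nat 3)) :
    IsSearch T (coordinates P (m.mat 3)) V X₀ (n + 1) ((run o searchStepProgram m).flat 4)
      ((run o searchStepProgram m).vec 6) ((run o searchStepProgram m).vec 7)
      ((run o searchStepProgram m).nat 3) := by
  rw [searchStepProgram, run_ifNat, eval_sampleSizeExpr, hm, hT]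
  split_ifs with hc
  · exact h.skip hc
  · replace hc : m.nat 3 < sampleSize d T := not_le.mp hc
    rw [run_seq, run_ifReal]
    obtain ⟨p1, p2, p3, p4⟩ := run_probeProgram ho hm
    generalize h1 : run o probeProgram m = m1 at p1 p2 p3 p4
    have n1 : m1.nat 0 = d := by rw [run_nat_ne h1 rfl, hm]
    have c1 : m1.nat 3 = m.nat 3 := by rw [run_nat_ne h1 rfl]
    have S1 : (m1.vec 6 : Fin d → ℝ) = m.vec 6 := vec_congr (run_arr_ne h1 rfl)
    have U1 : (m1.vec 7 : Fin d → ℝ) = m.vec 7 := vec_congr (run_arr_ne h1 rfl)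
    have X1 : (m1.flat 4 : Fin d × Fin d → ℝ) = m.flat 4 := flat_congr (run_arr_ne h1 rfl)
    have W1 : (m1.big 5 : Matrix (Fin d × Fin d) (Fin d × Fin d) ℝ) = m.big 5 :=
      big_congr (run_arr_ne h1 rfl)
    have R1 : (m1.mat 3 : Matrix (Fin d) (Fin d) ℝ) = m.mat 3 := mat_congr (run_arr_ne h1 rfl)
    simp only [RealExpr.eval, NatExpr.eval, Nat.cast_one, p4]
    split_ifs with hS
    · obtain ⟨r1, r2, r3⟩ := run_collectProgram (o := o) n1
      have X2 : ((run o collectProgram m1).flat 4 : Fin d × Fin d → ℝ) = m.flat 4 :=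
        (flat_congr (run_arr_of_not_writes o 4 _ rfl _)).trans X1
      rw [r1, r2, r3, X2, S1, U1, c1, p2]
      rw [p2] at hS
      exact h.collect hV hA hA2 hX₀ hc p1 hS
    · obtain ⟨w, w1, w2, w3, w4, w5, w6⟩ := run_projectProgram ho n1
      rw [R1] at w1 w2
      rw [S1] at w2
      rw [w3, w4, w5, w6, S1, X1, W1]
      rw [p2] at hS p3
      exact h.project hV hA2 hc w1 p3 w2 (not_le.mp hS)

/-- The search and the strategy that it produces, after the loss has been processed. -/
theorem run_roundProgram (ho : IsLinearOptimizationOracle P o) {T t k : ℕ}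
    {V : Matrix (Fin d × Fin d) (Fin d × Fin d) ℝ} {reg : (Fin d × Fin d → ℝ) → ℝ} {m : Memory}
    (hm : m.nat 0 = d) (hT : m.nat 1 = T) (hd : 0 < d) (hT0 : 0 < T) (ht : t ≤ T)
    (hA : Convex ℝ (coordinates P (m.mat 3)))
    (hA2 : ∀ u ∈ coordinates P (m.mat 3), ∀ i, |u i| ≤ 2)
    (hst : IsRoundState T (coordinates P (m.mat 3)) t V ((run o gradientProgram m).big 5)
      ((run o gradientProgram m).flat 4) k reg) :
    IsRoundState T (coordinates P (m.mat 3)) t V ((run o roundProgram m).big 5)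
      ((run o roundProgram m).flat 4) k reg ∧
    ((run o roundProgram m).vec 19 : Fin d → ℝ) ∈ coordinates P (m.mat 3) ∧
    (∀ l : Fin d → ℝ, (∀ i, |l i| ≤ 1) → |l ⬝ᵥ ((run o roundProgram m).vec 19 -
      applyPairs ((run o roundProgram m).flat 4) ((run o roundProgram m).vec 19))| ≤
        accuracy T) ∧
    ((run o roundProgram m).vec 0 : Fin d → ℝ) = (m.mat 2)ᵀ *ᵥ (run o roundProgram m).vec 19 := by
  simp only [roundProgram, run_seq]
  generalize h1 : run o gradientProgram m = m1 at hst
  have n1 : m1.nat 0 = d := by rw [run_nat_ne h1 rfl, hm]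
  have T1 : m1.nat 1 = T := by rw [run_nat_ne h1 rfl, hT]
  obtain ⟨r1, r2, r3⟩ := run_resetProgram (o := o) n1
  generalize h2 : run o resetProgram m1 = m2 at r1 r2 r3
  have n2 : m2.nat 0 = d := by rw [run_nat_ne h2 rfl, n1]
  have T2 : m2.nat 1 = T := by rw [run_nat_ne h2 rfl, T1]
  have R2 : m2.arr 3 = m.arr 3 := by rw [run_arr_ne h2 rfl, run_arr_ne h1 rfl]
  have B2 : m2.arr 2 = m.arr 2 := by rw [run_arr_ne h2 rfl, run_arr_ne h1 rfl]
  have W2 : m2.arr 5 = m1.arr 5 := run_arr_ne h2 rfl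
  have X2 : m2.arr 4 = m1.arr 4 := run_arr_ne h2 rfl
  have hV := hst.precond
  have hX₀ := hst.radius_le hd ht hT0
  -- the search
  have search := run_loop_induction o 6 searchLengthExpr searchStepProgram m2
    (fun n m' => m'.nat 0 = d ∧ m'.nat 1 = T ∧ m'.arr 3 = m.arr 3 ∧ m'.arr 5 = m1.arr 5 ∧
      IsSearch T (coordinates P (m.mat 3)) V (m1.flat 4) n (m'.flat 4) (m'.vec 6) (m'.vec 7)
        (m'.nat 3))
    ⟨n2, T2, R2, W2, by
      rw [flat_congr X2, r1, r2, r3]; exact IsSearch.start hX₀⟩ ?_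
  · rw [eval_searchLengthExpr, n2, T2] at search
    generalize h3 : run o (.loop 6 searchLengthExpr searchStepProgram) m2 = m3 at search
    obtain ⟨n3, T3, R3, W3, hs⟩ := search
    have hk : 0 < sampleSize d T := by
      have : 0 < incrementSq d T := by rw [incrementSq]; omega
      exact Nat.mul_pos (Nat.mul_pos hd hT0) this
    have hc := hs.count_eq hV hk
    rw [hc] at hs
    have B3 : m3.arr 2 = m.arr 2 := by rw [run_arr_ne h3 rfl, B2]
    generalize h4 : run o (fill 19 _ _ _ _ _ _) m3 = m4
    have n4 : m4.nat 0 = d := by rw [run_nat_ne h4 rfl, n3]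
    have v4 : (m4.vec 19 : Fin d → ℝ) = (sampleSize d T : ℝ)⁻¹ • m3.vec 7 := by
      rw [← h4, vec_run_fill o n3 rfl rfl rfl]
      ext j
      have e : NatExpr.eval (m3.indexed 0 j 0) sampleSizeExpr = sampleSize d T := by
        have e' : NatExpr.eval (m3.indexed 0 j 0) sampleSizeExpr =
          sampleSize (m3.nat 0) (m3.nat 1) := rfl
        rw [e', n3, T3]
      simp [fillValue, RealExpr.eval, RealExpr.zero, e]
      simp [Memory.indexed, NatExpr.eval, Memory.vec]
      ring
    have B4 : m4.arr 2 = m.arr 2 := by rw [run_arr_ne h4 rfl, B3]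
    generalize h5 : run o (fill 0 _ _ _ _ _ _) m4 = m5
    have v5 : (m5.vec 19 : Fin d → ℝ) = (sampleSize d T : ℝ)⁻¹ • m3.vec 7 :=
      (vec_congr (run_arr_ne h5 rfl)).trans v4
    have p5 : (m5.vec 0 : Fin d → ℝ) = (m.mat 2)ᵀ *ᵥ m4.vec 19 := by
      rw [← h5, vec_run_fill o n4 rfl rfl rfl]
      ext j
      simp [fillValue, Memory.indexed, NatExpr.eval, RealExpr.eval, RealExpr.zero, n4,
        Finset.sum_range, mulVec, dotProduct, Memory.vec, Memory.mat, B4]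
    have X5 : (m5.flat 4 : Fin d × Fin d → ℝ) = m3.flat 4 :=
      flat_congr ((run_arr_ne h5 rfl).trans (run_arr_ne h4 rfl))
    have W5 : (m5.big 5 : Matrix (Fin d × Fin d) (Fin d × Fin d) ℝ) = m1.big 5 :=
      big_congr ((run_arr_ne h5 rfl).trans ((run_arr_ne h4 rfl).trans W3))
    rw [X5, W5, v5, p5, v4]
    refine ⟨hst.of_mono hs.mono, hs.mean_mem hk.ne', fun l hl => ?_, rfl⟩
    exact hs.abs_dotProduct_displacement_le hd hT0 hl
  · rintro n _ m' ⟨a1, a2, a3, a4, a5⟩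
    have e3 : (m'.mat 3 : Matrix (Fin d) (Fin d) ℝ) = m.mat 3 := mat_congr a3
    have e5 : (m'.big 5 : Matrix (Fin d × Fin d) (Fin d × Fin d) ℝ) = m1.big 5 := big_congr a4
    have hnat : ∀ x, x ≠ 6 → (m'.setNat 6 n).nat x = m'.nat x := fun x hx => by
      simp [Memory.setNat, hx]
    refine ⟨?_, ?_, ?_, ?_, ?_⟩
    · rw [run_nat_of_not_writes o 0 _ rfl, hnat 0 (by decide), a1]
    · rw [run_nat_of_not_writes o 1 _ rfl, hnat 1 (by decide), a2]
    · rw [run_arr_of_not_writes o 3 _ rfl]; exact a3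
    · rw [run_arr_of_not_writes o 5 _ rfl]; exact a4
    · have := run_searchStepProgram (m := m'.setNat 6 n) (n := n) (X₀ := m1.flat 4) ho a1 a2
        (by rw [← e5] at hV; exact hV) (by rw [← e3] at hA; exact hA)
        (by rw [← e3] at hA2; exact hA2) hX₀ (by rw [← e3] at a5; exact a5)
      rw [← e3]
      exact this

end

/-! ### The algorithm and its guarantees -/

/-- The algorithm.  If the origin is a strategy, it is played in every round, and there is nothing to
compute. -/
def swapAlgorithm : OnlineAlgorithm where
  init := .ifNat (.const 1) (.var 2) .skip initProgram
  step := .ifNat (.const 1) (.var 2) .skip roundProgram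

/-- It suffices to compare with every single endomorphism. -/
theorem linearSwapRegret_le {d : ℕ} {P : Set (EuclideanSpace ℝ (Fin d))} {T : ℕ}
    {p ℓ : ℕ → EuclideanSpace ℝ (Fin d)} {c : ℝ}
    (h : ∀ φ ∈ linearEndomorphisms P,
      ∑ t ∈ Finset.range T, ⟪ℓ t, p t⟫ - ∑ t ∈ Finset.range T, ⟪ℓ t, φ (p t)⟫ ≤ c) :
    linearSwapRegret P T p ℓ ≤ c := by
  rw [linearSwapRegret, sub_le_comm]
  refine le_csInf ⟨_, Set.mem_image_of_mem _ (show LinearMap.id ∈ linearEndomorphisms P from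
    fun x hx => hx)⟩ ?_
  rintro _ ⟨φ, hφ, rfl⟩
  have := h φ hφ
  linarith

section Cost

variable {d : ℕ} (T : ℕ) (P : Set (EuclideanSpace ℝ (Fin d)))
  (o : EuclideanSpace ℝ (Fin d) → EuclideanSpace ℝ (Fin d)) (ℓ : ℕ → EuclideanSpace ℝ (Fin d))

theorem memory_succ (A : OnlineAlgorithm) (t : ℕ) :
    A.memory T P o ℓ (t + 1) = (run o A.step (A.memory T P o ℓ t)).store 1 (ℓ t) := rfl

theorem memory_params {A : OnlineAlgorithm} (hi : A.init.polyLoops = true)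
    (hs : A.step.polyLoops = true) (t : ℕ) :
    (A.memory T P o ℓ t).nat 0 = d ∧ (A.memory T P o ℓ t).nat 1 = T := by
  induction t with
  | zero =>
    exact ⟨run_nat_of_not_writes o 0 _ (A.init.polyLoops_writesNat hi 0 (by omega)) _,
      run_nat_of_not_writes o 1 _ (A.init.polyLoops_writesNat hi 1 (by omega)) _⟩
  | succ t ih =>
    rw [memory_succ]
    exact ⟨(run_nat_of_not_writes o 0 _ (A.step.polyLoops_writesNat hs 0 (by omega)) _).trans ih.1,
      (run_nat_of_not_writes o 1 _ (A.step.polyLoops_writesNat hs 1 (by omega)) _).trans ih.2⟩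

/-- Algorithms whose loop bounds depend only on the dimension and the horizon are efficient. -/
theorem exists_cost_bound {A : OnlineAlgorithm} (hi : A.init.polyLoops = true)
    (hs : A.step.polyLoops = true) :
    ∃ K : ℕ, ∀ (d T : ℕ) (P : Set (EuclideanSpace ℝ (Fin d)))
      (o : EuclideanSpace ℝ (Fin d) → EuclideanSpace ℝ (Fin d)) (ℓ : ℕ → EuclideanSpace ℝ (Fin d)),
      A.initCost T P o ≤ K * (d + T + 1) ^ K ∧
        ∀ t, A.roundCost T P o ℓ t ≤ K * (d + T + 1) ^ K := by
  obtain ⟨K₁, h₁⟩ := A.init.exists_cost_le_pow hi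
  obtain ⟨K₂, h₂⟩ := A.step.exists_cost_le_pow hs
  refine ⟨2 ^ (K₁ + K₂), fun d T P o ℓ => ?_⟩
  have key : ∀ K, K ≤ K₁ + K₂ →
      (d + T + 2) ^ K ≤ 2 ^ (K₁ + K₂) * (d + T + 1) ^ 2 ^ (K₁ + K₂) := by
    intro K hK
    calc (d + T + 2) ^ K ≤ (d + T + 2) ^ (K₁ + K₂) := Nat.pow_le_pow_right (by omega) hK
      _ ≤ (2 * (d + T + 1)) ^ (K₁ + K₂) := Nat.pow_le_pow_left (by omega) _
      _ = 2 ^ (K₁ + K₂) * (d + T + 1) ^ (K₁ + K₂) := mul_pow _ _ _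
      _ ≤ _ := Nat.mul_le_mul_left _ (Nat.pow_le_pow_right (by omega) Nat.lt_two_pow_self.le)
  constructor
  · have := h₁ d o (initialMemory T P) rfl
    exact this.trans (key K₁ (by omega))
  · intro t
    obtain ⟨e0, e1⟩ := memory_params T P o ℓ hi hs t
    have := h₂ d o (A.memory T P o ℓ t) e0
    rw [e0, e1] at this
    exact this.trans (key K₂ (by omega))

end Cost

section Origin

variable {d : ℕ} {T : ℕ} {P : Set (EuclideanSpace ℝ (Fin d))}
  {o : EuclideanSpace ℝ (Fin d) → EuclideanSpace ℝ (Fin d)} {ℓ : ℕ → EuclideanSpace ℝ (Fin d)}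

theorem strategy_eq_zero (h0 : 0 ∈ P) (t : ℕ) : swapAlgorithm.strategy T P o ℓ t = 0 := by
  have hrun : ∀ m : Memory, m.nat 2 = 1 → run o swapAlgorithm.step m = m := fun m hm => by
    rw [swapAlgorithm, run_ifNat, if_pos (by simp [NatExpr.eval, hm]), run_skip]
  have key : ∀ t, (swapAlgorithm.memory T P o ℓ t).nat 2 = 1 ∧
      (swapAlgorithm.memory T P o ℓ t).arr 0 = 0 := by
    intro t
    induction t with
    | zero =>
      have e : (initialMemory T P).nat 2 = 1 := by simp [initialMemory, h0]
      have : swapAlgorithm.memory T P o ℓ 0 = initialMemory T P := by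
        change run o swapAlgorithm.init (initialMemory T P) = _
        rw [swapAlgorithm, run_ifNat, if_pos (by simp [NatExpr.eval, e]), run_skip]
      rw [this]
      exact ⟨e, rfl⟩
    | succ t ih =>
      rw [memory_succ, hrun _ ih.1, arr_store_ne _ (by decide)]
      exact ⟨ih.1, ih.2⟩
  change (run o swapAlgorithm.step (swapAlgorithm.memory T P o ℓ t)).load 0 = 0
  rw [hrun _ (key t).1]
  ext i
  simp [Memory.load, (key t).2]

end Origin

section Geometry

variable {d : ℕ} {P : Set (EuclideanSpace ℝ (Fin d))} {B R : Matrix (Fin d) (Fin d) ℝ}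

/-- A set with an interior point is not contained in a hyperplane through the origin. -/
theorem exists_dotProduct_ne_zero (hP : (interior P).Nonempty) (r : Fin d → ℝ) (hr : r ≠ 0) :
    ∃ p ∈ points P, r ⬝ᵥ p ≠ 0 := by
  by_contra! hall
  obtain ⟨x, hx⟩ := hP
  set v : EuclideanSpace ℝ (Fin d) := WithLp.toLp 2 r with hv
  have hcont : Continuous fun s : ℝ => x + s • v := by fun_prop
  have hopen : IsOpen ((fun s : ℝ => x + s • v) ⁻¹' interior P) :=
    isOpen_interior.preimage hcont
  obtain ⟨ε, hε, hball⟩ := Metric.isOpen_iff.mp hopen 0 (by simpa using hx)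
  have hmem : ∀ s : ℝ, |s| < ε → r ⬝ᵥ (x.ofLp + s • r) = 0 := fun s hs =>
    hall _ (show WithLp.toLp 2 (x.ofLp + s • r) ∈ P from
      interior_subset (hball (by simpa [Real.dist_eq] using hs)))
  have h1 := hmem 0 (by simpa using hε)
  have h2 := hmem (ε / 2) (by rw [abs_of_pos (by positivity)]; linarith)
  rw [zero_smul, add_zero] at h1
  rw [dotProduct_add, h1, zero_add, dotProduct_smul, smul_eq_mul] at h2
  have h3 : r ⬝ᵥ r = 0 := (mul_eq_zero.mp h2).resolve_left (by positivity)
  exact hr (dotProduct_self_eq_zero.mp h3)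

theorem convex_coordinates (hP : Convex ℝ P) : Convex ℝ (coordinates P R) := by
  rintro _ ⟨p, hp, rfl⟩ _ ⟨q, hq, rfl⟩ a b ha hb hab
  refine ⟨a • p + b • q, hP hp hq ha hb hab, ?_⟩
  simp only [mulVec_add, mulVec_smul]

theorem single_mem_coordinates (h : R * Bᵀ = 1) (hB : ∀ j, B j ∈ points P) (i : Fin d) :
    Pi.single i 1 ∈ coordinates P R := by
  refine ⟨B i, hB i, ?_⟩
  ext j
  have := mul_transpose_eq_one_iff.mp h j i
  simpa [mulVec, Pi.single_apply] using this

/-- The matrix of `φ` with respect to the basis `B`, whose dual basis is `R`. -/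
noncomputable def pairsOfLinearMap (B R : Matrix (Fin d) (Fin d) ℝ)
    (φ : EuclideanSpace ℝ (Fin d) →ₗ[ℝ] EuclideanSpace ℝ (Fin d)) : Fin d × Fin d → ℝ :=
  fun q => R q.1 ⬝ᵥ (φ (WithLp.toLp 2 (B q.2))).ofLp

theorem applyPairs_pairsOfLinearMap (h : R * Bᵀ = 1)
    (φ : EuclideanSpace ℝ (Fin d) →ₗ[ℝ] EuclideanSpace ℝ (Fin d)) (p : Fin d → ℝ) :
    applyPairs (pairsOfLinearMap B R φ) (R *ᵥ p) = R *ᵥ (φ (WithLp.toLp 2 p)).ofLp := by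
  have e : (φ (WithLp.toLp 2 p)).ofLp = ∑ k, (R k ⬝ᵥ p) • (φ (WithLp.toLp 2 (B k))).ofLp := by
    conv_lhs => rw [eq_sum_of_mul_transpose_eq_one h p]
    simp only [WithLp.toLp_sum, WithLp.toLp_smul, map_sum, map_smul, WithLp.ofLp_sum,
      WithLp.ofLp_smul]
  ext i
  rw [e]
  simp only [applyPairs, pairsOfLinearMap, mulVec, dotProduct_sum, dotProduct_smul, smul_eq_mul]
  exact Finset.sum_congr rfl fun j _ => mul_comm _ _

theorem pairsOfLinearMap_mem_endoPairs (h : R * Bᵀ = 1)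
    {φ : EuclideanSpace ℝ (Fin d) →ₗ[ℝ] EuclideanSpace ℝ (Fin d)}
    (hφ : φ ∈ linearEndomorphisms P) : pairsOfLinearMap B R φ ∈ endoPairs (coordinates P R) := by
  rintro _ ⟨p, hp, rfl⟩
  rw [applyPairs_pairsOfLinearMap h]
  exact ⟨_, hφ hp, rfl⟩

theorem mulVec_dotProduct_mulVec (h : R * Bᵀ = 1) (l p : Fin d → ℝ) :
    (B *ᵥ l) ⬝ᵥ (R *ᵥ p) = l ⬝ᵥ p := by
  have h' : Bᵀ * R = 1 := mul_eq_one_comm.mp h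
  rw [dotProduct_comm, dotProduct_mulVec, ← mulVec_transpose, mulVec_mulVec, h', one_mulVec,
    dotProduct_comm]

end Geometry

section Away

variable {d : ℕ} {T : ℕ} {P : Set (EuclideanSpace ℝ (Fin d))}
  {o : EuclideanSpace ℝ (Fin d) → EuclideanSpace ℝ (Fin d)} {ℓ : ℕ → EuclideanSpace ℝ (Fin d)}

/-- The regret of the first `t` rounds with respect to `Y`, in coordinates. -/
noncomputable def coordRegret (B R : Matrix (Fin d) (Fin d) ℝ)
    (p ℓ : ℕ → EuclideanSpace ℝ (Fin d)) (t : ℕ) (Y : Fin d × Fin d → ℝ) : ℝ :=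
  ∑ s ∈ Finset.range t, ((B *ᵥ (ℓ s).ofLp) ⬝ᵥ (R *ᵥ (p s).ofLp) -
    (B *ᵥ (ℓ s).ofLp) ⬝ᵥ applyPairs Y (R *ᵥ (p s).ofLp))

/-- The memory after the computation of a round in which `t` losses are known. -/
structure IsGoodMemory (T : ℕ) (P : Set (EuclideanSpace ℝ (Fin d)))
    (B R : Matrix (Fin d) (Fin d) ℝ) (p ℓ : ℕ → EuclideanSpace ℝ (Fin d)) (t : ℕ) (m : Memory) :
    Prop where
  basis : m.mat 2 = B
  dual : m.mat 3 = R
  flag : m.nat 2 = 0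
  state : ∃ V k, IsRoundState T (coordinates P R) t V (m.big 5) (m.flat 4) k
    (coordRegret B R p ℓ t)
  mem : m.vec 19 ∈ coordinates P R
  fixed : ∀ l : Fin d → ℝ, (∀ i, |l i| ≤ 1) →
    |l ⬝ᵥ (m.vec 19 - applyPairs (m.flat 4) (m.vec 19))| ≤ accuracy T
  strategy : m.vec 0 = Bᵀ *ᵥ m.vec 19

theorem run_step_of_flag {m : Memory} (h : m.nat 2 = 0) :
    run o swapAlgorithm.step m = run o roundProgram m := by
  rw [swapAlgorithm, run_ifNat, if_neg (by simp [NatExpr.eval, h])]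

/-- The state of the memory in all rounds when the origin is not a strategy. -/
theorem exists_isGoodMemory (hd : 0 < d) (hT : 0 < T) (h0 : 0 ∉ P) (hP : Convex ℝ P)
    (hPi : (interior P).Nonempty) (ho : IsLinearOptimizationOracle P o)
    (hℓ : ∀ t < T, ∀ p ∈ P, |⟪p, ℓ t⟫| ≤ 1) :
    ∃ B R : Matrix (Fin d) (Fin d) ℝ, R * Bᵀ = 1 ∧ (∀ j, B j ∈ points P) ∧
      (∀ u ∈ coordinates P R, ∀ i, |u i| ≤ 2) ∧
      ∀ t ≤ T, IsGoodMemory T P B R (swapAlgorithm.strategy T P o ℓ) ℓ t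
        (run o swapAlgorithm.step (swapAlgorithm.memory T P o ℓ t)) := by
  have hflag : (initialMemory T P).nat 2 = 0 := by simp [initialMemory, h0]
  have hmem0 : swapAlgorithm.memory T P o ℓ 0 = run o initProgram (initialMemory T P) := by
    change run o swapAlgorithm.init (initialMemory T P) = _
    rw [swapAlgorithm, run_ifNat, if_neg (by simp [NatExpr.eval, hflag])]
  obtain ⟨i1, i2, i3, i4, i5⟩ := run_initProgram ho (exists_dotProduct_ne_zero hPi)
    (m := initialMemory T P) rfl
  rw [← hmem0] at i1 i2 i3 i4 i5
  set B : Matrix (Fin d) (Fin d) ℝ := (swapAlgorithm.memory T P o ℓ 0).mat 2 with hB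
  set R : Matrix (Fin d) (Fin d) ℝ := (swapAlgorithm.memory T P o ℓ 0).mat 3 with hR
  have hA : Convex ℝ (coordinates P R) := convex_coordinates hP
  have hA2 : ∀ u ∈ coordinates P R, ∀ i, |u i| ≤ 2 := by
    rintro _ ⟨p, hp, rfl⟩ i
    exact i3 i p hp
  have hl : ∀ t < T, ∀ i, |(B *ᵥ (ℓ t).ofLp) i| ≤ 1 := by
    intro t ht i
    have := hℓ t ht _ (i2 i)
    rwa [real_inner_eq_dotProduct] at this
  have hlA : ∀ t < T, ∀ u ∈ coordinates P R, |(B *ᵥ (ℓ t).ofLp) ⬝ᵥ u| ≤ 1 := by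
    rintro t ht _ ⟨p, hp, rfl⟩
    rw [mulVec_dotProduct_mulVec i1, dotProduct_comm]
    have := hℓ t ht _ hp
    rwa [real_inner_eq_dotProduct] at this
  refine ⟨B, R, i1, i2, hA2, fun t => ?_⟩
  -- the round program turns a state after the gradient step into a good memory
  have finish : ∀ t ≤ T, ∀ m : Memory, m.nat 0 = d → m.nat 1 = T → m.nat 2 = 0 →
      m.mat 2 = B → m.mat 3 = R →
      (∃ V k, IsRoundState T (coordinates P R) t V ((run o gradientProgram m).big 5)
        ((run o gradientProgram m).flat 4) k
        (coordRegret B R (swapAlgorithm.strategy T P o ℓ) ℓ t)) →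
      IsGoodMemory T P B R (swapAlgorithm.strategy T P o ℓ) ℓ t (run o swapAlgorithm.step m) := by
    rintro t ht m m0 m1 m2 mB mR ⟨V, k, hst⟩
    rw [run_step_of_flag m2]
    obtain ⟨r1, r2, r3, r4⟩ := run_roundProgram ho m0 m1 hd hT ht (by rw [mR]; exact hA)
      (by rw [mR]; exact hA2) (by rw [mR]; exact hst)
    rw [mR] at r1 r2
    rw [mB] at r4
    exact ⟨(mat_congr (run_arr_of_not_writes o 2 _ rfl _)).trans mB,
      (mat_congr (run_arr_of_not_writes o 3 _ rfl _)).trans mR,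
      (run_nat_of_not_writes o 2 _ rfl _).trans m2, ⟨V, k, r1⟩, r2, r3, r4⟩
  induction t with
  | zero =>
    intro _
    obtain ⟨e0, e1⟩ := memory_params (A := swapAlgorithm) T P o ℓ rfl rfl 0
    refine finish 0 (Nat.zero_le _) _ e0 e1 ?_ rfl rfl ?_
    · rw [hmem0, run_nat_of_not_writes o 2 _ rfl, hflag]
    · -- before the first round the array of the loss is zero, so that the state does not change
      have z : ((swapAlgorithm.memory T P o ℓ 0).vec 1 : Fin d → ℝ) = 0 := by
        have : (swapAlgorithm.memory T P o ℓ 0).arr 1 = (initialMemory T P).arr 1 := by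
          rw [hmem0]; exact run_arr_of_not_writes o 1 _ rfl _
        exact vec_congr this
      have hG : (0 : Fin d × Fin d → ℝ) = outerPairs
          ((swapAlgorithm.memory T P o ℓ 0).mat 2 *ᵥ (swapAlgorithm.memory T P o ℓ 0).vec 1)
          ((swapAlgorithm.memory T P o ℓ 0).vec 19) := by
        rw [z, mulVec_zero]
        ext p
        simp [outerPairs]
      obtain ⟨g1, g2⟩ := (run_gradientProgram (o := o) e0 e1 hG).1 (by simp)
      rw [mulVec_zero, smul_zero, sub_zero, i4] at g2
      rw [i5] at g1
      refine ⟨1, 0, ?_⟩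
      rw [g1, g2]
      convert IsRoundState.start T (coordinates P R) using 1
      funext Y
      simp [coordRegret]
  | succ t ih =>
    intro ht
    have h := ih (by omega)
    set m := run o swapAlgorithm.step (swapAlgorithm.memory T P o ℓ t) with hm
    obtain ⟨e0, e1⟩ := memory_params (A := swapAlgorithm) T P o ℓ rfl rfl (t + 1)
    have hsucc : swapAlgorithm.memory T P o ℓ (t + 1) = m.store 1 (ℓ t) := rfl
    rw [hsucc] at e0 e1 ⊢
    have fr : ∀ b, b ≠ 1 → (m.store 1 (ℓ t)).arr b = m.arr b := fun b hb => arr_store_ne m hb _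
    have mB : (m.store 1 (ℓ t)).mat 2 = B := (mat_congr (fr 2 (by decide))).trans h.basis
    have mR : (m.store 1 (ℓ t)).mat 3 = R := (mat_congr (fr 3 (by decide))).trans h.dual
    refine finish (t + 1) ht _ e0 e1 h.flag mB mR ?_
    obtain ⟨V, k, hst⟩ := h.state
    set u : Fin d → ℝ := m.vec 19 with hu
    have eu : ((m.store 1 (ℓ t)).vec 19 : Fin d → ℝ) = u := vec_congr (fr 19 (by decide))
    have eX : ((m.store 1 (ℓ t)).flat 4 : Fin d × Fin d → ℝ) = m.flat 4 :=
      flat_congr (fr 4 (by decide))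
    have eW : ((m.store 1 (ℓ t)).big 5 : Matrix (Fin d × Fin d) (Fin d × Fin d) ℝ) = m.big 5 :=
      big_congr (fr 5 (by decide))
    have hstep := hst.gradient_step hd hT hA2 (hl t ht) (hlA t ht) h.mem (h.fixed _ (hl t ht))
    have hprog := run_gradientProgram (o := o) e0 e1
      (G := outerPairs (B *ᵥ (ℓ t).ofLp) u) (by rw [mB, vec_store_self, eu])
    rw [eX, eW] at hprog
    -- the point `u` consists of the coordinates of the strategy
    have hRp : R *ᵥ (swapAlgorithm.strategy T P o ℓ t).ofLp = u := by
      have : (swapAlgorithm.strategy T P o ℓ t).ofLp = Bᵀ *ᵥ u := h.strategy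
      rw [this, mulVec_mulVec, i1, one_mulVec]
    have hreg : coordRegret B R (swapAlgorithm.strategy T P o ℓ) ℓ (t + 1) = fun Y =>
        coordRegret B R (swapAlgorithm.strategy T P o ℓ) ℓ t Y +
          ((B *ᵥ (ℓ t).ofLp) ⬝ᵥ u - (B *ᵥ (ℓ t).ofLp) ⬝ᵥ applyPairs Y u) := by
      funext Y
      rw [coordRegret, Finset.sum_range_succ, hRp]
      rfl
    rw [hreg]
    by_cases hle : outerPairs (B *ᵥ (ℓ t).ofLp) u ⬝ᵥ
        m.big 5 *ᵥ outerPairs (B *ᵥ (ℓ t).ofLp) u ≤ d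
    · obtain ⟨g1, g2⟩ := hprog.1 hle
      rw [g1, g2]
      exact ⟨V, k, hstep.1 hle⟩
    · obtain ⟨g1, g2⟩ := hprog.2 hle
      rw [g2]
      exact ⟨_, _, hstep.2 _ hle g1⟩

end Away

/-- The strategies are feasible, and the regret is at most `42 d^(3/2) √T`. -/
theorem swapAlgorithm_spec {d : ℕ} (T : ℕ) {P L : Set (EuclideanSpace ℝ (Fin d))}
    (hP : Convex ℝ P) (hPi : (interior P).Nonempty) (hL1 : ∀ p ∈ P, ∀ l ∈ L, ⟪p, l⟫ ≤ 1)
    (hL2 : 0 ∉ P → ∀ p ∈ P, ∀ l ∈ L, -1 ≤ ⟪p, l⟫)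
    {o : EuclideanSpace ℝ (Fin d) → EuclideanSpace ℝ (Fin d)}
    (ho : IsLinearOptimizationOracle P o) {ℓ : ℕ → EuclideanSpace ℝ (Fin d)}
    (hℓ : ∀ t < T, ℓ t ∈ L) :
    (∀ t < T, swapAlgorithm.strategy T P o ℓ t ∈ P) ∧
      linearSwapRegret P T (swapAlgorithm.strategy T P o ℓ) ℓ ≤
        42 * (d : ℝ) ^ (3 / 2 : ℝ) * √(T : ℝ) := by
  by_cases h0 : 0 ∈ P
  · -- the origin is a fixed point of every linear map
    refine ⟨fun t _ => by rwa [strategy_eq_zero h0], linearSwapRegret_le fun φ _ => ?_⟩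
    simp only [strategy_eq_zero h0, map_zero, inner_zero_right, Finset.sum_const_zero, sub_zero]
    positivity
  · rcases Nat.eq_zero_or_pos T with rfl | hT
    · exact ⟨fun t ht => absurd ht (Nat.not_lt_zero t), linearSwapRegret_le fun φ _ => by simp⟩
    have hd : 0 < d := by
      rcases Nat.eq_zero_or_pos d with rfl | hd
      · obtain ⟨x, hx⟩ := hPi
        exact absurd (by rw [Subsingleton.elim 0 x]; exact interior_subset hx) h0
      · exact hd
    obtain ⟨B, R, h1, h2, hA2, hgood⟩ := exists_isGoodMemory hd hT h0 hP hPi ho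
      (fun t ht p hp => abs_le.mpr ⟨hL2 h0 p hp _ (hℓ t ht), hL1 p hp _ (hℓ t ht)⟩)
    constructor
    · intro t ht
      have h := hgood t ht.le
      obtain ⟨p, hp, hpu⟩ := h.mem
      have e : (swapAlgorithm.strategy T P o ℓ t).ofLp = p := by
        have e1 : (swapAlgorithm.strategy T P o ℓ t).ofLp = _ := h.strategy
        have e2 : Bᵀ * R = 1 := mul_eq_one_comm.mp h1
        rw [e1, ← hpu]
        simp only [mulVec_mulVec, e2, one_mulVec]
      have : WithLp.toLp 2 (swapAlgorithm.strategy T P o ℓ t).ofLp ∈ P := by rw [e]; exact hp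
      exact this
    · refine linearSwapRegret_le fun φ hφ => ?_
      obtain ⟨V, k, hst⟩ := (hgood T le_rfl).state
      have hreg := hst.reg_le hd hT hA2 (single_mem_coordinates h1 h2)
        (pairsOfLinearMap_mem_endoPairs h1 hφ)
      refine le_trans (le_of_eq ?_) hreg
      rw [coordRegret, ← Finset.sum_sub_distrib]
      refine Finset.sum_congr rfl fun t _ => ?_
      rw [applyPairs_pairsOfLinearMap h1, mulVec_dotProduct_mulVec h1,
        mulVec_dotProduct_mulVec h1, real_inner_eq_dotProduct, real_inner_eq_dotProduct]

end RealRAM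

end

theorem mainTheorem3 :
    ∃ (A : RealRAM.OnlineAlgorithm) (C : ℝ) (K : ℕ),
      ∀ (d T : ℕ) (P L : Set (EuclideanSpace ℝ (Fin d))),
        Convex ℝ P → IsCompact P → (interior P).Nonempty →
        (∀ p ∈ P, ∀ l ∈ L, ⟪p, l⟫ ≤ 1) →
        (0 ∉ P → ∀ p ∈ P, ∀ l ∈ L, -1 ≤ ⟪p, l⟫) →
        ∀ o : EuclideanSpace ℝ (Fin d) → EuclideanSpace ℝ (Fin d),
          IsLinearOptimizationOracle P o →
          ∀ ℓ : ℕ → EuclideanSpace ℝ (Fin d), (∀ t < T, ℓ t ∈ L) →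
            (∀ t < T, A.strategy T P o ℓ t ∈ P) ∧
            linearSwapRegret P T (A.strategy T P o ℓ) ℓ ≤ C * (d : ℝ) ^ (3 / 2 : ℝ) * √(T : ℝ) ∧
            A.initCost T P o ≤ K * (d + T + 1) ^ K ∧
            ∀ t < T, A.roundCost T P o ℓ t ≤ K * (d + T + 1) ^ K := by
  obtain ⟨K, hK⟩ := RealRAM.exists_cost_bound (A := RealRAM.swapAlgorithm) rfl rfl
  refine ⟨RealRAM.swapAlgorithm, 42, K, fun d T P L hP _ hPi hL1 hL2 o ho ℓ hℓ => ?_⟩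
  obtain ⟨hmem, hreg⟩ := RealRAM.swapAlgorithm_spec T hP hPi hL1 hL2 ho hℓ
  obtain ⟨hinit, hround⟩ := hK d T P o ℓ
  exact ⟨hmem, hreg, hinit, fun t _ => hround t⟩
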